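/- **Setting.** Let $\mathbb X$ be a finite (geometric) simplicial complex whose underlying space is a connected $d$-manifold, $d\ge 2$. A scalar field is an injective function $f:V(\mathbb X)\to\mathbb R$. Its *augmented merge tree* $\mathcal T_f$ has node set $V(\mathbb X)$ and an edge $(y,x)$ (child $y$, parent $x$) iff $y$ is the lowest vertex of a connected component $Y$ of the superlevel set $\{v: f(v)>f(x)\}$ and $x$ is adjacent to a vertex of $Y$. A non-root vertex is a maximum, regular, or a saddle if it has $0$, $1$, or more than $1$ children in $\mathcal T_f$. The *merge tree* $T_f$ is obtained by pruning all regular vertices (their two incident edges are merged into one). A path $b_1\dots b_k$ ($k\ge2$) has edges $(b_i,b_{i-1})$. The branch decomposition of $T_f$ is given by the elder rule: branches are tracked downwards from the maxima; where branches meet, the one with the highest maximum continues and the others stop. $\mathrm{BDT}(T_f)$ is the tree of these branches; $b_1\dots b_k$ is the parent of $a_1\dots a_l$ if $a_1=b_i$ for some $1<i<k$. The ordered tree $\mathrm{OBDT}(T_f)$ also carries the partial order on the children of a branch given by the positions of their first nodes. $\mathcal B_f(v)$ is the branch containing $v$ at a position other than the first. Two scalar fields $f,f'$ on $\mathbb X$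 differ by a *minimal vertex perturbation* of $x$ if $f(x)\ne f'(x)$, $f=f'$ on all other vertices, and either the vertex orderings agree or they differ exactly by exchanging $x$ with one vertex $y$ that is adjacent to $x$ in the ordering; in the latter case, if $f'(x)>f(x)$, we say that $x$ passes $y$. Inclusions ("$\subseteq$") are subgraph relations up to renaming of the two vertices $x,y$: the vertices may be renamed by a permutation fixing all vertices other than $x,y$; branches are identified by their first and last nodes; for OBDTs the sibling order has to be preserved and reflected. Two fields differ by * a *simple change* if $T_f,T_{f'}$ are nested (one is included in the other) and $\mathrm{OBDT}(T_f),\mathrm{OBDT}(T_{f'})$ are nested; * a *vertical swap* if $T_f,T_{f'}$ are nested but the OBDTs are not; * an *edge split* if $T_f,T_{f'}$ are not nested but the OBDTs are; * a *horizontal swap* if neither the trees nor the OBDTs are nested. **Lemma.** Let $f,f'$ be scalar fields on $\mathbb X$ that differ by a minimal vertex perturbation of $x$ passing $y$, with $f'(x)>f(x)$. 1. If they differ by a vertical swap, then $T_f=T_{f'}$ (literally), exactly one node of the tree has a different scalar value and exactly one edge has a different length $|f(c)-f(p)|$; $x$ and $y$ are maxima in both trees, $\mathcal B_f(y)$ is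 a parent of $\mathcal B_f(x)$, and $\mathcal B_{f'}(x)$ is a parent of $\mathcal B_{f'}(y)$. 2. If they differ by an edge split with $\mathrm{BDT}(T_f)\subseteq\mathrm{BDT}(T_{f'})$, then $V(T_{f'})=V(T_f)\mathbin{\dot\cup}\{x,y\}$ and, for some $(c,p)\in E(T_f)$, $E(T_{f'})=(E(T_f)\setminus\{(c,p)\})\cup\{(x,y),(c,y),(y,p)\}$ and $V(\mathrm{BDT}(T_{f'}))=V(\mathrm{BDT}(T_f))\cup\{yx\}$, where the branch of $T_f$ through $(c,p)$ is identified with the branch obtained by inserting $y$ between $p$ and $c$. 3. If they differ by a horizontal swap, then one of the following holds: (a) $(y,x)\in E(T_f)$, $(x,y)\in E(T_{f'})$, and $x,y$ are saddles in both fields; (b) exactly one of $x,y$ is a node of $T_f$, it is a saddle there, $(x,y)\in E(T_{f'})$, and $x,y$ are both saddles of $f'$; (c) the inverse of (b): exactly one of $x,y$ is a node of $T_{f'}$, it is a saddle there, $(y,x)\in E(T_f)$, and $x,y$ are both saddles of $f$. 4. If they differ by a simple change, then either $T_f=T_{f'}$ and $\mathrm{BDT}(T_f)=\mathrm{BDT}(T_{f'})$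 up to one common renaming of $x,y$, or $|V(T)|$, $|E(T)|$, $|V(\mathrm{BDT})|$ and $|E(\mathrm{BDT})|$ each differ by exactly $1$ between the two fields. -/

import Mathlib

/-- A directed graph given by a set of vertices and a set of edges, an edge `(c, p)` pointing from
a child `c` to its parent `p`.  All trees below are values of this type. -/
@[ext]
structure ParentGraph (α : Type*) where
  verts : Set α
  edges : Set (α × α)

namespace ParentGraph

variable {α β : Type*}

/-- The children of a node. -/
def children (T : ParentGraph α) (v : α) : Set α := {c | (c, v) ∈ T.edges}

/-- The degree of a node is its number of children. -/
noncomputable def deg (T : ParentGraph α) (v : α) : ℕ := (T.children v).ncard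

/-- A root is a sink, i.e. a node without a parent. -/
def IsRoot (T : ParentGraph α) (v : α) : Prop := v ∈ T.verts ∧ ∀ p, (v, p) ∉ T.edges

/-- A leaf is a node without children. -/
def IsLeaf (T : ParentGraph α) (v : α) : Prop := v ∈ T.verts ∧ ∀ c, (c, v) ∉ T.edges

/-- Renaming of the vertices. -/
def map (φ : α → β) (T : ParentGraph α) : ParentGraph β where
  verts := φ '' T.verts
  edges := (Prod.map φ φ) '' T.edges

/-- The subgraph relation. -/
def IsSubgraph (T T' : ParentGraph α) : Prop := T.verts ⊆ T'.verts ∧ T.edges ⊆ T'.edges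

/-- `u` lies in the subtree rooted at `v` (possibly `u = v`). -/
def InSubtree (T : ParentGraph α) (u v : α) : Prop :=
  Relation.ReflTransGen (fun a b => (a, b) ∈ T.edges) u v

/-- A path `v₁ … vₖ`, `k ≥ 2`, runs away from the root: `(vᵢ, vᵢ₋₁)` is an edge. -/
def IsPath (T : ParentGraph α) (p : List α) : Prop :=
  2 ≤ p.length ∧ p.IsChain (fun u v => (v, u) ∈ T.edges)

/-- `m` is the leaf with the largest value in the subtree rooted at `v`. -/
def IsHighestLeaf (T : ParentGraph α) (f : α → ℝ) (v m : α) : Prop :=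
  T.IsLeaf m ∧ T.InSubtree m v ∧ ∀ m', T.IsLeaf m' → T.InSubtree m' v → f m' ≤ f m

/-- The branches `b = b₁ … bₖ` of the persistence-based branch decomposition (elder rule).
The branch tracked from the leaf `m = bₖ` is continued through every node where it is the longest
of the branches that meet there, i.e. where `m` is the highest leaf of the subtree of that node,
and it is stopped at the first node `s = b₁` where this fails, or at the root. -/
def IsElderBranch (T : ParentGraph α) (f : α → ℝ) (b : List α) : Prop :=
  T.IsPath b ∧ ∃ s m, b.head? = some s ∧ b.getLast? = some m ∧ T.IsLeaf m ∧
    (∀ v ∈ b.tail, T.IsHighestLeaf f v m) ∧ (T.IsRoot s ∨ ¬ T.IsHighestLeaf f s m)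

/-- The persistence-based branch decomposition, a set of paths. -/
def branchDecomposition (T : ParentGraph α) (f : α → ℝ) : Set (List α) :=
  {b | T.IsElderBranch f b}

/-- `b` is the branch containing `v` at a position other than the first one. -/
def IsBranchAt (T : ParentGraph α) (f : α → ℝ) (v : α) (b : List α) : Prop :=
  b ∈ T.branchDecomposition f ∧ v ∈ b.tail

end ParentGraph

/-- `b = b₁ … bₖ` is a parent branch of `a = a₁ … aₗ` if `a₁ = bᵢ` for some `1 < i < k`
(indices of lists start at `0`). -/
def IsParentBranch {α : Type*} (b a : List α) : Prop :=
  ∃ s, a.head? = some s ∧ ∃ i, 0 < i ∧ i + 1 < b.length ∧ b[i]? = some s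

/-- For child branches `a`, `b` of `q`: `a` starts at an earlier node of `q` than `b`. -/
def StartsBefore {α : Type*} (q a b : List α) : Prop :=
  ∃ i j, i < j ∧ j < q.length ∧ q[i]? = a.head? ∧ q[j]? = b.head?

/-- The (unordered) branch decomposition tree. -/
def branchDecompositionTree {α : Type*} (T : ParentGraph α) (f : α → ℝ) :
    ParentGraph (List α) where
  verts := T.branchDecomposition f
  edges := {e | e.1 ∈ T.branchDecomposition f ∧ e.2 ∈ T.branchDecomposition f ∧
    IsParentBranch e.2 e.1}

section MergeTree

variable {V : Type*}

/-- `(y, x)` is an edge of the augmented merge tree: `y` is the lowest vertex of some connected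
component `C` of the superlevel set above `f x`, and `x` is adjacent to a vertex of `C`. -/
def IsAugmentedEdge (G : SimpleGraph V) (f : V → ℝ) (y x : V) : Prop :=
  ∃ C : (G.induce {u | f x < f u}).ConnectedComponent,
    (∃ z ∈ C.supp, (z : V) = y) ∧ (∀ z ∈ C.supp, f y ≤ f z) ∧ ∃ z ∈ C.supp, G.Adj x z

/-- The augmented merge tree (split tree) of a scalar field. -/
def augmentedMergeTree (G : SimpleGraph V) (f : V → ℝ) : ParentGraph V where
  verts := Set.univ
  edges := {e | IsAugmentedEdge G f e.1 e.2}

/-- Regular vertices: not the root, and exactly one child in the augmented merge tree. -/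
def IsRegularVertex (G : SimpleGraph V) (f : V → ℝ) (v : V) : Prop :=
  ¬ (augmentedMergeTree G f).IsRoot v ∧ (augmentedMergeTree G f).deg v = 1

/-- Maximum vertices: no child in the augmented merge tree. -/
def IsMaximumVertex (G : SimpleGraph V) (f : V → ℝ) (v : V) : Prop :=
  ¬ (augmentedMergeTree G f).IsRoot v ∧ (augmentedMergeTree G f).deg v = 0

/-- Saddle vertices: more than one child in the augmented merge tree. -/
def IsSaddleVertex (G : SimpleGraph V) (f : V → ℝ) (v : V) : Prop :=
  ¬ (augmentedMergeTree G f).IsRoot v ∧ 1 < (augmentedMergeTree G f).deg v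

/-- `PrunedPath G f a b`: the augmented merge tree has a directed path from `a` down to `b` all of
whose inner vertices are regular. -/
inductive PrunedPath (G : SimpleGraph V) (f : V → ℝ) : V → V → Prop
  | edge {a b : V} : IsAugmentedEdge G f a b → PrunedPath G f a b
  | step {a r b : V} : IsAugmentedEdge G f a r → IsRegularVertex G f r →
      PrunedPath G f r b → PrunedPath G f a b

/-- The unaugmented merge tree: all regular vertices of the augmented merge tree are pruned. -/
def mergeTree (G : SimpleGraph V) (f : V → ℝ) : ParentGraph V where
  verts := {v | ¬ IsRegularVertex G f v}
  edges := {e | ¬ IsRegularVertex G f e.1 ∧ ¬ IsRegularVertex G f e.2 ∧ PrunedPath G f e.1 e.2}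

/-- The branch decomposition tree of the unaugmented merge tree. -/
def bdt (G : SimpleGraph V) (f : V → ℝ) : ParentGraph (List V) :=
  branchDecompositionTree (mergeTree G f) f

/-! ### Subgraph relations up to renaming -/

/-- `σ` renames no vertices other than `x` and `y`. -/
def RenamesOnly (x y : V) (σ : Equiv.Perm V) : Prop := ∀ v, v ≠ x → v ≠ y → σ v = v

/-- `φ` embeds the first branch decomposition tree into the second one, where branches are
identified by their first and last nodes, up to the renaming `σ` of nodes. -/
def IsBranchEmbedding (σ : Equiv.Perm V) (D D' : ParentGraph (List V))
    (φ : List V → List V) : Prop :=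
  Set.InjOn φ D.verts ∧
  (∀ b ∈ D.verts, φ b ∈ D'.verts ∧ (φ b).head? = b.head?.map σ ∧
    (φ b).getLast? = b.getLast?.map σ) ∧
  ∀ a b, (a, b) ∈ D.edges → (φ a, φ b) ∈ D'.edges

/-- `φ` is consistent with the orderings of the children of each branch. -/
def PreservesSiblingOrder (D : ParentGraph (List V)) (φ : List V → List V) : Prop :=
  ∀ a b c, (a, c) ∈ D.edges → (b, c) ∈ D.edges →
    (StartsBefore c a b ↔ StartsBefore (φ c) (φ a) (φ b))

/-- Subgraph relation of unordered branch decomposition trees, up to the renaming `σ`. -/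
def BDTSubgraph (σ : Equiv.Perm V) (D D' : ParentGraph (List V)) : Prop :=
  ∃ φ, IsBranchEmbedding σ D D' φ

/-- Subtree relation of ordered branch decomposition trees, up to the renaming `σ`. -/
def OBDTSubgraph (σ : Equiv.Perm V) (D D' : ParentGraph (List V)) : Prop :=
  ∃ φ, IsBranchEmbedding σ D D' φ ∧ PreservesSiblingOrder D φ

variable (G : SimpleGraph V) (x y : V) (f g : V → ℝ)

/-- `T_f ⊆ T_g` up to renaming of `x` and `y`. -/
def TreeIncluded : Prop :=
  ∃ σ, RenamesOnly x y σ ∧ ((mergeTree G f).map σ).IsSubgraph (mergeTree G g)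

/-- `BDT(T_f) ⊆ BDT(T_g)` (unordered) up to renaming of `x` and `y`. -/
def BDTIncluded : Prop :=
  ∃ σ, RenamesOnly x y σ ∧ BDTSubgraph σ (bdt G f) (bdt G g)

/-- `OBDT(T_f) ⊆ OBDT(T_g)` (ordered) up to renaming of `x` and `y`. -/
def OBDTIncluded : Prop :=
  ∃ σ, RenamesOnly x y σ ∧ OBDTSubgraph σ (bdt G f) (bdt G g)

/-- `T_f = T_g` and `BDT(T_f) = BDT(T_g)`, up to one common renaming of `x` and `y`. -/
def EqualUpToRenaming : Prop :=
  ∃ σ, RenamesOnly x y σ ∧ (mergeTree G f).map σ = mergeTree G g ∧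
    BDTSubgraph σ (bdt G f) (bdt G g) ∧ BDTSubgraph σ⁻¹ (bdt G g) (bdt G f)

/-! ### The four classes of merge tree changes -/

/-- Neither the tree nor the branch decomposition tree changes beyond inclusion. -/
def IsSimpleChange : Prop :=
  (TreeIncluded G x y f g ∨ TreeIncluded G x y g f) ∧
  (OBDTIncluded G x y f g ∨ OBDTIncluded G x y g f)

/-- Inclusion holds for the trees, but not for the ordered branch decomposition trees. -/
def IsVerticalSwap : Prop :=
  (TreeIncluded G x y f g ∨ TreeIncluded G x y g f) ∧
  ¬ OBDTIncluded G x y f g ∧ ¬ OBDTIncluded G x y g f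

/-- Inclusion holds for the ordered branch decomposition trees, but not for the trees. -/
def IsEdgeSplit : Prop :=
  ¬ TreeIncluded G x y f g ∧ ¬ TreeIncluded G x y g f ∧
  (OBDTIncluded G x y f g ∨ OBDTIncluded G x y g f)

/-- (Ordered) horizontal swap: inclusion holds for neither structure. -/
def IsHorizontalSwap : Prop :=
  ¬ TreeIncluded G x y f g ∧ ¬ TreeIncluded G x y g f ∧
  ¬ OBDTIncluded G x y f g ∧ ¬ OBDTIncluded G x y g f

/-- One saddle of `T_f` is split into the two adjacent saddles `y` (below) and `x` (above) of
`T_g`; the split saddle of `T_f` is named `x` or `y`, and the other name is not a node of `T_f`. -/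
def SaddleSplits : Prop :=
  ((x ∉ (mergeTree G f).verts ∧ IsSaddleVertex G f y) ∨
    (y ∉ (mergeTree G f).verts ∧ IsSaddleVertex G f x)) ∧
  (x, y) ∈ (mergeTree G g).edges ∧ IsSaddleVertex G g x ∧ IsSaddleVertex G g y

end MergeTree

/-! ### Minimal vertex perturbations -/

section Perturbation

variable {V : Type*}

/-- The position of `v` in the ordering of the vertices by ascending value, starting at `1`. -/
noncomputable def vertexRank (f : V → ℝ) (v : V) : ℕ := {u | f u ≤ f v}.ncard

/-- `v` and `u` are neighbours in the vertex ordering of `f`, they are exchanged in that of `g`,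
and all other vertices keep their positions. -/
def SwapsPosition (f g : V → ℝ) (v u : V) : Prop :=
  u ≠ v ∧ |(vertexRank f v : ℤ) - (vertexRank f u : ℤ)| = 1 ∧
  vertexRank f v = vertexRank g u ∧ vertexRank f u = vertexRank g v ∧
  ∀ w, w ≠ u → w ≠ v → vertexRank f w = vertexRank g w

/-- `f` and `g` differ by a minimal vertex perturbation of `v`. -/
def IsMinimalVertexPerturbation (f g : V → ℝ) (v : V) : Prop :=
  f v ≠ g v ∧ (∀ u, u ≠ v → f u = g u) ∧
  ((∀ w, vertexRank f w = vertexRank g w) ∨ ∃! u, SwapsPosition f g v u)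

end Perturbation

open Classical in
/-- Insert `y` between every two consecutive entries `p`, `c` of a list. -/
noncomputable def subdivide {α : Type*} (p c y : α) : List α → List α
  | [] => []
  | [a] => [a]
  | a :: b :: l =>
      if a = p ∧ b = c then a :: y :: subdivide p c y (b :: l)
      else a :: subdivide p c y (b :: l)

/-- The graph of vertices and edges (the 1-skeleton) of a geometric simplicial complex. -/
def vertexGraph {E : Type*} [AddCommGroup E] [Module ℝ E]
    (K : Geometry.SimplicialComplex ℝ E) : SimpleGraph K.vertices where
  Adj u v := u ≠ v ∧ ∃ s ∈ K.faces, (s : Set E) = {(u : E), (v : E)}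
  symm := ⟨fun u v h => ⟨h.1.symm, by
    obtain ⟨s, hs, h2⟩ := h.2
    exact ⟨s, hs, by rw [h2, Set.pair_comm]⟩⟩⟩
  loopless := ⟨fun u h => h.1 rfl⟩

/-! ### Tree orders -/

/-- `R v u` means that `u` lies above `v`. -/
structure IsTreeOrder {V : Type*} (R : V → V → Prop) : Prop where
  refl : ∀ a, R a a
  trans : ∀ {a b c}, R a b → R b c → R a c
  antisymm : ∀ {a b}, R a b → R b a → a = b
  linear : ∀ {a b u}, R a u → R b u → R a b ∨ R b a
  root : ∃ r, ∀ u, R r u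

section TreeOrder

variable {V : Type*}

/-- `m` is a maximal element. -/
def IsTip (R : V → V → Prop) (m : V) : Prop := ∀ u, R m u → u = m

/-- `r` is the least element. -/
def IsLowest (R : V → V → Prop) (r : V) : Prop := ∀ u, R r u

/-- `v` is not the least element, and the elements strictly above `v` have a least one. -/
def IsReg (R : V → V → Prop) (v : V) : Prop :=
  ¬ IsLowest R v ∧ ∃ w, R v w ∧ w ≠ v ∧ ∀ u, R v u → u ≠ v → R w u

/-- The tree on the elements that are not regular. -/
def nodeTree (R : V → V → Prop) : ParentGraph V where
  verts := {v | ¬ IsReg R v}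
  edges := {e | ¬ IsReg R e.1 ∧ ¬ IsReg R e.2 ∧ R e.2 e.1 ∧ e.1 ≠ e.2 ∧
    ∀ w, ¬ IsReg R w → R e.2 w → R w e.1 → w = e.1 ∨ w = e.2}

/-- `m` is the highest maximal element above `v`. -/
def IsHighest (R : V → V → Prop) (f : V → ℝ) (v m : V) : Prop :=
  IsTip R m ∧ R v m ∧ ∀ m', IsTip R m' → R v m' → f m' ≤ f m

/-- The branch of `m` starts at `s`. -/
def IsStart (R : V → V → Prop) (f : V → ℝ) (s m : V) : Prop :=
  IsTip R m ∧ ¬ IsReg R s ∧ R s m ∧ s ≠ m ∧ (IsLowest R s ∨ ¬ IsHighest R f s m) ∧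
    ∀ v, ¬ IsReg R v → R s v → s ≠ v → R v m → IsHighest R f v m

namespace IsTreeOrder

variable {R : V → V → Prop} (hR : IsTreeOrder R)
include hR

theorem exists_maximal [Finite V] (P : V → Prop) {a : V} (ha : P a) :
    ∃ m, P m ∧ R a m ∧ ∀ u, P u → R m u → u = m := by
  let r : V → V → Prop := fun u v => R v u ∧ u ≠ v
  have : IsTrans V r := ⟨fun a b c h1 h2 => ⟨hR.trans h2.1 h1.1, by
    rintro rfl; exact h1.2 (hR.antisymm h2.1 h1.1)⟩⟩
  have : Std.Irrefl r := ⟨fun a h => h.2 rfl⟩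
  obtain ⟨m, ⟨h1, h2⟩, h3⟩ := (Finite.wellFounded_of_trans_of_irrefl r).has_min
    {u | P u ∧ R a u} ⟨a, ha, hR.refl a⟩
  exact ⟨m, h1, h2, fun u hu hmu => by
    by_contra hne
    exact h3 u ⟨hu, hR.trans h2 hmu⟩ ⟨hmu, hne⟩⟩

theorem exists_minimal [Finite V] (P : V → Prop) {a : V} (ha : P a) :
    ∃ m, P m ∧ R m a ∧ ∀ u, P u → R u m → u = m := by
  let r : V → V → Prop := fun u v => R u v ∧ u ≠ v
  have : IsTrans V r := ⟨fun a b c h1 h2 => ⟨hR.trans h1.1 h2.1, by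
    rintro rfl; exact h1.2 (hR.antisymm h1.1 h2.1)⟩⟩
  have : Std.Irrefl r := ⟨fun a h => h.2 rfl⟩
  obtain ⟨m, ⟨h1, h2⟩, h3⟩ := (Finite.wellFounded_of_trans_of_irrefl r).has_min
    {u | P u ∧ R u a} ⟨a, ha, hR.refl a⟩
  exact ⟨m, h1, h2, fun u hu hmu => by
    by_contra hne
    exact h3 u ⟨hu, hR.trans hmu h2⟩ ⟨hmu, hne⟩⟩

theorem exists_tip [Finite V] (a : V) : ∃ m, IsTip R m ∧ R a m := by
  obtain ⟨m, -, h2, h3⟩ := hR.exists_maximal (fun _ => True) (a := a) trivial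
  exact ⟨m, fun u => h3 u trivial, h2⟩

theorem bot_unique {r s : V} (hr : IsLowest R r) (hs : IsLowest R s) : r = s :=
  hR.antisymm (hr s) (hs r)

theorem eq_of_le_bot {r v : V} (hr : IsLowest R r) (h : R v r) : v = r :=
  hR.antisymm h (hr v)

omit hR in
theorem not_reg_of_tip {m : V} (hm : IsTip R m) : ¬ IsReg R m :=
  fun h => by obtain ⟨-, w, h1, h2, -⟩ := h; exact h2 (hm w h1)

omit hR in
theorem not_reg_of_bot {m : V} (hm : IsLowest R m) : ¬ IsReg R m := fun h => h.1 hm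

/-- Incomparable elements branch off at an element that is not regular. -/
theorem exists_branching [Finite V] {k a b : V} (ha : R k a) (hb : R k b) (hab : ¬ R a b)
    (hba : ¬ R b a) :
    ∃ z, ¬ IsReg R z ∧ R k z ∧ R z a ∧ R z b ∧ z ≠ a ∧ z ≠ b ∧
      ∀ u, R u a → R u b → R u z := by
  obtain ⟨z, ⟨h1, h2⟩, h3, h4⟩ := hR.exists_maximal (fun z => R z a ∧ R z b) ⟨ha, hb⟩
  have hza : z ≠ a := by rintro rfl; exact hab h2
  have hzb : z ≠ b := by rintro rfl; exact hba h1
  refine ⟨z, ?_, h3, h1, h2, hza, hzb, ?_⟩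
  · rintro ⟨-, w, hw, hwz, hw'⟩
    exact hwz (h4 w ⟨hw' a h1 hza.symm, hw' b h2 hzb.symm⟩ hw)
  · intro u hua hub
    rcases hR.linear hua h1 with h | h
    · exact h
    · rw [h4 u ⟨hua, hub⟩ h]; exact hR.refl _

theorem exists_parent [Finite V] {u v : V} (hu : ¬ IsReg R u) (hv : ¬ IsReg R v) (h : R v u)
    (hne : v ≠ u) : ∃ p, (u, p) ∈ (nodeTree R).edges ∧ R v p := by
  obtain ⟨p, ⟨h1, h2, h3⟩, h4, h5⟩ :=
    hR.exists_maximal (fun p => ¬ IsReg R p ∧ R p u ∧ p ≠ u) ⟨hv, h, hne⟩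
  refine ⟨p, ⟨hu, h1, h2, h3.symm, fun w hw hpw hwu => ?_⟩, h4⟩
  by_cases hwu' : w = u
  · exact Or.inl hwu'
  · exact Or.inr (h5 w ⟨hw, hwu, hwu'⟩ hpw)

theorem exists_child [Finite V] {u v : V} (hu : ¬ IsReg R u) (hv : ¬ IsReg R v) (h : R v u)
    (hne : v ≠ u) : ∃ c, (c, v) ∈ (nodeTree R).edges ∧ R c u := by
  obtain ⟨p, ⟨h1, h2, h3⟩, h4, h5⟩ :=
    hR.exists_minimal (fun p => ¬ IsReg R p ∧ R v p ∧ p ≠ v) ⟨hu, h, hne.symm⟩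
  refine ⟨p, ⟨h1, hv, h2, h3, fun w hw hpw hwu => ?_⟩, h4⟩
  by_cases hwu' : w = v
  · exact Or.inr hwu'
  · exact Or.inl (h5 w ⟨hw, hpw, hwu'⟩ hwu)

theorem parent_unique {u p q : V} (hp : (u, p) ∈ (nodeTree R).edges)
    (hq : (u, q) ∈ (nodeTree R).edges) : p = q := by
  rcases hR.linear hp.2.2.1 hq.2.2.1 with h | h
  · rcases hp.2.2.2.2 q hq.2.1 h hq.2.2.1 with h' | h'
    · exact absurd h'.symm hq.2.2.2.1
    · exact h'.symm
  · rcases hq.2.2.2.2 p hp.2.1 h hp.2.2.1 with h' | h'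
    · exact absurd h'.symm hp.2.2.2.1
    · exact h'

theorem child_unique {v c d u : V} (hc : (c, v) ∈ (nodeTree R).edges)
    (hd : (d, v) ∈ (nodeTree R).edges) (hcu : R c u) (hdu : R d u) : c = d := by
  rcases hR.linear hcu hdu with h | h
  · rcases hd.2.2.2.2 c hc.1 hc.2.2.1 h with h' | h'
    · exact h'
    · exact absurd h' hc.2.2.2.1
  · rcases hc.2.2.2.2 d hd.1 hd.2.2.1 h with h' | h'
    · exact h'.symm
    · exact absurd h' hd.2.2.2.1

theorem isLeaf_iff [Finite V] {m : V} : (nodeTree R).IsLeaf m ↔ IsTip R m := by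
  constructor
  · rintro ⟨h1, h2⟩ u hu
    by_contra hne
    obtain ⟨t, ht, hut⟩ := hR.exists_tip u
    obtain ⟨c, hc, -⟩ := hR.exists_child (not_reg_of_tip ht) h1 (hR.trans hu hut) (by
      rintro rfl; exact hne (hR.antisymm hut hu))
    exact h2 c hc
  · exact fun h => ⟨not_reg_of_tip h, fun c hc => hc.2.2.2.1 (h c hc.2.2.1)⟩

theorem isRoot_iff [Finite V] {s : V} : (nodeTree R).IsRoot s ↔ IsLowest R s := by
  constructor
  · rintro ⟨h1, h2⟩
    obtain ⟨r, hr⟩ := hR.root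
    by_cases hrs : r = s
    · exact hrs ▸ hr
    · obtain ⟨p, hp, -⟩ := hR.exists_parent h1 (not_reg_of_bot hr) (hr s) hrs
      exact absurd hp (h2 p)
  · exact fun h => ⟨not_reg_of_bot h, fun p hp => hp.2.2.2.1 (hR.antisymm (h p) hp.2.2.1)⟩

theorem inSubtree_iff [Finite V] {u v : V} (hu : ¬ IsReg R u) (hv : ¬ IsReg R v) :
    (nodeTree R).InSubtree u v ↔ R v u := by
  constructor
  · intro h
    unfold ParentGraph.InSubtree at h
    induction h with
    | refl => exact hR.refl _
    | tail h1 h2 ih => exact hR.trans h2.2.2.1 (ih h2.1)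
  · intro h
    obtain ⟨p, ⟨h1, h2, h3⟩, -, h4⟩ := hR.exists_minimal
      (fun p => ¬ IsReg R p ∧ R v p ∧ (nodeTree R).InSubtree u p)
      ⟨hu, h, Relation.ReflTransGen.refl⟩
    by_cases hpv : v = p
    · exact hpv ▸ h3
    · obtain ⟨q, hq, hvq⟩ := hR.exists_parent h1 hv h2 hpv
      have := h4 q ⟨hq.2.1, hvq, Relation.ReflTransGen.tail h3 hq⟩ hq.2.2.1
      exact absurd this.symm hq.2.2.2.1

theorem isHighestLeaf_iff [Finite V] {f : V → ℝ} {v m : V} (hv : ¬ IsReg R v) :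
    (nodeTree R).IsHighestLeaf f v m ↔ IsHighest R f v m := by
  unfold ParentGraph.IsHighestLeaf IsHighest
  simp only [hR.isLeaf_iff]
  constructor
  · rintro ⟨h1, h2, h3⟩
    exact ⟨h1, (hR.inSubtree_iff (not_reg_of_tip h1) hv).1 h2, fun m' hm' h =>
      h3 m' hm' ((hR.inSubtree_iff (not_reg_of_tip hm') hv).2 h)⟩
  · rintro ⟨h1, h2, h3⟩
    exact ⟨h1, (hR.inSubtree_iff (not_reg_of_tip h1) hv).2 h2, fun m' hm' h =>
      h3 m' hm' ((hR.inSubtree_iff (not_reg_of_tip hm') hv).1 h)⟩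

/-! #### Highest leaves and starts of branches -/

theorem exists_highest [Finite V] (f : V → ℝ) (v : V) : ∃ m, IsHighest R f v m := by
  obtain ⟨m, ⟨h1, h2⟩, h3⟩ := Set.exists_max_image {m | IsTip R m ∧ R v m} f (Set.toFinite _)
    (hR.exists_tip v)
  exact ⟨m, h1, h2, fun m' h h' => h3 m' ⟨h, h'⟩⟩

omit hR in
theorem highest_unique {f : V → ℝ} (hf : Function.Injective f) {v m m' : V}
    (h : IsHighest R f v m) (h' : IsHighest R f v m') : m = m' :=
  hf (le_antisymm (h'.2.2 m h.1 h.2.1) (h.2.2 m' h'.1 h'.2.1))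

theorem highest_mono {f : V → ℝ} {v w m : V} (h : IsHighest R f v m) (hvw : R v w)
    (hwm : R w m) : IsHighest R f w m :=
  ⟨h.1, hwm, fun m' hm' h' => h.2.2 m' hm' (hR.trans hvw h')⟩

omit hR in
theorem highest_self {f : V → ℝ} {m : V} (h : IsTip R m) (hR : IsTreeOrder R) :
    IsHighest R f m m :=
  ⟨h, hR.refl _, fun m' _ h' => by rw [h m' h']⟩

theorem exists_start [Finite V] (f : V → ℝ) {m : V} (hm : IsTip R m) (hb : ¬ IsLowest R m) :
    ∃ s, IsStart R f s m := by
  obtain ⟨r, hr⟩ := hR.root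
  have hrm : r ≠ m := by rintro rfl; exact hb hr
  obtain ⟨s, ⟨h1, h2, h3, h4⟩, h5, h6⟩ := hR.exists_maximal
    (fun s => ¬ IsReg R s ∧ R s m ∧ s ≠ m ∧ (IsLowest R s ∨ ¬ IsHighest R f s m))
    (a := r) ⟨not_reg_of_bot hr, hr m, hrm, Or.inl hr⟩
  refine ⟨s, hm, h1, h2, h3, h4, fun v hv hsv hne hvm => ?_⟩
  by_contra hcon
  by_cases hvm' : v = m
  · subst hvm'; exact hcon (highest_self hm hR)
  · exact hne (h6 v ⟨hv, hvm, hvm', Or.inr hcon⟩ hsv).symm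

theorem start_unique {f : V → ℝ} {s s' m : V} (h : IsStart R f s m) (h' : IsStart R f s' m) :
    s = s' := by
  have key : ∀ {s s' : V}, IsStart R f s m → IsStart R f s' m → R s s' → s = s' := by
    intro s s' h h' hss
    by_contra hne
    rcases h'.2.2.2.2.1 with hb | hb
    · exact hne (hR.eq_of_le_bot hb hss)
    · exact hb (h.2.2.2.2.2 s' h'.2.1 hss hne h'.2.2.1)
  rcases hR.linear h.2.2.1 h'.2.2.1 with hl | hl
  · exact key h h' hl
  · exact (key h' h hl).symm

omit hR in
theorem not_highest_of_start {f : V → ℝ} {s m : V} (h : IsStart R f s m) (hs : ¬ IsLowest R s) :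
    ¬ IsHighest R f s m := h.2.2.2.2.1.resolve_left hs

/-- A child of `s` that is not below the highest leaf of `s` starts a branch at `s`. -/
theorem start_of_child {f : V → ℝ} {s c m t : V} (hc : (c, s) ∈ (nodeTree R).edges)
    (ht : IsHighest R f s t) (hct : ¬ R c t) (hm : IsHighest R f c m)
    (hf : Function.Injective f) : IsStart R f s m := by
  have hsm := hR.trans hc.2.2.1 hm.2.1
  refine ⟨hm.1, hc.2.1, hsm, ?_, Or.inr ?_, fun v hv hsv hne hvm => ?_⟩
  · rintro rfl
    exact hc.2.2.2.1 (hm.1 _ hc.2.2.1)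
  · intro h
    exact hct (highest_unique hf h ht ▸ hm.2.1)
  · rcases hR.linear hm.2.1 hvm with h | h
    · exact hR.highest_mono hm h hvm
    · rcases hc.2.2.2.2 v hv hsv h with h' | h'
      · exact h' ▸ hm
      · exact absurd h'.symm hne

end IsTreeOrder

end TreeOrder

/-! ### Branches as lists -/

/-- `l` runs from `s` up to `m` along the edges of `T`. -/
inductive ParentGraph.DownPath {V : Type*} (T : ParentGraph V) : V → V → List V → Prop
  | nil (a : V) : DownPath T a a [a]
  | cons {a c m : V} {l : List V} : (c, a) ∈ T.edges → DownPath T c m l → DownPath T a m (a :: l)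

section DownPath

variable {V : Type*}

namespace ParentGraph

theorem DownPath.eq_cons {T : ParentGraph V} {s m : V} {l : List V} (h : T.DownPath s m l) :
    ∃ t, l = s :: t := by
  cases h with
  | nil => exact ⟨_, rfl⟩
  | cons _ _ => exact ⟨_, rfl⟩

theorem DownPath.head? {T : ParentGraph V} {s m : V} {l : List V} (h : T.DownPath s m l) :
    l.head? = some s := by
  obtain ⟨t, rfl⟩ := h.eq_cons; rfl

theorem DownPath.getLast? {T : ParentGraph V} {s m : V} {l : List V} (h : T.DownPath s m l) :
    l.getLast? = some m := by
  induction h with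
  | nil => rfl
  | cons _ h ih =>
    obtain ⟨t, rfl⟩ := h.eq_cons
    rw [List.getLast?_cons_cons]; exact ih

theorem DownPath.isChain {T : ParentGraph V} {s m : V} {l : List V} (h : T.DownPath s m l) :
    l.IsChain (fun u v => (v, u) ∈ T.edges) := by
  induction h with
  | nil => simp
  | cons hc h ih =>
    obtain ⟨t, rfl⟩ := h.eq_cons
    exact List.isChain_cons_cons.2 ⟨hc, ih⟩

theorem downPath_of_isChain {T : ParentGraph V} {m : V} :
    ∀ {l : List V} {s : V}, (s :: l).IsChain (fun u v => (v, u) ∈ T.edges) →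
      (s :: l).getLast? = some m → T.DownPath s m (s :: l)
  | [], s, _, h => by
    obtain rfl : s = m := by simpa using h
    exact .nil s
  | c :: l, s, hc, h => by
    rw [List.isChain_cons_cons] at hc
    exact .cons hc.1 (downPath_of_isChain hc.2 (by rwa [List.getLast?_cons_cons] at h))

end ParentGraph

namespace IsTreeOrder

open ParentGraph

variable {R : V → V → Prop} (hR : IsTreeOrder R)
include hR

theorem le_of_downPath {s m : V} {l : List V} (h : (nodeTree R).DownPath s m l) : R s m := by
  induction h with
  | nil => exact hR.refl _
  | cons hc _ ih => exact hR.trans hc.2.2.1 ih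

theorem exists_downPath [Finite V] {s m : V} (hs : ¬ IsReg R s) (hm : ¬ IsReg R m) (h : R s m) :
    ∃ l, (nodeTree R).DownPath s m l := by
  obtain ⟨p, ⟨h1, h2, h3, l, hl⟩, -, h4⟩ := hR.exists_minimal
    (fun p => ¬ IsReg R p ∧ R s p ∧ R p m ∧ ∃ l, (nodeTree R).DownPath p m l)
    ⟨hm, h, hR.refl m, [m], .nil m⟩
  by_cases hsp : s = p
  · exact ⟨l, hsp ▸ hl⟩
  · obtain ⟨q, hq, hsq⟩ := hR.exists_parent h1 hs h2 hsp
    have := h4 q ⟨hq.2.1, hsq, hR.trans hq.2.2.1 h3, _, .cons hq hl⟩ hq.2.2.1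
    exact absurd this.symm hq.2.2.2.1

theorem downPath_unique {s m : V} {l l' : List V} (h : (nodeTree R).DownPath s m l)
    (h' : (nodeTree R).DownPath s m l') : l = l' := by
  induction h generalizing l' with
  | nil a =>
    cases h' with
    | nil => rfl
    | cons hc h => exact absurd (hR.antisymm (hR.le_of_downPath h) hc.2.2.1) hc.2.2.2.1
  | cons hc h ih =>
    cases h' with
    | nil => exact absurd (hR.antisymm (hR.le_of_downPath h) hc.2.2.1) hc.2.2.2.1
    | cons hc' h' =>
      obtain rfl := hR.child_unique hc hc' (hR.le_of_downPath h) (hR.le_of_downPath h')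
      rw [ih h']

theorem mem_downPath {s m : V} {l : List V} (h : (nodeTree R).DownPath s m l)
    (hm : ¬ IsReg R m) {v : V} : v ∈ l ↔ ¬ IsReg R v ∧ R s v ∧ R v m := by
  induction h with
  | nil a =>
    rw [List.mem_singleton]
    exact ⟨by rintro rfl; exact ⟨hm, hR.refl _, hR.refl _⟩, fun h => hR.antisymm h.2.2 h.2.1⟩
  | cons hc h ih =>
    rw [List.mem_cons, ih hm]
    constructor
    · rintro (rfl | ⟨h1, h2, h3⟩)
      · exact ⟨hc.2.1, hR.refl _, hR.trans hc.2.2.1 (hR.le_of_downPath h)⟩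
      · exact ⟨h1, hR.trans hc.2.2.1 h2, h3⟩
    · rintro ⟨h1, h2, h3⟩
      rcases hR.linear h3 (hR.le_of_downPath h) with h4 | h4
      · rcases hc.2.2.2.2 v h1 h2 h4 with rfl | rfl
        · exact Or.inr ⟨h1, hR.refl _, h3⟩
        · exact Or.inl rfl
      · exact Or.inr ⟨h1, h4, h3⟩

theorem pairwise_downPath {s m : V} {l : List V} (h : (nodeTree R).DownPath s m l)
    (hm : ¬ IsReg R m) : l.Pairwise (fun u v => R u v ∧ u ≠ v) := by
  induction h with
  | nil a => simp
  | cons hc h ih =>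
    refine List.pairwise_cons.2 ⟨fun v hv => ?_, ih hm⟩
    have := (hR.mem_downPath h hm).1 hv
    refine ⟨hR.trans hc.2.2.1 this.2.1, ?_⟩
    rintro rfl
    exact hc.2.2.2.1 (hR.antisymm this.2.1 hc.2.2.1)

theorem mem_tail_downPath {s m : V} {l : List V} (h : (nodeTree R).DownPath s m l)
    (hm : ¬ IsReg R m) {v : V} : v ∈ l.tail ↔ ¬ IsReg R v ∧ R s v ∧ R v m ∧ s ≠ v := by
  obtain ⟨t, rfl⟩ := h.eq_cons
  have hp := hR.pairwise_downPath h hm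
  have hmem := hR.mem_downPath h hm (v := v)
  rw [List.pairwise_cons] at hp
  rw [List.mem_cons] at hmem
  rw [List.tail_cons]
  constructor
  · intro hv
    have := hmem.1 (Or.inr hv)
    exact ⟨this.1, this.2.1, this.2.2, (hp.1 v hv).2⟩
  · rintro ⟨h1, h2, h3, h4⟩
    exact (hmem.2 ⟨h1, h2, h3⟩).resolve_left (Ne.symm h4)

theorem getElem?_lt_of_pairwise {l : List V}
    (hp : l.Pairwise (fun u v => R u v ∧ u ≠ v))
    {i j : ℕ} {u v : V} (hi : l[i]? = some u) (hj : l[j]? = some v) :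
    i < j ↔ R u v ∧ u ≠ v := by
  obtain ⟨hi', rfl⟩ := List.getElem?_eq_some_iff.1 hi
  obtain ⟨hj', rfl⟩ := List.getElem?_eq_some_iff.1 hj
  rw [List.pairwise_iff_getElem] at hp
  constructor
  · exact hp i j hi' hj'
  · rintro ⟨h1, h2⟩
    by_contra hlt
    rcases (not_lt.1 hlt).eq_or_lt with h | h
    · subst h; exact h2 rfl
    · have := hp j i hj' hi' h
      exact h2 (hR.antisymm h1 this.1)

theorem inner_downPath {s m : V} {l : List V} (h : (nodeTree R).DownPath s m l)
    (hm : ¬ IsReg R m) {v : V} :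
    (∃ i, 0 < i ∧ i + 1 < l.length ∧ l[i]? = some v) ↔
      ¬ IsReg R v ∧ R s v ∧ R v m ∧ s ≠ v ∧ v ≠ m := by
  have hp := hR.pairwise_downPath h hm
  have h0 : l[0]? = some s := by rw [← List.head?_eq_getElem?]; exact h.head?
  have hl : l[l.length - 1]? = some m := by rw [← List.getLast?_eq_getElem?]; exact h.getLast?
  have hmem := hR.mem_downPath h hm (v := v)
  constructor
  · rintro ⟨i, hi0, hil, hi⟩
    have h1 := (hR.getElem?_lt_of_pairwise hp h0 hi).1 hi0
    have h2 := (hR.getElem?_lt_of_pairwise hp hi hl).1 (by omega)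
    exact ⟨(hmem.1 (List.mem_of_getElem? hi)).1, h1.1, h2.1, h1.2, h2.2⟩
  · rintro ⟨h1, h2, h3, h4, h5⟩
    obtain ⟨i, hi⟩ := List.mem_iff_getElem?.1 (hmem.2 ⟨h1, h2, h3⟩)
    have h6 := (hR.getElem?_lt_of_pairwise hp h0 hi).2 ⟨h2, h4⟩
    have h7 := (hR.getElem?_lt_of_pairwise hp hi hl).2 ⟨h3, h5⟩
    exact ⟨i, h6, by omega, hi⟩

theorem mem_branchDecomposition [Finite V] {f : V → ℝ} {b : List V} :
    b ∈ (nodeTree R).branchDecomposition f ↔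
      ∃ s m, IsStart R f s m ∧ (nodeTree R).DownPath s m b := by
  constructor
  · rintro ⟨⟨hlen, hchain⟩, s, m, hs, hm, hleaf, htail, hend⟩
    obtain ⟨t, rfl⟩ : ∃ t, b = s :: t := by
      cases b with
      | nil => simp at hs
      | cons a t => obtain rfl : a = s := by simpa using hs
                    exact ⟨t, rfl⟩
    have hp := downPath_of_isChain hchain hm
    rw [hR.isLeaf_iff] at hleaf
    have hm' := not_reg_of_tip hleaf
    have hs' := (hR.mem_downPath hp hm' (v := s)).1 (by simp)
    refine ⟨s, m, ⟨hleaf, hs'.1, hs'.2.2, ?_, ?_, ?_⟩, hp⟩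
    · rintro rfl
      have := hR.downPath_unique hp (.nil s)
      simp only [List.cons.injEq, true_and] at this
      subst this
      simp at hlen
    · rw [hR.isRoot_iff, hR.isHighestLeaf_iff hs'.1] at hend
      exact hend
    · intro v h1 h2 h3 h4
      rw [← hR.isHighestLeaf_iff h1]
      exact htail v ((hR.mem_tail_downPath hp hm').2 ⟨h1, h2, h4, h3⟩)
  · rintro ⟨s, m, ⟨h1, h2, h3, h4, h5, h6⟩, hp⟩
    have hm' := not_reg_of_tip h1
    refine ⟨⟨?_, hp.isChain⟩, s, m, hp.head?, hp.getLast?, hR.isLeaf_iff.2 h1, ?_, ?_⟩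
    · cases hp with
      | nil => exact absurd rfl h4
      | cons _ h => obtain ⟨t, rfl⟩ := h.eq_cons; simp
    · intro v hv
      rw [hR.mem_tail_downPath hp hm'] at hv
      exact (hR.isHighestLeaf_iff hv.1).2 (h6 v hv.1 hv.2.1 hv.2.2.2 hv.2.2.1)
    · rwa [hR.isRoot_iff, hR.isHighestLeaf_iff h2]

theorem exists_branch [Finite V] {f : V → ℝ} {s m : V} (h : IsStart R f s m) :
    ∃ b, (nodeTree R).DownPath s m b ∧ b ∈ (nodeTree R).branchDecomposition f := by
  obtain ⟨b, hb⟩ := hR.exists_downPath h.2.1 (not_reg_of_tip h.1) h.2.2.1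
  exact ⟨b, hb, hR.mem_branchDecomposition.2 ⟨s, m, h, hb⟩⟩

theorem isParentBranch_iff {f : V → ℝ} {s m s' m' : V} {a b : List V}
    (ha : IsStart R f s m) (hpa : (nodeTree R).DownPath s m a)
    (hb : IsStart R f s' m') (hpb : (nodeTree R).DownPath s' m' b) :
    IsParentBranch b a ↔ ¬ IsLowest R s ∧ IsHighest R f s m' := by
  have hm' := not_reg_of_tip hb.1
  have : IsParentBranch b a ↔ ¬ IsReg R s ∧ R s' s ∧ R s m' ∧ s' ≠ s ∧ s ≠ m' := by
    rw [← hR.inner_downPath hpb hm']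
    unfold IsParentBranch
    rw [hpa.head?]
    constructor
    · rintro ⟨t, ht, h⟩
      obtain rfl : s = t := by simpa using ht
      exact h
    · exact fun h => ⟨s, rfl, h⟩
  rw [this]
  constructor
  · rintro ⟨h1, h2, h3, h4, h5⟩
    exact ⟨fun h => h4 (hR.eq_of_le_bot h h2), hb.2.2.2.2.2 s h1 h2 h4 h3⟩
  · rintro ⟨h1, h2⟩
    have hsm' : s ≠ m' := by
      rintro rfl
      exact ha.2.2.2.1 (hb.1 m ha.2.2.1).symm
    have key : R s s' → False := by
      intro h
      have hh := hR.highest_mono h2 h hb.2.2.1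
      rcases hb.2.2.2.2.1 with h3 | h3
      · exact h1 (by rw [hR.eq_of_le_bot h3 h]; exact h3)
      · exact h3 hh
    rcases hR.linear hb.2.2.1 h2.2.1 with h | h
    · exact ⟨ha.2.1, h, h2.2.1, fun e => key (e ▸ hR.refl _), hsm'⟩
    · exact (key h).elim

theorem startsBefore_iff {s1 m1 s2 m2 s' m' : V} {q a b : List V}
    (hpa : (nodeTree R).DownPath s1 m1 a) (hpb : (nodeTree R).DownPath s2 m2 b)
    (hpq : (nodeTree R).DownPath s' m' q) (hm' : ¬ IsReg R m')
    (h1 : s1 ∈ q) (h2 : s2 ∈ q) : StartsBefore q a b ↔ R s1 s2 ∧ s1 ≠ s2 := by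
  have hp := hR.pairwise_downPath hpq hm'
  unfold StartsBefore
  rw [hpa.head?, hpb.head?]
  constructor
  · rintro ⟨i, j, hij, -, hi, hj⟩
    exact (hR.getElem?_lt_of_pairwise hp hi hj).1 hij
  · intro h
    obtain ⟨i, hi⟩ := List.mem_iff_getElem?.1 h1
    obtain ⟨j, hj⟩ := List.mem_iff_getElem?.1 h2
    refine ⟨i, j, (hR.getElem?_lt_of_pairwise hp hi hj).2 h, ?_, hi, hj⟩
    exact (List.getElem?_eq_some_iff.1 hj).1

end IsTreeOrder

end DownPath

/-! ### Embeddings of branch decomposition trees -/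

section BranchMap

variable {V : Type*}

/-- Starts and parents of branches are respected by the renaming `σ`. -/
structure BranchMap (σ : Equiv.Perm V) (R R' : V → V → Prop) (f g : V → ℝ) : Prop where
  start : ∀ {s m}, IsStart R f s m → IsStart R' g (σ s) (σ m)
  parent : ∀ {s m m'}, IsStart R f s m → ¬ IsLowest R s → IsHighest R f s m' →
    ¬ IsLowest R' (σ s) ∧ IsHighest R' g (σ s) (σ m')

/-- The order of starts of sibling branches is respected by the renaming `σ`. -/
def SiblingOrder (σ : Equiv.Perm V) (R R' : V → V → Prop) (f : V → ℝ) : Prop :=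
  ∀ {s₁ m₁ s₂ m₂ m'}, IsStart R f s₁ m₁ → IsStart R f s₂ m₂ → ¬ IsLowest R s₁ → ¬ IsLowest R s₂ →
    IsHighest R f s₁ m' → IsHighest R f s₂ m' → (R s₁ s₂ ↔ R' (σ s₁) (σ s₂))

variable {R R' : V → V → Prop} {f g : V → ℝ} {σ : Equiv.Perm V}

namespace IsTreeOrder

theorem exists_parentBranch [Finite V] (hR : IsTreeOrder R) {s m m' : V} {a : List V}
    (h : IsStart R f s m) (ha : (nodeTree R).DownPath s m a) (hs : ¬ IsLowest R s)
    (hm' : IsHighest R f s m') :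
    ∃ s' b, IsStart R f s' m' ∧ (nodeTree R).DownPath s' m' b ∧
      (a, b) ∈ (branchDecompositionTree (nodeTree R) f).edges ∧ s ∈ b := by
  have hml : ¬ IsLowest R m' := fun hl => hs (by rw [hR.eq_of_le_bot hl hm'.2.1]; exact hl)
  obtain ⟨s', hs'⟩ := hR.exists_start f hm'.1 hml
  obtain ⟨b, hb, hb'⟩ := hR.exists_branch hs'
  have hpar := (hR.isParentBranch_iff h ha hs' hb).2 ⟨hs, hm'⟩
  refine ⟨s', b, hs', hb, ⟨hR.mem_branchDecomposition.2 ⟨s, m, h, ha⟩, hb', hpar⟩, ?_⟩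
  obtain ⟨t, ht, i, -, -, hi⟩ := hpar
  rw [ha.head?] at ht
  obtain rfl : s = t := by simpa using ht
  exact List.mem_of_getElem? hi

theorem branch_ends (hR : IsTreeOrder R) [Finite V] {b : List V}
    (hb : b ∈ (nodeTree R).branchDecomposition f) {s m : V} (hs : b.head? = some s)
    (hm : b.getLast? = some m) : IsStart R f s m ∧ (nodeTree R).DownPath s m b := by
  obtain ⟨s', m', h1, h2⟩ := hR.mem_branchDecomposition.1 hb
  obtain rfl : s' = s := by simpa [h2.head?] using hs
  obtain rfl : m' = m := by simpa [h2.getLast?] using hm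
  exact ⟨h1, h2⟩

theorem start_of_isBranchEmbedding [Finite V] (hR : IsTreeOrder R) (hR' : IsTreeOrder R')
    {φ : List V → List V}
    (h : IsBranchEmbedding σ (branchDecompositionTree (nodeTree R) f)
      (branchDecompositionTree (nodeTree R') g) φ) {s m : V} {b : List V} (hs : IsStart R f s m)
    (hb : (nodeTree R).DownPath s m b) :
    IsStart R' g (σ s) (σ m) ∧ (nodeTree R').DownPath (σ s) (σ m) (φ b) := by
  obtain ⟨h1, h2, h3⟩ := h.2.1 b (hR.mem_branchDecomposition.2 ⟨s, m, hs, hb⟩)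
  rw [hb.head?] at h2
  rw [hb.getLast?] at h3
  exact hR'.branch_ends h1 h2 h3

theorem branchMap_of_isBranchEmbedding [Finite V] (hR : IsTreeOrder R) (hR' : IsTreeOrder R')
    {φ : List V → List V}
    (h : IsBranchEmbedding σ (branchDecompositionTree (nodeTree R) f)
      (branchDecompositionTree (nodeTree R') g) φ) : BranchMap σ R R' f g where
  start hs := by
    obtain ⟨b, hb, -⟩ := hR.exists_branch hs
    exact (start_of_isBranchEmbedding hR hR' h hs hb).1
  parent {s m m'} hs hl hm' := by
    obtain ⟨a, ha, -⟩ := hR.exists_branch hs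
    obtain ⟨s', b, hs', hb, hab, -⟩ := hR.exists_parentBranch hs ha hl hm'
    have h1 := start_of_isBranchEmbedding hR hR' h hs ha
    have h2 := start_of_isBranchEmbedding hR hR' h hs' hb
    exact (hR'.isParentBranch_iff h1.1 h1.2 h2.1 h2.2).1 (h.2.2 a b hab).2.2

theorem branchMap_of_bdtSubgraph [Finite V] (hR : IsTreeOrder R) (hR' : IsTreeOrder R')
    (h : BDTSubgraph σ (branchDecompositionTree (nodeTree R) f)
      (branchDecompositionTree (nodeTree R') g)) : BranchMap σ R R' f g :=
  let ⟨_, h⟩ := h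
  branchMap_of_isBranchEmbedding hR hR' h

theorem siblingOrder_of_obdtSubgraph [Finite V] (hR : IsTreeOrder R) (hR' : IsTreeOrder R')
    (h : OBDTSubgraph σ (branchDecompositionTree (nodeTree R) f)
      (branchDecompositionTree (nodeTree R') g)) :
    BranchMap σ R R' f g ∧ SiblingOrder σ R R' f := by
  obtain ⟨φ, h, hord⟩ := h
  refine ⟨branchMap_of_isBranchEmbedding hR hR' h, ?_⟩
  intro s₁ m₁ s₂ m₂ m' h1 h2 hl1 hl2 ht1 ht2
  by_cases hne : s₁ = s₂
  · subst hne; exact ⟨fun _ => hR'.refl _, fun _ => hR.refl _⟩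
  obtain ⟨a, ha, -⟩ := hR.exists_branch h1
  obtain ⟨b, hb, -⟩ := hR.exists_branch h2
  obtain ⟨s, c, hs, hc, hac, hmem1⟩ := hR.exists_parentBranch h1 ha hl1 ht1
  obtain ⟨s', c', hs', hc', hbc, hmem2⟩ := hR.exists_parentBranch h2 hb hl2 ht2
  obtain rfl := hR.start_unique hs hs'
  obtain rfl := hR.downPath_unique hc hc'
  have key := hord a b c hac hbc
  have k1 := start_of_isBranchEmbedding hR hR' h h1 ha
  have k2 := start_of_isBranchEmbedding hR hR' h h2 hb
  have k3 := start_of_isBranchEmbedding hR hR' h hs hc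
  have inner : ∀ {s₁ m₁ a}, IsStart R' g (σ s₁) (σ m₁) →
      (nodeTree R').DownPath (σ s₁) (σ m₁) (φ a) → IsParentBranch (φ c) (φ a) → σ s₁ ∈ φ c := by
    intro s₁ m₁ a _ hp hpar
    obtain ⟨t, ht, i, -, -, hi⟩ := hpar
    rw [hp.head?] at ht
    obtain rfl : σ s₁ = t := by simpa using ht
    exact List.mem_of_getElem? hi
  rw [hR.startsBefore_iff ha hb hc (not_reg_of_tip hs.1) hmem1 hmem2,
    hR'.startsBefore_iff k1.2 k2.2 k3.2 (not_reg_of_tip k3.1.1)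
      (inner k1.1 k1.2 (h.2.2 a c hac).2.2) (inner k2.1 k2.2 (h.2.2 b c hbc).2.2)] at key
  simpa [hne] using key

theorem obdtSubgraph_of_branchMap [Finite V] (hR : IsTreeOrder R) (hR' : IsTreeOrder R')
    (h : BranchMap σ R R' f g) (hord : SiblingOrder σ R R' f) :
    OBDTSubgraph σ (branchDecompositionTree (nodeTree R) f)
      (branchDecompositionTree (nodeTree R') g) := by
  have hex : ∀ b ∈ (nodeTree R).branchDecomposition f, ∃ b', ∃ s m, IsStart R f s m ∧
      (nodeTree R).DownPath s m b ∧ (nodeTree R').DownPath (σ s) (σ m) b' := by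
    intro b hb
    obtain ⟨s, m, h1, h2⟩ := hR.mem_branchDecomposition.1 hb
    obtain ⟨b', hb', -⟩ := hR'.exists_branch (h.start h1)
    exact ⟨b', s, m, h1, h2, hb'⟩
  choose! φ hφ using hex
  have hedge : ∀ a b, (a, b) ∈ (branchDecompositionTree (nodeTree R) f).edges →
      (φ a, φ b) ∈ (branchDecompositionTree (nodeTree R') g).edges := by
    rintro a b ⟨ha, hb, hab⟩
    obtain ⟨s, m, h1, h2, h3⟩ := hφ a ha
    obtain ⟨s', m', h1', h2', h3'⟩ := hφ b hb
    have := (hR.isParentBranch_iff h1 h2 h1' h2').1 hab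
    exact ⟨hR'.mem_branchDecomposition.2 ⟨_, _, h.start h1, h3⟩,
      hR'.mem_branchDecomposition.2 ⟨_, _, h.start h1', h3'⟩,
      (hR'.isParentBranch_iff (h.start h1) h3 (h.start h1') h3').2 (h.parent h1 this.1 this.2)⟩
  refine ⟨φ, ⟨?_, ?_, hedge⟩, ?_⟩
  · intro a ha b hb hab
    obtain ⟨s, m, h1, h2, h3⟩ := hφ a ha
    obtain ⟨s', m', h1', h2', h3'⟩ := hφ b hb
    rw [hab] at h3
    have e1 := h3.head?.symm.trans h3'.head?
    have e2 := h3.getLast?.symm.trans h3'.getLast?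
    simp only [Option.some.injEq, EmbeddingLike.apply_eq_iff_eq] at e1 e2
    subst e1 e2
    exact hR.downPath_unique h2 h2'
  · intro b hb
    obtain ⟨s, m, h1, h2, h3⟩ := hφ b hb
    refine ⟨hR'.mem_branchDecomposition.2 ⟨_, _, h.start h1, h3⟩, ?_, ?_⟩
    · rw [h3.head?, h2.head?]; rfl
    · rw [h3.getLast?, h2.getLast?]; rfl
  · intro a b c hac hbc
    obtain ⟨s₁, m₁, h1, h2, h3⟩ := hφ a hac.1
    obtain ⟨s₂, m₂, k1, k2, k3⟩ := hφ b hbc.1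
    obtain ⟨s', m', c1, c2, c3⟩ := hφ c hac.2.1
    have p1 := (hR.isParentBranch_iff h1 h2 c1 c2).1 hac.2.2
    have p2 := (hR.isParentBranch_iff k1 k2 c1 c2).1 hbc.2.2
    have inner : ∀ {R : V → V → Prop} {s₁ m₁ : V} {a c : List V},
        (nodeTree R).DownPath s₁ m₁ a → IsParentBranch c a → s₁ ∈ c := by
      intro R s₁ m₁ a c hp hpar
      obtain ⟨t, ht, i, -, -, hi⟩ := hpar
      rw [hp.head?] at ht
      obtain rfl : s₁ = t := by simpa using ht
      exact List.mem_of_getElem? hi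
    rw [hR.startsBefore_iff h2 k2 c2 (not_reg_of_tip c1.1) (inner h2 hac.2.2) (inner k2 hbc.2.2),
      hR'.startsBefore_iff h3 k3 c3 (not_reg_of_tip (h.start c1).1)
        (inner h3 (hedge _ _ hac).2.2) (inner k3 (hedge _ _ hbc).2.2),
      hord h1 k1 p1.1 p2.1 p1.2 p2.2]
    simp

/-! #### Counting -/

theorem ncard_edges [Finite V] (hR : IsTreeOrder R) :
    (nodeTree R).edges.ncard + 1 = (nodeTree R).verts.ncard := by
  obtain ⟨r, hr⟩ := hR.root
  have hinj : Set.InjOn Prod.fst (nodeTree R).edges := by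
    rintro ⟨u, p⟩ hp ⟨u', q⟩ hq huv
    obtain rfl : u = u' := huv
    rw [hR.parent_unique hp hq]
  have himg : Prod.fst '' (nodeTree R).edges = (nodeTree R).verts \ {r} := by
    ext u
    constructor
    · rintro ⟨⟨u, p⟩, hp, rfl⟩
      exact ⟨hp.1, fun hur => hp.2.2.2.1 (hR.antisymm (by
        rw [Set.mem_singleton_iff] at hur; exact hur ▸ hr _) hp.2.2.1)⟩
    · rintro ⟨hu, hur⟩
      obtain ⟨p, hp, -⟩ := hR.exists_parent hu (not_reg_of_bot hr) (hr u) (fun h => hur h.symm)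
      exact ⟨(u, p), hp, rfl⟩
  rw [← hinj.ncard_image, himg]
  exact Set.ncard_sdiff_singleton_add_one (not_reg_of_bot hr) (Set.toFinite _)

theorem ncard_branches [Finite V] (hR : IsTreeOrder R) (f : V → ℝ) :
    (branchDecompositionTree (nodeTree R) f).verts.ncard =
      {m | IsTip R m ∧ ¬ IsLowest R m}.ncard := by
  have hinj : Set.InjOn List.getLast? (branchDecompositionTree (nodeTree R) f).verts := by
    intro a ha b hb hab
    obtain ⟨s, m, h1, h2⟩ := hR.mem_branchDecomposition.1 ha
    obtain ⟨s', m', h1', h2'⟩ := hR.mem_branchDecomposition.1 hb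
    obtain rfl : m = m' := by simpa [h2.getLast?, h2'.getLast?] using hab
    obtain rfl := hR.start_unique h1 h1'
    exact hR.downPath_unique h2 h2'
  have himg : List.getLast? '' (branchDecompositionTree (nodeTree R) f).verts =
      some '' {m | IsTip R m ∧ ¬ IsLowest R m} := by
    ext o
    constructor
    · rintro ⟨b, hb, rfl⟩
      obtain ⟨s, m, h1, h2⟩ := hR.mem_branchDecomposition.1 hb
      refine ⟨m, ⟨h1.1, fun hl => h1.2.2.2.1 (hR.eq_of_le_bot hl h1.2.2.1)⟩, h2.getLast?.symm⟩
    · rintro ⟨m, ⟨h1, h2⟩, rfl⟩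
      obtain ⟨s, hs⟩ := hR.exists_start f h1 h2
      obtain ⟨b, hb, hb'⟩ := hR.exists_branch hs
      exact ⟨b, hb', hb.getLast?⟩
  rw [← hinj.ncard_image, himg, Set.ncard_image_of_injective _
    (Option.some_injective V)]

theorem finite_branches [Finite V] (hR : IsTreeOrder R) (f : V → ℝ) :
    (branchDecompositionTree (nodeTree R) f).verts.Finite := by
  refine Set.Finite.of_finite_image (f := fun b : List V => (b.head?, b.getLast?))
    (Set.toFinite _) ?_
  intro a ha b hb hab
  obtain ⟨s, m, h1, h2⟩ := hR.mem_branchDecomposition.1 ha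
  obtain ⟨s', m', h1', h2'⟩ := hR.mem_branchDecomposition.1 hb
  simp only [h2.head?, h2.getLast?, h2'.head?, h2'.getLast?, Prod.mk.injEq,
    Option.some.injEq] at hab
  obtain ⟨rfl, rfl⟩ := hab
  exact hR.downPath_unique h2 h2'

theorem ncard_bdt_edges [Finite V] (hR : IsTreeOrder R) (hf : Function.Injective f) {r w : V}
    (hr : IsLowest R r) (hwr : w ≠ r) (hw : ∀ u, u ≠ r → R w u) :
    (branchDecompositionTree (nodeTree R) f).edges.ncard + 1 =
      (branchDecompositionTree (nodeTree R) f).verts.ncard := by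
  obtain ⟨m₀, hm₀⟩ := hR.exists_highest f r
  have hm₀r : m₀ ≠ r := by
    rintro rfl
    exact hwr (hm₀.1 w (hr w))
  obtain ⟨s, hs⟩ := hR.exists_start f hm₀.1 (fun hl => hm₀r (hR.bot_unique hl hr))
  have hsr : IsLowest R s := by
    by_contra hl
    exact not_highest_of_start hs hl (hR.highest_mono hm₀ (hr s) hs.2.2.1)
  obtain rfl := hR.bot_unique hr hsr
  obtain ⟨b₀, hb₀, hb₀'⟩ := hR.exists_branch hs
  have huniq : ∀ m, IsStart R f r m → m = m₀ := by
    intro m hm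
    by_contra hne
    have hmr : m ≠ r := fun h => hm.2.2.2.1 h.symm
    obtain ⟨z, h1, h2, h3, h4, -⟩ := hR.exists_branching (hw m hmr) (hw m₀ hm₀r)
      (fun h => hne (hm.1 _ h).symm) (fun h => hne (hm₀.1 _ h))
    have hrz : r ≠ z := by
      rintro rfl
      exact hwr (hR.eq_of_le_bot hr h2)
    have k1 := hm.2.2.2.2.2 z h1 (hr z) hrz h3
    exact hne (highest_unique hf k1 (hR.highest_mono hm₀ (hr z) h4))
  have hinj : Set.InjOn Prod.fst (branchDecompositionTree (nodeTree R) f).edges := by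
    rintro ⟨a, b⟩ ⟨ha, hb, hab⟩ ⟨a', b'⟩ ⟨ha', hb', hab'⟩ haa
    obtain rfl : a = a' := haa
    obtain ⟨s, m, h1, h2⟩ := hR.mem_branchDecomposition.1 ha
    obtain ⟨s1, m1, h3, h4⟩ := hR.mem_branchDecomposition.1 hb
    obtain ⟨s2, m2, h5, h6⟩ := hR.mem_branchDecomposition.1 hb'
    obtain rfl := highest_unique hf ((hR.isParentBranch_iff h1 h2 h3 h4).1 hab).2
      ((hR.isParentBranch_iff h1 h2 h5 h6).1 hab').2
    obtain rfl := hR.start_unique h3 h5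
    exact Prod.ext rfl (hR.downPath_unique h4 h6)
  have himg : Prod.fst '' (branchDecompositionTree (nodeTree R) f).edges =
      (branchDecompositionTree (nodeTree R) f).verts \ {b₀} := by
    ext a
    constructor
    · rintro ⟨⟨a, b⟩, ⟨ha, hb, hab⟩, rfl⟩
      refine ⟨ha, fun hab₀ => ?_⟩
      obtain rfl : a = b₀ := hab₀
      obtain ⟨s1, m1, h3, h4⟩ := hR.mem_branchDecomposition.1 hb
      exact ((hR.isParentBranch_iff hs hb₀ h3 h4).1 hab).1 hr
    · rintro ⟨ha, hne⟩
      obtain ⟨s, m, h1, h2⟩ := hR.mem_branchDecomposition.1 ha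
      have hsl : ¬ IsLowest R s := by
        intro hl
        obtain rfl := hR.bot_unique hr hl
        obtain rfl := huniq m h1
        exact hne (hR.downPath_unique h2 hb₀)
      obtain ⟨m', hm'⟩ := hR.exists_highest f s
      obtain ⟨s', b, -, -, hab, -⟩ := hR.exists_parentBranch h1 h2 hsl hm'
      exact ⟨(a, b), hab, rfl⟩
  rw [← hinj.ncard_image, himg]
  exact Set.ncard_sdiff_singleton_add_one hb₀' (hR.finite_branches f)

/-! #### Isomorphic tree orders -/

theorem isTip_iff_of_node [Finite V] (hR : IsTreeOrder R) {m : V} :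
    IsTip R m ↔ ∀ u, ¬ IsReg R u → R m u → u = m := by
  refine ⟨fun h u _ => h u, fun h u hu => ?_⟩
  obtain ⟨t, ht, hut⟩ := hR.exists_tip u
  have := h t (not_reg_of_tip ht) (hR.trans hu hut)
  exact hR.antisymm (this ▸ hut) hu

theorem isLowest_iff_of_node (hR : IsTreeOrder R) {v : V} :
    IsLowest R v ↔ ∀ u, ¬ IsReg R u → R v u := by
  refine ⟨fun h u _ => h u, fun h => ?_⟩
  obtain ⟨r, hr⟩ := hR.root
  have := hR.eq_of_le_bot hr (h r (not_reg_of_bot hr))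
  exact this ▸ hr

/-- The renaming `σ` is an isomorphism of the trees. -/
structure NodeMap (σ : Equiv.Perm V) (R R' : V → V → Prop) : Prop where
  reg : ∀ v, IsReg R v ↔ IsReg R' (σ v)
  le : ∀ u v, ¬ IsReg R u → ¬ IsReg R v → (R u v ↔ R' (σ u) (σ v))

/-- The renaming `σ` is an isomorphism of the trees that respects the highest leaves. -/
structure NodeIso (σ : Equiv.Perm V) (R R' : V → V → Prop) (f g : V → ℝ) : Prop
    extends NodeMap σ R R' where
  highest : ∀ v m, ¬ IsReg R v → (IsHighest R f v m ↔ IsHighest R' g (σ v) (σ m))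

theorem NodeMap.tip [Finite V] (hR : IsTreeOrder R) (hR' : IsTreeOrder R')
    (h : NodeMap σ R R') (m : V) : IsTip R m ↔ IsTip R' (σ m) := by
  by_cases hm : IsReg R m
  · exact iff_of_false (fun h => not_reg_of_tip h hm)
      (fun h' => not_reg_of_tip h' ((h.reg m).1 hm))
  · rw [hR.isTip_iff_of_node, hR'.isTip_iff_of_node,
      σ.forall_congr_left]
    refine forall_congr' fun u => ?_
    rw [h.reg, Equiv.apply_symm_apply, Equiv.symm_apply_eq]
    refine imp_congr_right fun hu => imp_congr_left ?_
    rw [h.le m _ hm (by rwa [h.reg, Equiv.apply_symm_apply]), Equiv.apply_symm_apply]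

theorem NodeMap.lowest (hR : IsTreeOrder R) (hR' : IsTreeOrder R')
    (h : NodeMap σ R R') (v : V) : IsLowest R v ↔ IsLowest R' (σ v) := by
  by_cases hm : IsReg R v
  · exact iff_of_false (fun h => not_reg_of_bot h hm)
      (fun h' => not_reg_of_bot h' ((h.reg v).1 hm))
  · rw [hR.isLowest_iff_of_node, hR'.isLowest_iff_of_node, σ.forall_congr_left]
    refine forall_congr' fun u => ?_
    rw [h.reg, Equiv.apply_symm_apply]
    refine imp_congr_right fun hu => ?_
    rw [h.le v _ hm (by rwa [h.reg, Equiv.apply_symm_apply]), Equiv.apply_symm_apply]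

theorem NodeMap.nodeIso [Finite V] (hR : IsTreeOrder R) (hR' : IsTreeOrder R')
    (h : NodeMap σ R R')
    (hleaf : ∀ m m', IsTip R m → IsTip R m' → (f m' ≤ f m ↔ g (σ m') ≤ g (σ m))) :
    NodeIso σ R R' f g := by
  refine ⟨h, fun v m hv => ?_⟩
  unfold IsHighest
  rw [← h.tip hR hR']
  refine and_congr_right fun hm => ?_
  rw [h.le v m hv (not_reg_of_tip hm)]
  refine and_congr_right fun _ => ?_
  rw [σ.forall_congr_left]
  refine forall_congr' fun u => ?_
  rw [h.tip hR hR', Equiv.apply_symm_apply]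
  refine imp_congr_right fun hu => ?_
  have hu' : IsTip R (σ.symm u) := by rwa [h.tip hR hR', Equiv.apply_symm_apply]
  rw [h.le v _ hv (not_reg_of_tip hu'), hleaf m _ hm hu', Equiv.apply_symm_apply]

theorem NodeIso.start [Finite V] (hR : IsTreeOrder R) (hR' : IsTreeOrder R')
    (h : NodeIso σ R R' f g) {s m : V} (hs : IsStart R f s m) : IsStart R' g (σ s) (σ m) := by
  obtain ⟨h1, h2, h3, h4, h5, h6⟩ := hs
  have hm := not_reg_of_tip h1
  refine ⟨(h.tip hR hR' m).1 h1, fun h' => h2 ((h.reg s).2 h'), (h.le s m h2 hm).1 h3,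
    fun h' => h4 (σ.injective h'), ?_, ?_⟩
  · rwa [← h.lowest hR hR', ← h.highest _ _ h2]
  · intro v hv hsv hne hvm
    obtain ⟨v, rfl⟩ := σ.surjective v
    rw [← h.reg] at hv
    rw [← h.le _ _ h2 hv] at hsv
    rw [← h.le _ _ hv hm] at hvm
    rw [← h.highest _ _ hv]
    exact h6 v hv hsv (fun h' => hne (h' ▸ rfl)) hvm

theorem NodeIso.symm (h : NodeIso σ R R' f g) :
    NodeIso σ⁻¹ R' R g f where
  reg v := by rw [h.reg]; simp
  le u v hu hv := by rw [h.le _ _ (by rw [h.reg]; simpa) (by rw [h.reg]; simpa)]; simp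
  highest v m hv := by rw [h.highest _ _ (by rw [h.reg]; simpa)]; simp

theorem NodeIso.obdtSubgraph [Finite V] (hR : IsTreeOrder R) (hR' : IsTreeOrder R')
    (h : NodeIso σ R R' f g) :
    OBDTSubgraph σ (branchDecompositionTree (nodeTree R) f)
      (branchDecompositionTree (nodeTree R') g) := by
  refine obdtSubgraph_of_branchMap hR hR' ⟨h.start hR hR', ?_⟩ ?_
  · intro s m m' hs hl hm'
    exact ⟨fun h' => hl ((h.lowest hR hR' s).2 h'), (h.highest _ _ hs.2.1).1 hm'⟩
  · intro s₁ m₁ s₂ m₂ m' h1 h2 _ _ _ _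
    exact h.le _ _ h1.2.1 h2.2.1

theorem NodeIso.map_eq (h : NodeIso σ R R' f g) :
    (nodeTree R).map σ = nodeTree R' := by
  have hedge : ∀ u v, (u, v) ∈ (nodeTree R).edges ↔ (σ u, σ v) ∈ (nodeTree R').edges := by
    intro u v
    by_cases hu : IsReg R u
    · exact iff_of_false (fun h' => h'.1 hu) (fun h' => h'.1 ((h.reg u).1 hu))
    by_cases hv : IsReg R v
    · exact iff_of_false (fun h' => h'.2.1 hv) (fun h' => h'.2.1 ((h.reg v).1 hv))
    change (_ ∧ _ ∧ _ ∧ _ ∧ ∀ w, _) ↔ (_ ∧ _ ∧ _ ∧ _ ∧ ∀ w, _)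
    dsimp only
    rw [← h.reg, ← h.reg, ← h.le v u hv hu, σ.injective.ne_iff, σ.forall_congr_left]
    refine and_congr_right fun _ => and_congr_right fun _ => and_congr_right fun _ =>
      and_congr_right fun _ => forall_congr' fun w => ?_
    rw [h.reg, Equiv.apply_symm_apply]
    refine imp_congr_right fun hw => ?_
    have hw' : ¬ IsReg R (σ.symm w) := by rwa [h.reg, Equiv.apply_symm_apply]
    rw [h.le v _ hv hw', h.le _ u hw' hu, Equiv.apply_symm_apply, Equiv.symm_apply_eq,
      Equiv.symm_apply_eq]
  refine ParentGraph.ext ?_ ?_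
  · ext v
    constructor
    · rintro ⟨u, hu, rfl⟩
      exact fun h' => hu ((h.reg u).2 h')
    · intro hv
      exact ⟨σ.symm v, fun h' => hv (by simpa using (h.reg _).1 h'), by simp⟩
  · ext ⟨u, v⟩
    constructor
    · rintro ⟨⟨a, b⟩, hab, he⟩
      simp only [Prod.map_apply, Prod.mk.injEq] at he
      obtain ⟨rfl, rfl⟩ := he
      exact (hedge a b).1 hab
    · intro huv
      refine ⟨(σ.symm u, σ.symm v), (hedge _ _).2 (by simpa using huv), by simp⟩

end IsTreeOrder

end BranchMap

/-! ### The order of a scalar field on a graph -/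

section MergeOrder

variable {V : Type*}

/-- `b` can be reached from `a` by steps into `S`. -/
def ReachIn (G : SimpleGraph V) (S : Set V) (a b : V) : Prop :=
  Relation.ReflTransGen (fun a b => G.Adj a b ∧ b ∈ S) a b

/-- `u` can be reached from `v` without going below `v`. -/
def MergeLE (G : SimpleGraph V) (f : V → ℝ) (v u : V) : Prop :=
  ReachIn G {w | f v ≤ f w} v u

variable {G : SimpleGraph V} {S T : Set V} {a b c : V} {f : V → ℝ}

namespace ReachIn

theorem trans (h : ReachIn G S a b) (h' : ReachIn G S b c) : ReachIn G S a c :=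
  Relation.ReflTransGen.trans h h'

theorem mono (hST : S ⊆ T) (h : ReachIn G S a b) : ReachIn G T a b :=
  Relation.ReflTransGen.mono (fun _ _ h => ⟨h.1, hST h.2⟩) _ _ h

theorem mem (h : ReachIn G S a b) (ha : a ∈ S) : b ∈ S := by
  induction h with
  | refl => exact ha
  | tail _ h _ => exact h.2

theorem symm (h : ReachIn G S a b) (ha : a ∈ S) : ReachIn G S b a := by
  induction h with
  | refl => exact Relation.ReflTransGen.refl
  | tail h1 h2 ih => exact Relation.ReflTransGen.head ⟨h2.1.symm, mem h1 ha⟩ ih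

theorem of_reachable_induce {a b : S} (h : (G.induce S).Reachable a b) : ReachIn G S a b := by
  rw [SimpleGraph.reachable_iff_reflTransGen] at h
  induction h with
  | refl => exact Relation.ReflTransGen.refl
  | tail _ h ih => exact Relation.ReflTransGen.tail ih ⟨h, Subtype.coe_prop _⟩

theorem reachable_induce (h : ReachIn G S a b) (ha : a ∈ S) :
    ∃ hb : b ∈ S, (G.induce S).Reachable ⟨a, ha⟩ ⟨b, hb⟩ := by
  induction h with
  | refl => exact ⟨ha, .refl _⟩
  | tail _ h2 ih =>
    obtain ⟨hb, ih⟩ := ih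
    refine ⟨h2.2, ih.trans (SimpleGraph.Adj.reachable ?_)⟩
    exact h2.1

end ReachIn

theorem MergeLE.le (h : MergeLE G f a b) : f a ≤ f b :=
  ReachIn.mem (S := {w | f a ≤ f w}) h (le_refl (f a))

theorem isTreeOrder_mergeLE [Finite V] [Nonempty V] (hG : ∀ a b, ReachIn G Set.univ a b)
    (hf : Function.Injective f) : IsTreeOrder (MergeLE G f) where
  refl _ := Relation.ReflTransGen.refl
  trans {a b c} h h' := ReachIn.trans h
    (ReachIn.mono (fun w (hw : f b ≤ f w) => le_trans h.le hw) h')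
  antisymm h h' := hf (le_antisymm h.le h'.le)
  linear {a b u} h h' := by
    rcases le_total (f a) (f b) with hab | hab
    · left
      exact ReachIn.trans h ((ReachIn.mono (fun w (hw : f b ≤ f w) => le_trans hab hw) h').symm hab)
    · right
      exact ReachIn.trans h' ((ReachIn.mono (fun w (hw : f a ≤ f w) => le_trans hab hw) h).symm hab)
  root := by
    obtain ⟨r, hr⟩ := Finite.exists_min f
    exact ⟨r, fun u => ReachIn.mono (fun w _ => hr w) (hG r u)⟩

theorem isAugmentedEdge_iff [Finite V] (hR : IsTreeOrder (MergeLE G f)) {y x : V} :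
    IsAugmentedEdge G f y x ↔ MergeLE G f x y ∧ x ≠ y ∧
      ∀ w, MergeLE G f x w → MergeLE G f w y → w = x ∨ w = y := by
  constructor
  · rintro ⟨C, ⟨⟨y', hy⟩, hyC, rfl⟩, hmin, ⟨z, hz⟩, hzC, hadj⟩
    have hCmem : ∀ (w : V), (ReachIn G {u | f x < f u} y' w) →
        ∃ hw : w ∈ {u | f x < f u}, (⟨w, hw⟩ : {u | f x < f u}) ∈ C.supp := by
      intro w h
      obtain ⟨hw, h⟩ := h.reachable_induce hy
      refine ⟨hw, ?_⟩
      rw [SimpleGraph.ConnectedComponent.mem_supp_iff] at hyC ⊢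
      rw [← hyC]
      exact (SimpleGraph.ConnectedComponent.sound h).symm
    have hzy : ReachIn G {u | f x < f u} z y' := by
      rw [SimpleGraph.ConnectedComponent.mem_supp_iff] at hyC hzC
      exact ReachIn.of_reachable_induce
        (SimpleGraph.ConnectedComponent.exact (hzC.trans hyC.symm))
    refine ⟨Relation.ReflTransGen.head ⟨hadj, show f x ≤ f z from le_of_lt hz⟩
      (ReachIn.mono (fun w (hw : f x < f w) => le_of_lt hw) hzy), ?_, ?_⟩
    · rintro rfl; exact lt_irrefl (f x) hy
    · intro w hxw hwy
      by_cases hwx : w = x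
      · exact Or.inl hwx
      right
      have hlt : f x < f w := lt_of_le_of_ne hxw.le (fun h => by
        have h1 : MergeLE G f w x := ReachIn.symm (ReachIn.mono
          (fun u (hu : f x ≤ f u) => by exact h ▸ hu) hxw) (le_of_eq h.symm)
        exact hwx (hR.antisymm h1 hxw))
      have h1 : ReachIn G {u | f w ≤ f u} y' w := ReachIn.symm hwy (le_refl (f w))
      obtain ⟨hw, hwC⟩ := hCmem w (ReachIn.mono (fun u hu => lt_of_lt_of_le hlt hu) h1)
      have h2 := hmin _ hwC
      exact hR.antisymm hwy (ReachIn.mono (fun u (hu : f w ≤ f u) => le_trans h2 hu) h1)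
  · rintro ⟨h1, h2, h3⟩
    have key : ∀ u, MergeLE G f x u → u ≠ x → ∃ z, G.Adj x z ∧ f x < f z ∧
        ReachIn G {u | f x < f u} z u := by
      intro u hu
      have : ∀ w, MergeLE G f x w → w ≠ x → f x < f w := fun w hw hne =>
        lt_of_le_of_ne hw.le (fun h => by
          have h1 : MergeLE G f w x := ReachIn.symm (ReachIn.mono
            (fun u (hu : f x ≤ f u) => by exact h ▸ hu) hw) (le_of_eq h.symm)
          exact hne (hR.antisymm h1 hw))
      induction hu with
      | refl => exact fun h => absurd rfl h
      | @tail v w hv hw ih =>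
        intro hne
        have hlt := this w (Relation.ReflTransGen.tail hv hw) hne
        by_cases hvx : v = x
        · subst hvx
          exact ⟨w, hw.1, hlt, Relation.ReflTransGen.refl⟩
        · obtain ⟨z, hz1, hz2, hz3⟩ := ih hvx
          exact ⟨z, hz1, hz2, Relation.ReflTransGen.tail hz3 ⟨hw.1, hlt⟩⟩
    obtain ⟨z, hz1, hz2, hz3⟩ := key y h1 h2.symm
    have hy : f x < f y := hz3.mem hz2
    refine ⟨(G.induce {u | f x < f u}).connectedComponentMk ⟨y, hy⟩, ⟨⟨y, hy⟩, rfl, rfl⟩, ?_,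
      ⟨z, hz2⟩, ?_, hz1⟩
    · obtain ⟨m, hm, hmin⟩ := Set.exists_min_image {w | ReachIn G {u | f x < f u} y w} f
        (Set.toFinite _) ⟨y, Relation.ReflTransGen.refl⟩
      have hm' : ReachIn G {u | f x < f u} m y := ReachIn.symm hm hy
      have hmy : MergeLE G f m y := by
        have : ∀ w, ReachIn G {u | f x < f u} m w → MergeLE G f m w := by
          intro w hw
          induction hw with
          | refl => exact Relation.ReflTransGen.refl
          | tail h h' ih =>
            exact Relation.ReflTransGen.tail ih ⟨h'.1, hmin _ (hm.trans (Relation.ReflTransGen.tail h h'))⟩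
        exact this y hm'
      have hxm : MergeLE G f x m := ReachIn.trans h1 (ReachIn.mono (fun w (hw : f x < f w) => le_of_lt hw) hm)
      have hmx : m ≠ x := by
        rintro rfl
        exact lt_irrefl (f m) (ReachIn.mem (S := {u | f m < f u}) hm hy)
      obtain rfl : m = y := (h3 m hxm hmy).resolve_left hmx
      rintro ⟨w, hw⟩ hwC
      rw [SimpleGraph.ConnectedComponent.mem_supp_iff] at hwC
      exact hmin w (ReachIn.of_reachable_induce
        (SimpleGraph.ConnectedComponent.exact hwC.symm))
    · obtain ⟨hb, h⟩ := hz3.reachable_induce hz2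
      exact SimpleGraph.ConnectedComponent.sound h

namespace IsTreeOrder

variable (hR : IsTreeOrder (MergeLE G f))
include hR

theorem augmented_isRoot_iff [Finite V] {v : V} :
    (augmentedMergeTree G f).IsRoot v ↔ IsLowest (MergeLE G f) v := by
  constructor
  · rintro ⟨-, h⟩
    obtain ⟨r, hr⟩ := hR.root
    by_cases hrv : r = v
    · exact hrv ▸ hr
    · obtain ⟨p, ⟨h2, h3⟩, h4, h5⟩ := hR.exists_maximal
        (fun p => MergeLE G f p v ∧ p ≠ v) ⟨hr v, hrv⟩
      refine absurd ((isAugmentedEdge_iff hR).2 ⟨h2, h3, fun w hpw hwu => ?_⟩) (h p)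
      by_cases hwu' : w = v
      · exact Or.inr hwu'
      · exact Or.inl (h5 w ⟨hwu, hwu'⟩ hpw)
  · intro h
    refine ⟨trivial, fun p hp => ?_⟩
    have hp := (isAugmentedEdge_iff hR).1 hp
    exact hp.2.1 (hR.antisymm hp.1 (h p))

theorem exists_augmentedEdge [Finite V] {v u : V} (h : MergeLE G f v u) (hne : v ≠ u) :
    ∃ c, IsAugmentedEdge G f c v ∧ MergeLE G f c u := by
  obtain ⟨p, ⟨h2, h3⟩, h4, h5⟩ := hR.exists_minimal
    (fun p => MergeLE G f v p ∧ p ≠ v) ⟨h, hne.symm⟩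
  refine ⟨p, (isAugmentedEdge_iff hR).2 ⟨h2, h3.symm, fun w hpw hwu => ?_⟩, h4⟩
  by_cases hwu' : w = v
  · exact Or.inl hwu'
  · exact Or.inr (h5 w ⟨hpw, hwu'⟩ hwu)

theorem deg_eq_zero_iff [Finite V] {v : V} :
    (augmentedMergeTree G f).deg v = 0 ↔ IsTip (MergeLE G f) v := by
  unfold ParentGraph.deg
  rw [Set.ncard_eq_zero (Set.toFinite _), Set.eq_empty_iff_forall_notMem]
  constructor
  · intro h u hu
    by_contra hne
    obtain ⟨c, hc, -⟩ := hR.exists_augmentedEdge hu (Ne.symm hne)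
    exact h c hc
  · intro h c hc
    have hc := (isAugmentedEdge_iff hR).1 hc
    exact hc.2.1 (h c hc.1).symm

theorem isRegularVertex_iff [Finite V] {v : V} :
    IsRegularVertex G f v ↔ IsReg (MergeLE G f) v := by
  unfold IsRegularVertex IsReg
  rw [hR.augmented_isRoot_iff]
  refine and_congr_right fun _ => ?_
  unfold ParentGraph.deg
  rw [Set.ncard_eq_one]
  constructor
  · rintro ⟨c, hc⟩
    have hcm : IsAugmentedEdge G f c v := by
      have : c ∈ (augmentedMergeTree G f).children v := by rw [hc]; rfl
      exact this
    have hc1 := (isAugmentedEdge_iff hR).1 hcm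
    refine ⟨c, hc1.1, hc1.2.1.symm, fun u hu hne => ?_⟩
    obtain ⟨c', hc', hcu⟩ := hR.exists_augmentedEdge hu hne.symm
    have : c' ∈ (augmentedMergeTree G f).children v := hc'
    rw [hc, Set.mem_singleton_iff] at this
    exact this ▸ hcu
  · rintro ⟨w, h1, h2, h3⟩
    refine ⟨w, Set.eq_singleton_iff_unique_mem.2 ⟨?_, fun c hc => ?_⟩⟩
    · refine (isAugmentedEdge_iff hR).2 ⟨h1, h2.symm, fun u hu huw => ?_⟩
      by_cases huv : u = v
      · exact Or.inl huv
      · exact Or.inr (hR.antisymm huw (h3 u hu huv))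
    · have hc := (isAugmentedEdge_iff hR).1 hc
      exact ((hc.2.2 w h1 (h3 c hc.1 hc.2.1.symm)).resolve_left h2).symm

theorem isMaximumVertex_iff [Finite V] {v : V} :
    IsMaximumVertex G f v ↔ ¬ IsLowest (MergeLE G f) v ∧ IsTip (MergeLE G f) v := by
  unfold IsMaximumVertex
  rw [hR.augmented_isRoot_iff, hR.deg_eq_zero_iff]

theorem isSaddleVertex_iff [Finite V] {v : V} :
    IsSaddleVertex G f v ↔ ¬ IsLowest (MergeLE G f) v ∧ ¬ IsTip (MergeLE G f) v ∧
      ¬ IsReg (MergeLE G f) v := by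
  rw [← hR.isRegularVertex_iff, ← hR.deg_eq_zero_iff]
  unfold IsSaddleVertex IsRegularVertex
  rw [hR.augmented_isRoot_iff]
  constructor
  · rintro ⟨h1, h2⟩
    exact ⟨h1, by omega, fun h => by omega⟩
  · rintro ⟨h1, h2, h3⟩
    refine ⟨h1, ?_⟩
    have : (augmentedMergeTree G f).deg v ≠ 1 := fun h => h3 ⟨h1, h⟩
    omega

theorem prunedPath_iff [Finite V] {a b : V} :
    PrunedPath G f a b ↔ MergeLE G f b a ∧ b ≠ a ∧
      ∀ w, ¬ IsReg (MergeLE G f) w → MergeLE G f b w → MergeLE G f w a → w = a ∨ w = b := by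
  constructor
  · intro h
    induction h with
    | edge h =>
      have h := (isAugmentedEdge_iff hR).1 h
      exact ⟨h.1, h.2.1, fun w _ h1 h2 => (h.2.2 w h1 h2).symm⟩
    | @step a r b h hr _ ih =>
      have h := (isAugmentedEdge_iff hR).1 h
      refine ⟨hR.trans ih.1 h.1, ?_, fun w hw h1 h2 => ?_⟩
      · rintro rfl
        exact h.2.1 (hR.antisymm h.1 ih.1)
      · rcases hR.linear h2 h.1 with h3 | h3
        · rcases ih.2.2 w hw h1 h3 with h4 | h4
          · subst h4
            exact absurd (hR.isRegularVertex_iff.1 hr) hw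
          · exact Or.inr h4
        · rcases h.2.2 w h3 h2 with h4 | h4
          · subst h4
            exact absurd (hR.isRegularVertex_iff.1 hr) hw
          · exact Or.inl h4
  · rintro ⟨h1, h2, h3⟩
    obtain ⟨p, ⟨hbp, hpb, hpa, hp⟩, -, hmin⟩ := hR.exists_minimal
      (fun p => MergeLE G f b p ∧ b ≠ p ∧ MergeLE G f p a ∧ (p = a ∨ (IsReg (MergeLE G f) p ∧
        ∀ q, PrunedPath G f p q → PrunedPath G f a q)))
      (a := a) ⟨h1, h2, hR.refl a, Or.inl rfl⟩
    have hp' : ∀ q, PrunedPath G f p q → PrunedPath G f a q := by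
      rcases hp with rfl | hp
      · exact fun q h => h
      · exact hp.2
    apply hp'
    obtain ⟨q, ⟨k1, k2, k3⟩, -, k4⟩ := hR.exists_maximal
      (fun q => MergeLE G f b q ∧ MergeLE G f q p ∧ q ≠ p) ⟨hR.refl b, hbp, hpb⟩
    have hedge : IsAugmentedEdge G f p q := by
      refine (isAugmentedEdge_iff hR).2 ⟨k2, k3, fun w hqw hwp => ?_⟩
      by_cases hwp' : w = p
      · exact Or.inr hwp'
      · exact Or.inl (k4 w ⟨hR.trans k1 hqw, hwp, hwp'⟩ hqw)
    by_cases hqb : b = q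
    · subst hqb; exact .edge hedge
    · exfalso
      have hqa : q ≠ a := by
        rintro rfl
        exact k3 (hR.antisymm k2 hpa)
      have hqr : IsReg (MergeLE G f) q := by
        by_contra hq
        rcases h3 q hq k1 (hR.trans k2 hpa) with h | h
        · exact hqa h
        · exact hqb h.symm
      have := hmin q ⟨k1, hqb, hR.trans k2 hpa, Or.inr ⟨hqr, fun c hc =>
        hp' c (.step hedge (hR.isRegularVertex_iff.2 hqr) hc)⟩⟩ k2
      exact k3 this

theorem mergeTree_eq [Finite V] : mergeTree G f = nodeTree (MergeLE G f) := by
  refine ParentGraph.ext ?_ ?_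
  · ext v
    exact not_congr hR.isRegularVertex_iff
  · ext ⟨u, v⟩
    change (_ ∧ _ ∧ _) ↔ (_ ∧ _ ∧ _ ∧ _ ∧ _)
    rw [hR.isRegularVertex_iff, hR.isRegularVertex_iff, hR.prunedPath_iff]
    dsimp only
    rw [ne_comm]

end IsTreeOrder

end MergeOrder

/-! ### Two vertices exchanging their positions -/

section Passes

variable {V : Type*} [DecidableEq V]

/-- The vertex orderings of `f` and `g` differ by exchanging the consecutive vertices `x`, `y`,
where `x` is below `y` in the ordering of `f`. -/
structure Passes (f g : V → ℝ) (x y : V) : Prop where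
  inj : Function.Injective f
  inj' : Function.Injective g
  ne : x ≠ y
  le_iff : ∀ u v, f u ≤ f v ↔ g (Equiv.swap x y u) ≤ g (Equiv.swap x y v)
  lt : f x < f y
  between : ∀ w, f x ≤ f w → f w ≤ f y → w = x ∨ w = y

namespace Passes

variable {f g : V → ℝ} {x y : V}

theorem lt' (h : Passes f g x y) : g y < g x := by
  have := (h.le_iff y x).not
  rw [Equiv.swap_apply_right, Equiv.swap_apply_left, not_le, not_le] at this
  exact this.1 h.lt

theorem symm (h : Passes f g x y) : Passes g f y x where
  inj := h.inj'
  inj' := h.inj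
  ne := h.ne.symm
  le_iff u v := by
    rw [h.le_iff, Equiv.swap_comm y x, Equiv.swap_apply_self, Equiv.swap_apply_self]
  lt := h.lt'
  between w h1 h2 := by
    by_cases hx : w = x
    · exact Or.inr hx
    by_cases hy : w = y
    · exact Or.inl hy
    have e1 := h.le_iff x w
    have e2 := h.le_iff w y
    rw [Equiv.swap_apply_left, Equiv.swap_apply_of_ne_of_ne hx hy] at e1
    rw [Equiv.swap_apply_right, Equiv.swap_apply_of_ne_of_ne hx hy] at e2
    exact (h.between w (e1.2 h1) (e2.2 h2)).symm

theorem le_iff_left (h : Passes f g x y) {v : V} (hx : v ≠ x) (hy : v ≠ y) (b : V) :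
    f v ≤ f b ↔ g v ≤ g b := by
  have e := h.le_iff v b
  rw [Equiv.swap_apply_of_ne_of_ne hx hy] at e
  have hs := h.symm
  by_cases hbx : b = x
  · subst hbx
    rw [Equiv.swap_apply_left] at e
    rw [e]
    refine ⟨fun h' => h'.trans h.lt'.le, fun h' => ?_⟩
    by_contra hlt
    rcases hs.between v (not_le.1 hlt).le h' with h1 | h1
    · exact hy h1
    · exact hx h1
  by_cases hby : b = y
  · subst hby
    rw [Equiv.swap_apply_right] at e
    have e' := h.le_iff v x
    rw [Equiv.swap_apply_of_ne_of_ne hx hy, Equiv.swap_apply_left] at e'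
    rw [← e']
    refine ⟨fun h' => ?_, fun h' => h'.trans h.lt.le⟩
    by_contra hlt
    rcases h.between v (not_le.1 hlt).le h' with h1 | h1
    · exact hx h1
    · exact hy h1
  · rw [Equiv.swap_apply_of_ne_of_ne hbx hby] at e
    exact e

theorem le_iff_right (h : Passes f g x y) {v : V} (hx : v ≠ x) (hy : v ≠ y) (b : V) :
    f b ≤ f v ↔ g b ≤ g v := by
  by_cases hb : b = v
  · subst hb; simp
  have h1 := h.le_iff_left hx hy b
  have h2 : f b ≠ f v := fun e => hb (h.inj e)
  have h3 : g b ≠ g v := fun e => hb (h.inj' e)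
  constructor
  · intro h4
    by_contra h5
    exact h2 (le_antisymm h4 (h1.2 (not_le.1 h5).le))
  · intro h4
    by_contra h5
    exact h3 (le_antisymm h4 (h1.1 (not_le.1 h5).le))

theorem le_iff_of_ne (h : Passes f g x y) {u v : V} (h1 : u ≠ x ∨ v ≠ y) (h2 : u ≠ y ∨ v ≠ x) :
    f u ≤ f v ↔ g u ≤ g v := by
  by_cases hv : v ≠ x ∧ v ≠ y
  · exact h.le_iff_right hv.1 hv.2 u
  by_cases hu : u ≠ x ∧ u ≠ y
  · exact h.le_iff_left hu.1 hu.2 v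
  have : u = v := by
    by_cases hvx : v = x
    · have := h2.resolve_right (not_not.2 hvx)
      by_contra hne
      exact hu ⟨fun e => hne (e.trans hvx.symm), this⟩
    · have hvy : v = y := by by_contra hvy; exact hv ⟨hvx, hvy⟩
      have := h1.resolve_right (not_not.2 hvy)
      by_contra hne
      exact hu ⟨this, fun e => hne (e.trans hvy.symm)⟩
  subst this
  simp

end Passes

/-- The situation of `x` passing `y` where `y` lies above `x`, in terms of the tree orders `R` and
`R'` of the two scalar fields `f` and `g`. -/
structure Linked (R R' : V → V → Prop) (f g : V → ℝ) (x y : V) : Prop where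
  passes : Passes f g x y
  tree : IsTreeOrder R
  tree' : IsTreeOrder R'
  le_of : ∀ {u v}, R u v → f u ≤ f v
  le_of' : ∀ {u v}, R' u v → g u ≤ g v
  off : ∀ {v}, v ≠ x → v ≠ y → ∀ u, R v u ↔ R' v u
  low : ∀ u, R x u ↔ R' y u
  link : R x y
  cover : ∀ u, R x u → u = x ∨ u = y ∨ R y u ∨ R' x u
  single : ∀ r, IsLowest R r → ∃ w, w ≠ r ∧ ∀ u, u ≠ r → R w u
  single' : ∀ r, IsLowest R' r → ∃ w, w ≠ r ∧ ∀ u, u ≠ r → R' w u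

namespace Linked

variable {R R' : V → V → Prop} {f g : V → ℝ} {x y : V}

theorem symm (h : Linked R R' f g x y) : Linked R' R g f y x where
  passes := h.passes.symm
  tree := h.tree'
  tree' := h.tree
  le_of := h.le_of'
  le_of' := h.le_of
  off h1 h2 u := (h.off h2 h1 u).symm
  low u := (h.low u).symm
  link := (h.low x).1 (h.tree.refl x)
  cover u hu := by
    rcases h.cover u ((h.low u).2 hu) with h1 | h1 | h1 | h1
    · exact Or.inr (Or.inl h1)
    · exact Or.inl h1
    · exact Or.inr (Or.inr (Or.inr h1))
    · exact Or.inr (Or.inr (Or.inl h1))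
  single := h.single'
  single' := h.single

variable (h : Linked R R' f g x y)
include h

theorem ne : x ≠ y := h.passes.ne

theorem link' : R' y x := h.symm.link

theorem not_le : ¬ R y x := fun h' => h.ne (h.tree.antisymm h.link h')

theorem not_le' : ¬ R' x y := h.symm.not_le

theorem eq_or_eq {u : V} (h1 : R x u) (h2 : R u y) : u = x ∨ u = y :=
  h.passes.between u (h.le_of h1) (h.le_of h2)

theorem le_iff {v : V} (hx : v ≠ x) (hy : v ≠ y) : R v x ↔ R v y := by
  refine ⟨fun h' => h.tree.trans h' h.link, fun h' => ?_⟩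
  rcases h.tree.linear h' h.link with h1 | h1
  · exact h1
  · rcases h.eq_or_eq h1 h' with h2 | h2
    · exact absurd h2 hx
    · exact absurd h2 hy

theorem up_closed {u v : V} (hxu : R x u) (hux : u ≠ x) (huy : u ≠ y) (huv : R u v)
    (hyv : R y v) : R y u := by
  rcases h.tree.linear huv hyv with h1 | h1
  · rcases h.eq_or_eq hxu h1 with h2 | h2
    · exact absurd h2 hux
    · exact absurd h2 huy
  · exact h1

theorem lowest_iff {v : V} (hx : v ≠ x) (hy : v ≠ y) : IsLowest R v ↔ IsLowest R' v :=
  forall_congr' (h.off hx hy)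

theorem lowest_iff_low : IsLowest R x ↔ IsLowest R' y := forall_congr' h.low

theorem not_lowest : ¬ IsLowest R y := fun hl => h.not_le (hl x)

theorem not_lowest' : ¬ IsLowest R' x := h.symm.not_lowest

theorem tip_iff {v : V} (hx : v ≠ x) (hy : v ≠ y) : IsTip R v ↔ IsTip R' v :=
  forall_congr' fun u => imp_congr_left (h.off hx hy u)

theorem not_tip : ¬ IsTip R x := fun hl => h.ne (hl y h.link).symm

theorem not_tip' : ¬ IsTip R' y := h.symm.not_tip

theorem reg_of_reg {v : V} (hx : v ≠ x) (hy : v ≠ y) (hr : IsReg R v) : IsReg R' v := by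
  obtain ⟨h1, w, h2, h3, h4⟩ := hr
  refine ⟨fun hl => h1 ((h.lowest_iff hx hy).2 hl), ?_⟩
  by_cases hwx : w = x
  · subst hwx
    refine ⟨y, (h.off hx hy y).1 (h.tree.trans h2 h.link), hy.symm, fun u hu hne => ?_⟩
    exact (h.low u).1 (h4 u ((h.off hx hy u).2 hu) hne)
  by_cases hwy : w = y
  · subst hwy
    exact absurd (h4 x ((h.le_iff hx hy).2 h2) hx.symm) h.not_le
  · exact ⟨w, (h.off hx hy w).1 h2, h3, fun u hu hne =>
      (h.off hwx hwy u).1 (h4 u ((h.off hx hy u).2 hu) hne)⟩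

theorem reg_iff {v : V} (hx : v ≠ x) (hy : v ≠ y) : IsReg R v ↔ IsReg R' v :=
  ⟨h.reg_of_reg hx hy, h.symm.reg_of_reg hy hx⟩

theorem reg_left_iff :
    IsReg R x ↔ ¬ IsLowest R x ∧ ∀ u, R x u → u ≠ x → u ≠ y → R y u := by
  refine and_congr_right fun _ => ⟨?_, ?_⟩
  · rintro ⟨w, h2, h3, h4⟩ u hu hux _
    have := (h.eq_or_eq h2 (h4 y h.link h.ne.symm)).resolve_left h3
    exact this ▸ h4 u hu hux
  · intro h'
    refine ⟨y, h.link, h.ne.symm, fun u hu hux => ?_⟩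
    by_cases huy : u = y
    · rw [huy]; exact h.tree.refl y
    · exact h' u hu hux huy

theorem reg_right_iff :
    IsReg R' y ↔ ¬ IsLowest R x ∧ ∀ u, R x u → u ≠ x → u ≠ y → R' x u := by
  rw [h.symm.reg_left_iff, h.lowest_iff_low]
  refine and_congr_right fun _ => forall_congr' fun u => ?_
  rw [h.low u]
  exact imp_congr_right fun _ => ⟨fun a b c => a c b, fun a b c => a c b⟩

theorem all_of_lowest (hl : IsLowest R x) {u : V} (hux : u ≠ x) : R y u := by
  obtain ⟨w, hw, hw'⟩ := h.single x hl
  rcases h.eq_or_eq (hl w) (hw' y h.ne.symm) with h1 | h1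
  · exact absurd h1 hw
  · exact h1 ▸ hw' u hux

theorem all_of_lowest' (hl : IsLowest R x) {u : V} (huy : u ≠ y) : R' x u :=
  h.symm.all_of_lowest (h.lowest_iff_low.1 hl) huy

theorem swap_le {u : V} (hu : u ≠ y) (v : V) :
    R u v ↔ R' (Equiv.swap x y u) (Equiv.swap x y v) := by
  by_cases hux : u = x
  · subst hux
    rw [Equiv.swap_apply_left]
    by_cases hvx : v = u
    · subst hvx
      rw [Equiv.swap_apply_left]
      exact iff_of_true (h.tree.refl _) (h.tree'.refl _)
    by_cases hvy : v = y
    · subst hvy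
      rw [Equiv.swap_apply_right]
      exact iff_of_true h.link h.link'
    · rw [Equiv.swap_apply_of_ne_of_ne hvx hvy]
      exact h.low v
  · rw [Equiv.swap_apply_of_ne_of_ne hux hu]
    by_cases hvx : v = x
    · subst hvx
      rw [Equiv.swap_apply_left, ← h.off hux hu]
      exact h.le_iff hux hu
    by_cases hvy : v = y
    · subst hvy
      rw [Equiv.swap_apply_right, ← h.off hux hu]
      exact (h.le_iff hux hu).symm
    · rw [Equiv.swap_apply_of_ne_of_ne hvx hvy]
      exact h.off hux hu v

omit [DecidableEq V] h in
theorem nodeMap_of_orderIso {σ : Equiv.Perm V} (hle : ∀ u v, R u v ↔ R' (σ u) (σ v)) :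
    IsTreeOrder.NodeMap σ R R' where
  reg v := by
    unfold IsReg IsLowest
    rw [σ.forall_congr_left, σ.exists_congr_left]
    refine and_congr (not_congr (forall_congr' fun u => by rw [hle, σ.apply_symm_apply]))
      (exists_congr fun w => ?_)
    rw [hle, σ.apply_symm_apply, Ne, Equiv.symm_apply_eq]
    refine and_congr_right fun _ => and_congr_right fun _ => ?_
    rw [σ.forall_congr_left]
    refine forall_congr' fun u => ?_
    rw [hle, hle, σ.apply_symm_apply, σ.apply_symm_apply, Ne, Equiv.symm_apply_eq]
  le u v _ _ := hle u v

theorem nodeIso_of_all [Finite V] (hP : ∀ u, R x u → u ≠ x → u ≠ y → R y u)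
    (hQ : ∀ u, R x u → u ≠ x → u ≠ y → R' x u) :
    IsTreeOrder.NodeIso (Equiv.swap x y) R R' f g := by
  refine (nodeMap_of_orderIso fun u v => ?_).nodeIso h.tree h.tree'
    (fun m m' _ _ => h.passes.le_iff m' m)
  by_cases hu : u = y
  · subst hu
    rw [Equiv.swap_apply_right]
    by_cases hvx : v = x
    · subst hvx
      rw [Equiv.swap_apply_left]
      exact iff_of_false h.not_le h.not_le'
    by_cases hvy : v = u
    · subst hvy
      rw [Equiv.swap_apply_right]
      exact iff_of_true (h.tree.refl _) (h.tree'.refl _)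
    · rw [Equiv.swap_apply_of_ne_of_ne hvx hvy]
      exact ⟨fun h' => hQ v (h.tree.trans h.link h') hvx hvy,
        fun h' => hP v ((h.low v).2 (h.tree'.trans h.link' h')) hvx hvy⟩
  · exact h.swap_le hu v

theorem nodeIso_swap [Finite V] (hy : IsReg R y) (hx : IsReg R' x)
    (ha : ¬ ∀ u, R x u → u ≠ x → u ≠ y → R y u) (hb : ¬ ∀ u, R x u → u ≠ x → u ≠ y → R' x u) :
    IsTreeOrder.NodeIso (Equiv.swap x y) R R' f g := by
  refine IsTreeOrder.NodeMap.nodeIso h.tree h.tree' ⟨fun v => ?_, fun u v hu hv => ?_⟩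
    fun m m' hm hm' => ?_
  · by_cases hvx : v = x
    · subst hvx
      rw [Equiv.swap_apply_left, h.reg_left_iff, h.reg_right_iff]
      exact iff_of_false (fun h' => ha h'.2) (fun h' => hb h'.2)
    by_cases hvy : v = y
    · subst hvy
      rw [Equiv.swap_apply_right]
      exact iff_of_true hy hx
    · rw [Equiv.swap_apply_of_ne_of_ne hvx hvy]
      exact h.reg_iff hvx hvy
  · exact h.swap_le (by rintro rfl; exact hu hy) v
  · exact h.passes.le_iff m' m

theorem exists_above_of_reg (hy : IsReg R y) :
    ∃ k, R y k ∧ R x k ∧ k ≠ x ∧ k ≠ y := by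
  obtain ⟨-, k, h1, h2, -⟩ := hy
  refine ⟨k, h1, h.tree.trans h.link h1, ?_, h2⟩
  rintro rfl
  exact h.not_le h1

theorem nodeIso_refl [Finite V] (hy : IsReg R y)
    (ha : ¬ ∀ u, R x u → u ≠ x → u ≠ y → R y u) (hQ : ∀ u, R x u → u ≠ x → u ≠ y → R' x u) :
    IsTreeOrder.NodeIso (Equiv.refl V) R R' f g := by
  refine IsTreeOrder.NodeMap.nodeIso h.tree h.tree' ⟨fun v => ?_, fun u v hu hv => ?_⟩
    fun m m' hm hm' => ?_
  · rw [Equiv.refl_apply]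
    by_cases hvx : v = x
    · subst hvx
      refine iff_of_false (fun h' => ha (h.reg_left_iff.1 h').2) ?_
      rintro ⟨-, w, h2, h3, h4⟩
      obtain ⟨k, k1, k2, k3, k4⟩ := h.exists_above_of_reg hy
      have hwy : w ≠ y := fun e => h.not_le' (e ▸ h2)
      have hxw := (h.low w).2 (h.tree'.trans h.link' h2)
      have hwk := (h.off h3 hwy k).2 (h4 k (hQ k k2 k3 k4) k3)
      have hyw : R y w := h.up_closed hxw h3 hwy hwk k1
      exact ha fun u h1 hux huy =>
        h.tree.trans hyw ((h.off h3 hwy u).2 (h4 u (hQ u h1 hux huy) hux))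
    by_cases hvy : v = y
    · subst hvy
      refine iff_of_true hy (h.reg_right_iff.2 ⟨fun hl => ?_, hQ⟩)
      exact ha fun u _ hux _ => h.all_of_lowest hl hux
    · exact h.reg_iff hvx hvy
  · simp only [Equiv.refl_apply]
    have huy : u ≠ y := by rintro rfl; exact hu hy
    have hvy : v ≠ y := by rintro rfl; exact hv hy
    by_cases hux : u = x
    · subst hux
      by_cases hvx : v = u
      · subst hvx
        exact iff_of_true (h.tree.refl _) (h.tree'.refl _)
      · exact ⟨fun h' => hQ v h' hvx hvy, fun h' => (h.low v).2 (h.tree'.trans h.link' h')⟩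
    · exact h.off hux huy v
  · have h1 : m ≠ y := by rintro rfl; exact IsTreeOrder.not_reg_of_tip hm hy
    have h2 : m' ≠ y := by rintro rfl; exact IsTreeOrder.not_reg_of_tip hm' hy
    exact h.passes.le_iff_of_ne (Or.inr h1) (Or.inl h2)

end Linked

end Passes

/-! ### Inclusions up to renaming, and horizontal swaps -/

section Horizontal

variable {V : Type*}

/-- Inclusion of the trees up to renaming of `x` and `y`. -/
def NodeTreeIncluded (R R' : V → V → Prop) (x y : V) : Prop :=
  ∃ σ, RenamesOnly x y σ ∧ ((nodeTree R).map σ).IsSubgraph (nodeTree R')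

/-- Inclusion of the ordered branch decomposition trees up to renaming of `x` and `y`. -/
def BranchesIncluded (R R' : V → V → Prop) (f g : V → ℝ) (x y : V) : Prop :=
  ∃ σ, RenamesOnly x y σ ∧ OBDTSubgraph σ (branchDecompositionTree (nodeTree R) f)
    (branchDecompositionTree (nodeTree R') g)

/-- `v` is not the root and has several children. -/
def IsSaddle (R : V → V → Prop) (v : V) : Prop := ¬ IsLowest R v ∧ ¬ IsTip R v ∧ ¬ IsReg R v

/-- One saddle of the first tree is split into the saddles `y` (below) and `x` (above). -/
def SaddleSplitting (R R' : V → V → Prop) (x y : V) : Prop :=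
  ((IsReg R x ∧ IsSaddle R y) ∨ (IsReg R y ∧ IsSaddle R x)) ∧
    (x, y) ∈ (nodeTree R').edges ∧ IsSaddle R' x ∧ IsSaddle R' y

/-- Saddles are exchanged, split or merged. -/
def SaddlesChange (R R' : V → V → Prop) (x y : V) : Prop :=
  ((y, x) ∈ (nodeTree R).edges ∧ (x, y) ∈ (nodeTree R').edges ∧
    IsSaddle R x ∧ IsSaddle R y ∧ IsSaddle R' x ∧ IsSaddle R' y) ∨
  SaddleSplitting R R' x y ∨ SaddleSplitting R' R y x

theorem RenamesOnly.symm {x y : V} {σ : Equiv.Perm V} (h : RenamesOnly x y σ) :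
    RenamesOnly y x σ := fun v h1 h2 => h v h2 h1

theorem RenamesOnly.inv {x y : V} {σ : Equiv.Perm V} (h : RenamesOnly x y σ) :
    RenamesOnly x y σ⁻¹ := fun v h1 h2 => by
  rw [Equiv.Perm.inv_eq_iff_eq]; exact (h v h1 h2).symm

theorem renamesOnly_refl (x y : V) : RenamesOnly x y (Equiv.refl V) := fun _ _ _ => rfl

theorem renamesOnly_swap [DecidableEq V] (x y : V) : RenamesOnly x y (Equiv.swap x y) :=
  fun _ h1 h2 => Equiv.swap_apply_of_ne_of_ne h1 h2

theorem RenamesOnly.mem {x y : V} {σ : Equiv.Perm V} (h : RenamesOnly x y σ) {v : V}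
    (hv : v = x ∨ v = y) : σ v = x ∨ σ v = y := by
  by_contra hcon
  rw [not_or] at hcon
  have := σ.injective (h (σ v) hcon.1 hcon.2)
  rw [this] at hcon
  exact hv.elim hcon.1 hcon.2

theorem RenamesOnly.eq_refl_or_swap [DecidableEq V] {x y : V} {σ : Equiv.Perm V}
    (h : RenamesOnly x y σ) : σ = Equiv.refl V ∨ σ = Equiv.swap x y := by
  by_cases hxy : x = y
  · left
    ext v
    by_cases hv : v = x
    · subst hv hxy
      simpa using h.mem (Or.inl rfl)
    · exact h v hv (hxy ▸ hv)
  rcases h.mem (Or.inl rfl) with hx | hx <;> rcases h.mem (Or.inr rfl) with hy | hy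
  · exact absurd (σ.injective (hx.trans hy.symm)) hxy
  · left
    ext v
    by_cases h1 : v = x
    · subst h1; exact hx
    by_cases h2 : v = y
    · subst h2; exact hy
    exact h v h1 h2
  · right
    ext v
    by_cases h1 : v = x
    · subst h1; rw [hx, Equiv.swap_apply_left]
    by_cases h2 : v = y
    · subst h2; rw [hy, Equiv.swap_apply_right]
    rw [h v h1 h2, Equiv.swap_apply_of_ne_of_ne h1 h2]
  · exact absurd (σ.injective (hx.trans hy.symm)) hxy

theorem NodeTreeIncluded.symm_names {R R' : V → V → Prop} {x y : V}
    (h : NodeTreeIncluded R R' x y) : NodeTreeIncluded R R' y x :=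
  h.imp fun _ h => ⟨h.1.symm, h.2⟩

theorem BranchesIncluded.symm_names {R R' : V → V → Prop} {f g : V → ℝ} {x y : V}
    (h : BranchesIncluded R R' f g x y) : BranchesIncluded R R' f g y x :=
  h.imp fun _ h => ⟨h.1.symm, h.2⟩

theorem SaddlesChange.symm {R R' : V → V → Prop} {x y : V}
    (h : SaddlesChange R' R y x) : SaddlesChange R R' x y := by
  rcases h with ⟨h1, h2, h3, h4, h5, h6⟩ | h | h
  · exact Or.inl ⟨h2, h1, h6, h5, h4, h3⟩
  · exact Or.inr (Or.inr h)
  · exact Or.inr (Or.inl h)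

theorem edge_of_isSubgraph {T T' : ParentGraph V} {σ : Equiv.Perm V}
    (h : (T.map σ).IsSubgraph T') {u v : V} (huv : (u, v) ∈ T.edges) : (σ u, σ v) ∈ T'.edges :=
  h.2 ⟨(u, v), huv, rfl⟩

theorem IsTreeOrder.two_children [Finite V] {R : V → V → Prop} (hR : IsTreeOrder R) {v t : V}
    (hv : IsSaddle R v) (ht : IsTip R t) (hvt : R v t) :
    ∃ c₁ c₂, (c₁, v) ∈ (nodeTree R).edges ∧ (c₂, v) ∈ (nodeTree R).edges ∧ R c₁ t ∧ ¬ R c₂ t := by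
  obtain ⟨h1, h2, h3⟩ := hv
  have hne : v ≠ t := by rintro rfl; exact h2 ht
  obtain ⟨c₁, hc₁, hc₁t⟩ := hR.exists_child (not_reg_of_tip ht) h3 hvt hne
  obtain ⟨w, ⟨w1, w2⟩, w3, w4⟩ := hR.exists_minimal (fun w => R v w ∧ w ≠ v) ⟨hvt, hne.symm⟩
  have : ∃ u, R v u ∧ u ≠ v ∧ ¬ R w u := by
    by_contra! hcon
    exact h3 ⟨h1, w, w1, w2, hcon⟩
  obtain ⟨u, u1, u2, u3⟩ := this
  obtain ⟨m, hm, hum⟩ := hR.exists_tip u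
  have hwm : ¬ R w m := by
    intro hwm
    rcases hR.linear hwm hum with h | h
    · exact u3 h
    · exact u3 (w4 u ⟨u1, u2⟩ h ▸ hR.refl _)
  have hvm : v ≠ m := by rintro rfl; exact h2 hm
  obtain ⟨c₂, hc₂, hc₂m⟩ := hR.exists_child (not_reg_of_tip hm) h3 (hR.trans u1 hum) hvm
  refine ⟨c₁, c₂, hc₁, hc₂, hc₁t, fun hct => ?_⟩
  rcases hR.linear w3 hct with h | h
  · exact hwm (hR.trans h hc₂m)
  · exact hwm (w4 c₂ ⟨hc₂.2.2.1, hc₂.2.2.2.1⟩ h ▸ hc₂m)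

namespace Linked

open IsTreeOrder

variable [DecidableEq V] {R R' : V → V → Prop} {f g : V → ℝ} {x y : V}

variable (h : Linked R R' f g x y)
include h

theorem edge (hx : ¬ IsReg R x) (hy : ¬ IsReg R y) : (y, x) ∈ (nodeTree R).edges :=
  ⟨hy, hx, h.link, h.ne.symm, fun _ _ h1 h2 => (h.eq_or_eq h1 h2).symm⟩

theorem edge' (hx : ¬ IsReg R' x) (hy : ¬ IsReg R' y) : (x, y) ∈ (nodeTree R').edges :=
  h.symm.edge hy hx

theorem not_lowest_left (ha : ¬ ∀ u, R x u → u ≠ x → u ≠ y → R y u) : ¬ IsLowest R x :=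
  fun hl => ha fun _ _ hux _ => h.all_of_lowest hl hux

theorem saddle_left (ha : ¬ ∀ u, R x u → u ≠ x → u ≠ y → R y u) : IsSaddle R x :=
  ⟨h.not_lowest_left ha, h.not_tip, fun hr => ha (h.reg_left_iff.1 hr).2⟩

/-- A child of `x` besides `y`. -/
theorem exists_other_child [Finite V] (ha : ¬ ∀ u, R x u → u ≠ x → u ≠ y → R y u) :
    ∃ c, (c, x) ∈ (nodeTree R).edges ∧ c ≠ x ∧ c ≠ y ∧ ¬ R y c ∧ R' x c := by
  have hx := (h.saddle_left ha).2.2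
  push Not at ha
  obtain ⟨k, k1, k2, k3, k4⟩ := ha
  obtain ⟨m, hm, hkm⟩ := h.tree.exists_tip k
  have hym : ¬ R y m := fun hym => k4 (h.up_closed k1 k2 k3 hkm hym)
  have hxm : x ≠ m := by rintro rfl; exact h.not_tip hm
  obtain ⟨c, hc, hcm⟩ := h.tree.exists_child (not_reg_of_tip hm) hx (h.tree.trans k1 hkm) hxm
  have hyc : ¬ R y c := fun hyc => hym (h.tree.trans hyc hcm)
  have hcy : c ≠ y := by rintro rfl; exact hym hcm
  refine ⟨c, hc, hc.2.2.2.1, hcy, hyc, ?_⟩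
  rcases h.cover c hc.2.2.1 with h1 | h1 | h1 | h1
  · exact absurd h1 hc.2.2.2.1
  · exact absurd h1 hcy
  · exact absurd h1 hyc
  · exact h1

theorem not_tip_right [Finite V] (ha : ¬ ∀ u, R x u → u ≠ x → u ≠ y → R y u) : ¬ IsTip R' x := by
  obtain ⟨c, -, hcx, -, -, hc⟩ := h.exists_other_child ha
  exact fun ht => hcx (ht c hc)

theorem not_nodeTreeIncluded [Finite V] (ha : ¬ ∀ u, R x u → u ≠ x → u ≠ y → R y u)
    (hy : IsSaddle R y) : ¬ NodeTreeIncluded R R' x y := by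
  rintro ⟨σ, hσ, hsub⟩
  have hx := (h.saddle_left ha).2.2
  have e := edge_of_isSubgraph hsub (h.edge hx hy.2.2)
  obtain ⟨c, hc, hcx, hcy, hyc, hxc⟩ := h.exists_other_child ha
  have ec := edge_of_isSubgraph hsub hc
  rw [hσ c hcx hcy] at ec
  rcases hσ.eq_refl_or_swap with rfl | rfl
  · exact h.not_le' e.2.2.1
  · rw [Equiv.swap_apply_left] at ec
    rw [Equiv.swap_apply_left, Equiv.swap_apply_right] at e
    rcases ec.2.2.2.2 x e.1 h.link' hxc with h1 | h1
    · exact hcx h1.symm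
    · exact h.ne h1

theorem not_nodeTreeIncluded' [Finite V] (ha : ¬ ∀ u, R x u → u ≠ x → u ≠ y → R y u)
    (hy : IsSaddle R y) : ¬ NodeTreeIncluded R' R x y := by
  rintro ⟨σ, hσ, hsub⟩
  obtain ⟨r, hr⟩ := h.tree'.root
  have hrx : r ≠ x := by rintro rfl; exact h.not_lowest' hr
  have hry : r ≠ y := by rintro rfl; exact h.not_lowest_left ha (h.lowest_iff_low.2 hr)
  have hpar : ∀ c p, (c, p) ∈ (nodeTree R).edges → R x p → c ≠ x → c ≠ y →
      ∃ q, (c, q) ∈ (nodeTree R').edges ∧ σ q = p := by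
    intro c p hc hxp hcx hcy
    have hrc : r ≠ c := by
      rintro rfl
      have := (h.lowest_iff hrx hry).2 hr
      exact hc.2.2.2.1 (h.tree.antisymm (this p) hc.2.2.1)
    obtain ⟨q, hq, -⟩ := h.tree'.exists_parent (fun hr => hc.1 ((h.reg_iff hcx hcy).2 hr))
      (not_reg_of_bot hr) (hr c) hrc
    have := edge_of_isSubgraph hsub hq
    rw [hσ c hcx hcy] at this
    exact ⟨q, hq, h.tree.parent_unique this hc⟩
  obtain ⟨c, hc, hcx, hcy, hyc, hxc⟩ := h.exists_other_child ha
  obtain ⟨t, ht, hyt⟩ := h.tree.exists_tip y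
  obtain ⟨c₁, -, hc₁, -, -, -⟩ := h.tree.two_children hy ht hyt
  have hc₁x : c₁ ≠ x := by rintro rfl; exact h.not_le hc₁.2.2.1
  obtain ⟨q, hq, hqx⟩ := hpar c x hc (h.tree.refl x) hcx hcy
  obtain ⟨p, hp, hpy⟩ := hpar c₁ y hc₁ h.link hc₁x hc₁.2.2.2.1
  rcases hσ.eq_refl_or_swap with rfl | rfl
  · obtain rfl : q = x := hqx
    obtain rfl : p = y := hpy
    exact h.not_le (edge_of_isSubgraph hsub (h.edge' hq.2.1 hp.2.1)).2.2.1
  · rw [Equiv.swap_apply_eq_iff, Equiv.swap_apply_left] at hqx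
    rw [Equiv.swap_apply_eq_iff, Equiv.swap_apply_right] at hpy
    subst hqx hpy
    rcases hq.2.2.2.2 p hp.2.1 h.link' hxc with h1 | h1
    · exact hcx h1.symm
    · exact h.ne h1

theorem not_branchMap [Finite V] (ha : ¬ ∀ u, R x u → u ≠ x → u ≠ y → R y u)
    (hy : IsSaddle R y) {σ : Equiv.Perm V} (hσ : RenamesOnly x y σ)
    (hb : BranchMap σ R R' f g) (ho : SiblingOrder σ R R' f) : False := by
  have hxs := h.saddle_left ha
  have hinj := h.passes.inj
  obtain ⟨t₁, ht₁⟩ := h.tree.exists_highest f y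
  obtain ⟨-, c₂, -, hc₂, -, hc₂t⟩ := h.tree.two_children hy ht₁.1 ht₁.2.1
  obtain ⟨t₂, ht₂⟩ := h.tree.exists_highest f c₂
  have hst₂ := h.tree.start_of_child hc₂ ht₁ hc₂t ht₂ hinj
  obtain ⟨c, hc, hcx, hcy, hyc, hxc⟩ := h.exists_other_child ha
  obtain ⟨m, hm⟩ := h.tree.exists_highest f c
  have hct₁ : ¬ R c t₁ := fun h' => hyc (h.up_closed hc.2.2.1 hcx hcy h' ht₁.2.1)
  have hfix : ∀ {t}, IsTip R t → t ≠ x ∧ t ≠ y := fun ht =>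
    ⟨by rintro rfl; exact h.not_tip ht, by rintro rfl; exact hy.2.1 ht⟩
  have ht₁' := hfix ht₁.1
  have ht₂' := hfix ht₂.1
  have hm' := hfix hm.1
  have k1 := (hb.parent hst₂ hy.1 ht₁).2
  have k2 := hb.start hst₂
  rw [hσ t₁ ht₁'.1 ht₁'.2] at k1
  rw [hσ t₂ ht₂'.1 ht₂'.2] at k2
  rcases hσ.eq_refl_or_swap with rfl | rfl
  · rw [Equiv.refl_apply] at k1
    have hx₁ : IsHighest R f x t₁ := by
      refine ⟨ht₁.1, h.tree.trans h.link ht₁.2.1, fun u hu hxu => ?_⟩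
      have hu' := hfix hu
      exact (h.passes.le_iff_right ht₁'.1 ht₁'.2 u).2
        (k1.2.2 u ((h.tip_iff hu'.1 hu'.2).1 hu) ((h.low u).1 hxu))
    have hsm := h.tree.start_of_child hc hx₁ hct₁ hm hinj
    exact h.not_le' ((ho hsm hst₂ hxs.1 hy.1 hx₁ ht₁).1 h.link)
  · rw [Equiv.swap_apply_right] at k1 k2
    obtain ⟨M, hM⟩ := h.tree.exists_highest f x
    have hM' := hfix hM.1
    by_cases hMt : M = t₁
    · subst hMt
      have hsm := hb.start (h.tree.start_of_child hc hM hct₁ hm hinj)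
      rw [Equiv.swap_apply_left, Equiv.swap_apply_of_ne_of_ne hm'.1 hm'.2] at hsm
      have := hsm.2.2.2.2.2 x k2.2.1 h.link' h.ne.symm
        (h.tree'.trans hxc ((h.off hcx hcy m).1 hm.2.1))
      exact hct₁ (highest_unique h.passes.inj' this k1 ▸ hm.2.1)
    · have hle : f t₁ ≤ f M := hM.2.2 t₁ ht₁.1 (h.tree.trans h.link ht₁.2.1)
      have hyM : ¬ R y M := fun h' => hMt (hinj (le_antisymm (ht₁.2.2 M hM.1 h') hle))
      have hxM : R' x M := by
        rcases h.cover M hM.2.1 with h1 | h1 | h1 | h1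
        · exact absurd h1 hM'.1
        · exact absurd h1 hM'.2
        · exact absurd h1 hyM
        · exact h1
      have := k1.2.2 M ((h.tip_iff hM'.1 hM'.2).1 hM.1) hxM
      exact hMt (hinj (le_antisymm ((h.passes.le_iff_right ht₁'.1 ht₁'.2 M).2 this) hle))

theorem branchMap_reverse [Finite V] (ha : ¬ ∀ u, R x u → u ≠ x → u ≠ y → R y u)
    (hy : IsSaddle R y) {σ : Equiv.Perm V} (hσ : RenamesOnly x y σ)
    (hb : BranchMap σ R' R g f) (ho : SiblingOrder σ R' R g) :
    BranchMap σ R R' f g ∧ SiblingOrder σ R R' f := by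
  have hinv : ∀ v, σ (σ v) = v := by
    intro v
    rcases hσ.eq_refl_or_swap with rfl | rfl
    · rfl
    · exact Equiv.swap_apply_self x y v
  have hfix : ∀ {t}, IsTip R t → t ≠ x ∧ t ≠ y := fun ht =>
    ⟨by rintro rfl; exact h.not_tip ht, by rintro rfl; exact hy.2.1 ht⟩
  have hfix' : ∀ {t}, IsTip R' t → t ≠ x ∧ t ≠ y := fun ht =>
    ⟨by rintro rfl; exact h.not_tip_right ha ht, by rintro rfl; exact h.not_tip' ht⟩
  have hst : ∀ {s m}, IsStart R f s m → IsStart R' g (σ s) m := by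
    intro s m hs
    have hm := hfix hs.1
    obtain ⟨s', hs'⟩ := h.tree'.exists_start g ((h.tip_iff hm.1 hm.2).1 hs.1)
      (fun hl => hs.2.2.2.1 (h.tree.eq_of_le_bot ((h.lowest_iff hm.1 hm.2).2 hl) hs.2.2.1))
    have := hb.start hs'
    rw [hσ m hm.1 hm.2] at this
    rw [h.tree.start_unique hs this, hinv]
    exact hs'
  have hlow : ∀ {s}, ¬ IsLowest R s → ¬ IsLowest R' (σ s) := by
    intro s hs hl
    have h1 : σ s ≠ x := fun e => h.not_lowest' (e ▸ hl)
    have h2 : σ s ≠ y := fun e => h.not_lowest_left ha (h.lowest_iff_low.2 (e ▸ hl))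
    have h3 := hσ _ h1 h2
    rw [hinv] at h3
    rw [← h3] at h1 h2 hl
    exact hs ((h.lowest_iff h1 h2).2 hl)
  have hpar : ∀ {s m m'}, IsStart R f s m → ¬ IsLowest R s → IsHighest R f s m' →
      IsHighest R' g (σ s) m' := by
    intro s m m' hs hl hm'
    obtain ⟨t, ht⟩ := h.tree'.exists_highest g (σ s)
    have h1 := (hb.parent (hst hs) (hlow hl) ht).2
    have ht' := hfix' ht.1
    rw [hinv, hσ t ht'.1 ht'.2] at h1
    rw [highest_unique h.passes.inj hm' h1]
    exact ht
  refine ⟨⟨fun {s m} hs => ?_, fun {s m m'} hs hl hm' => ?_⟩, ?_⟩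
  · rw [hσ m (hfix hs.1).1 (hfix hs.1).2]
    exact hst hs
  · rw [hσ m' (hfix hm'.1).1 (hfix hm'.1).2]
    exact ⟨hlow hl, hpar hs hl hm'⟩
  · intro s₁ m₁ s₂ m₂ m' h1 h2 l1 l2 p1 p2
    have := ho (hst h1) (hst h2) (hlow l1) (hlow l2) (hpar h1 l1 p1) (hpar h2 l2 p2)
    rw [hinv, hinv] at this
    exact this.symm

theorem not_branchesIncluded [Finite V] (ha : ¬ ∀ u, R x u → u ≠ x → u ≠ y → R y u)
    (hy : IsSaddle R y) : ¬ BranchesIncluded R R' f g x y := by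
  rintro ⟨σ, hσ, hsub⟩
  obtain ⟨hb, ho⟩ := siblingOrder_of_obdtSubgraph h.tree h.tree' hsub
  exact h.not_branchMap ha hy hσ hb ho

theorem not_branchesIncluded' [Finite V] (ha : ¬ ∀ u, R x u → u ≠ x → u ≠ y → R y u)
    (hy : IsSaddle R y) : ¬ BranchesIncluded R' R g f x y := by
  rintro ⟨σ, hσ, hsub⟩
  obtain ⟨hb, ho⟩ := siblingOrder_of_obdtSubgraph h.tree' h.tree hsub
  obtain ⟨hb, ho⟩ := h.branchMap_reverse ha hy hσ hb ho
  exact h.not_branchMap ha hy hσ hb ho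

theorem saddlesChange [Finite V] (ha : ¬ ∀ u, R x u → u ≠ x → u ≠ y → R y u)
    (hy : IsSaddle R y) : SaddlesChange R R' x y := by
  have hxs := h.saddle_left ha
  have hx't := h.not_tip_right ha
  have hl := h.lowest_iff_low.not.1 hxs.1
  have he := h.edge hxs.2.2 hy.2.2
  by_cases hx' : IsReg R' x
  · by_cases hy' : IsReg R' y
    · exfalso
      have hQ := (h.reg_right_iff.1 hy').2
      obtain ⟨-, w, h2, h3, h4⟩ := hx'
      obtain ⟨t, ht, hyt⟩ := h.tree.exists_tip y
      have hty : t ≠ y := by rintro rfl; exact hy.2.1 ht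
      have htx : t ≠ x := by rintro rfl; exact h.not_le hyt
      have hwy : w ≠ y := by rintro rfl; exact h.not_le' h2
      have hxw := (h.low w).2 (h.tree'.trans h.link' h2)
      have hwt := (h.off h3 hwy t).2 (h4 t (hQ t (h.tree.trans h.link hyt) htx hty) htx)
      have hyw := h.up_closed hxw h3 hwy hwt hyt
      exact ha fun u h1 hux huy =>
        h.tree.trans hyw ((h.off h3 hwy u).2 (h4 u (hQ u h1 hux huy) hux))
    · exact Or.inr (Or.inr ⟨Or.inr ⟨hx', hl, h.not_tip', hy'⟩, he, hy, hxs⟩)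
  · by_cases hy' : IsReg R' y
    · exact Or.inr (Or.inr ⟨Or.inl ⟨hy', h.not_lowest', hx't, hx'⟩, he, hy, hxs⟩)
    · exact Or.inl ⟨he, h.edge' hx' hy', hxs, hy, ⟨h.not_lowest', hx't, hx'⟩,
        hl, h.not_tip', hy'⟩

end Linked

end Horizontal

/-! ### A new leaf -/

section NewLeaf

variable {V : Type*}

namespace IsTreeOrder

/-- Regular elements on a branch also have the tip of the branch as their highest leaf. -/
theorem highest_of_start [Finite V] {R : V → V → Prop} (hR : IsTreeOrder R) {f : V → ℝ}
    {s m v : V} (h : IsStart R f s m) (hsv : R s v) (hne : s ≠ v) (hvm : R v m) :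
    IsHighest R f v m := by
  obtain ⟨z, ⟨h1, h2, h3⟩, -, h4⟩ := hR.exists_minimal (fun z => ¬ IsReg R z ∧ R v z ∧ R z m)
    ⟨not_reg_of_tip h.1, hvm, hR.refl m⟩
  have hsz : s ≠ z := by
    rintro rfl
    exact hne (hR.antisymm hsv h2)
  have hz := h.2.2.2.2.2 z h1 (hR.trans hsv h2) hsz h3
  refine ⟨h.1, hvm, fun m' hm' hvm' => ?_⟩
  by_cases hzm : R z m'
  · exact hz.2.2 m' hm' hzm
  · exfalso
    have hmz : ¬ R m' z := by
      intro hmz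
      exact hzm (hm' z hmz ▸ hR.refl _)
    obtain ⟨z', k1, k2, k3, -, k5, -⟩ := hR.exists_branching h2 hvm' hzm hmz
    exact k5 (h4 z' ⟨k1, k2, hR.trans k3 h3⟩ k3)

end IsTreeOrder

open IsTreeOrder

namespace Linked

variable [DecidableEq V] {R R' : V → V → Prop} {f g : V → ℝ} {x y : V}

variable (h : Linked R R' f g x y) (ht : IsTip R' x) (hk : ∃ k, R x k ∧ k ≠ x ∧ k ≠ y)
include h ht

theorem le_of_tip {u : V} (hxu : R x u) (hux : u ≠ x) : R y u := by
  rcases h.cover u hxu with h1 | h1 | h1 | h1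
  · exact absurd h1 hux
  · exact h1 ▸ h.tree.refl y
  · exact h1
  · exact absurd (ht u h1) hux

theorem le_iff_of_tip {u v : V} (hu : u ≠ x) (hv : v ≠ x) : R v u ↔ R' v u := by
  by_cases hvy : v = y
  · subst hvy
    rw [← h.low]
    exact ⟨fun h' => h.tree.trans h.link h', fun h' => h.le_of_tip ht h' hu⟩
  · exact h.off hv hvy u

include hk

theorem not_lowest_of_tip : ¬ IsLowest R x := by
  intro hl
  obtain ⟨k, -, k2, k3⟩ := hk
  exact k2 (ht k (h.all_of_lowest' hl k3))

theorem reg_of_tip : IsReg R x :=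
  h.reg_left_iff.2 ⟨h.not_lowest_of_tip ht hk, fun _ h1 h2 _ => h.le_of_tip ht h1 h2⟩

theorem saddle_of_tip : IsSaddle R' y := by
  refine ⟨h.lowest_iff_low.not.1 (h.not_lowest_of_tip ht hk), h.not_tip', fun hr => ?_⟩
  obtain ⟨k, k1, k2, k3⟩ := hk
  exact k2 (ht k ((h.reg_right_iff.1 hr).2 k k1 k2 k3))

theorem not_tip_of_tip : ¬ IsTip R y := by
  obtain ⟨k, k1, k2, k3⟩ := hk
  exact fun h' => k3 (h' k (h.le_of_tip ht k1 k2))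

theorem tip_iff_of_tip {m : V} (hm : m ≠ x) : IsTip R m ↔ IsTip R' m := by
  by_cases hmy : m = y
  · subst hmy
    exact iff_of_false (h.not_tip_of_tip ht hk) h.not_tip'
  · exact h.tip_iff hm hmy

theorem ne_of_tip {m : V} (hm : IsTip R m) : m ≠ x ∧ m ≠ y :=
  ⟨by rintro rfl; exact h.not_tip hm, by rintro rfl; exact h.not_tip_of_tip ht hk hm⟩

theorem lowest_iff_of_tip {v : V} (hv : v ≠ x) : IsLowest R v ↔ IsLowest R' v := by
  by_cases hvy : v = y
  · subst hvy
    exact iff_of_false h.not_lowest (h.saddle_of_tip ht hk).1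
  · exact h.lowest_iff hv hvy

theorem not_reg_of_not_reg {v : V} (hv : ¬ IsReg R v) : ¬ IsReg R' v := by
  have hvx : v ≠ x := by rintro rfl; exact hv (h.reg_of_tip ht hk)
  by_cases hvy : v = y
  · subst hvy
    exact (h.saddle_of_tip ht hk).2.2
  · rwa [← h.reg_iff hvx hvy]

theorem highest_iff_of_tip [Finite V] {v m : V} (hv : v ≠ x) (hm : m ≠ x) :
    IsHighest R f v m ↔ IsHighest R' g v m := by
  constructor
  · rintro ⟨h1, h2, h3⟩
    have hm' := h.ne_of_tip ht hk h1
    refine ⟨(h.tip_iff_of_tip ht hk hm).1 h1, (h.le_iff_of_tip ht hm hv).1 h2,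
      fun u hu hvu => ?_⟩
    by_cases hux : u = x
    · subst hux
      have hvy : R' v y := by
        by_cases hvy : v = y
        · exact hvy ▸ h.tree'.refl y
        · exact (h.symm.le_iff hvy hv).2 hvu
      have hvy := (h.le_iff_of_tip ht h.ne.symm hv).2 hvy
      obtain ⟨t, htip, hyt⟩ := h.tree.exists_tip y
      have htne := h.ne_of_tip ht hk htip
      have h4 := (h.passes.le_iff_left htne.1 htne.2 m).1 (h3 t htip (h.tree.trans hvy hyt))
      refine le_trans ?_ h4
      by_contra hlt
      have := h.le_of' ((h.le_iff_of_tip ht htne.1 h.ne.symm).1 hyt)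
      rcases h.passes.symm.between t this (_root_.not_le.1 hlt).le with h5 | h5
      · exact htne.2 h5
      · exact htne.1 h5
    · exact (h.passes.le_iff_right hm'.1 hm'.2 u).1
        (h3 u ((h.tip_iff_of_tip ht hk hux).2 hu) ((h.le_iff_of_tip ht hux hv).2 hvu))
  · rintro ⟨h1, h2, h3⟩
    have h1' := (h.tip_iff_of_tip ht hk hm).2 h1
    have hm' := h.ne_of_tip ht hk h1'
    refine ⟨h1', (h.le_iff_of_tip ht hm hv).2 h2, fun u hu hvu => ?_⟩
    have hu' := h.ne_of_tip ht hk hu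
    exact (h.passes.le_iff_right hm'.1 hm'.2 u).2
      (h3 u ((h.tip_iff_of_tip ht hk hu'.1).1 hu) ((h.le_iff_of_tip ht hu'.1 hv).1 hvu))

theorem start_of_start [Finite V] {s m : V} (hs : IsStart R f s m) : IsStart R' g s m := by
  have hsx : s ≠ x := by rintro rfl; exact hs.2.1 (h.reg_of_tip ht hk)
  have hm := h.ne_of_tip ht hk hs.1
  refine ⟨(h.tip_iff_of_tip ht hk hm.1).1 hs.1, h.not_reg_of_not_reg ht hk hs.2.1,
    (h.le_iff_of_tip ht hm.1 hsx).1 hs.2.2.1, hs.2.2.2.1, ?_, fun v hv h1 h2 h3 => ?_⟩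
  · rw [← h.lowest_iff_of_tip ht hk hsx, ← h.highest_iff_of_tip ht hk hsx hm.1]
    exact hs.2.2.2.2.1
  · have hvx : v ≠ x := by
      rintro rfl
      exact hm.1 (ht m h3)
    rw [← h.highest_iff_of_tip ht hk hvx hm.1]
    exact h.tree.highest_of_start hs ((h.le_iff_of_tip ht hvx hsx).2 h1) h2
      ((h.le_iff_of_tip ht hm.1 hvx).2 h3)

theorem branchesIncluded_of_tip [Finite V] : BranchesIncluded R R' f g x y := by
  have hne : ∀ {s m}, IsStart R f s m → s ≠ x := fun hs => by
    rintro rfl; exact hs.2.1 (h.reg_of_tip ht hk)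
  refine ⟨Equiv.refl V, renamesOnly_refl x y, obdtSubgraph_of_branchMap h.tree h.tree'
    ⟨h.start_of_start ht hk, fun {s m m'} hs hl hm' => ?_⟩ ?_⟩
  · have hm := h.ne_of_tip ht hk hm'.1
    exact ⟨fun h' => hl ((h.lowest_iff_of_tip ht hk (hne hs)).2 h'),
      (h.highest_iff_of_tip ht hk (hne hs) hm.1).1 hm'⟩
  · intro s₁ m₁ s₂ m₂ m' h1 h2 _ _ _ _
    exact h.le_iff_of_tip ht (hne h2) (hne h1)

theorem ncard_branches_of_tip [Finite V] :
    (branchDecompositionTree (nodeTree R') g).verts.ncard =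
      (branchDecompositionTree (nodeTree R) f).verts.ncard + 1 := by
  rw [h.tree.ncard_branches, h.tree'.ncard_branches]
  have : {m | IsTip R' m ∧ ¬ IsLowest R' m} = insert x {m | IsTip R m ∧ ¬ IsLowest R m} := by
    ext m
    rw [Set.mem_insert_iff]
    by_cases hm : m = x
    · subst hm
      exact iff_of_true ⟨ht, h.not_lowest'⟩ (Or.inl rfl)
    · simp only [hm, false_or]
      exact and_congr (h.tip_iff_of_tip ht hk hm).symm
        (not_congr (h.lowest_iff_of_tip ht hk hm).symm)
  rw [this, Set.ncard_insert_of_notMem _ (Set.toFinite _)]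
  exact fun h' => h.not_tip h'.1

section Saddle

variable (hy : ¬ IsReg R y)
include hy

theorem reg_iff_of_tip {v : V} (hv : v ≠ x) : IsReg R v ↔ IsReg R' v := by
  by_cases hvy : v = y
  · subst hvy
    exact iff_of_false hy (h.saddle_of_tip ht hk).2.2
  · exact h.reg_iff hv hvy

theorem ncard_verts_of_tip [Finite V] :
    (nodeTree R').verts.ncard = (nodeTree R).verts.ncard + 1 := by
  have : (nodeTree R').verts = insert x (nodeTree R).verts := by
    ext m
    rw [Set.mem_insert_iff]
    by_cases hm : m = x
    · subst hm
      exact iff_of_true (not_reg_of_tip ht) (Or.inl rfl)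
    · simp only [hm, false_or]
      exact not_congr (h.reg_iff_of_tip ht hk hy hm).symm
  rw [this, Set.ncard_insert_of_notMem _ (Set.toFinite _)]
  exact fun h' => h' (h.reg_of_tip ht hk)

theorem nodeTreeIncluded_of_tip : NodeTreeIncluded R R' x y := by
  refine ⟨Equiv.refl V, renamesOnly_refl x y, ?_, ?_⟩
  · rintro _ ⟨v, hv, rfl⟩
    exact h.not_reg_of_not_reg ht hk hv
  · rintro _ ⟨⟨c, p⟩, ⟨h1, h2, h3, h4, h5⟩, rfl⟩
    dsimp only at h1 h2 h3 h4 h5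
    have hcx : c ≠ x := by rintro rfl; exact h1 (h.reg_of_tip ht hk)
    have hpx : p ≠ x := by rintro rfl; exact h2 (h.reg_of_tip ht hk)
    refine ⟨h.not_reg_of_not_reg ht hk h1, h.not_reg_of_not_reg ht hk h2,
      (h.le_iff_of_tip ht hcx hpx).1 h3, h4, fun w hw hpw hwc => ?_⟩
    have hwx : w ≠ x := by
      rintro rfl
      exact hcx (ht c hwc)
    exact h5 w (fun hr => hw ((h.reg_iff_of_tip ht hk hy hwx).1 hr))
      ((h.le_iff_of_tip ht hwx hpx).2 hpw) ((h.le_iff_of_tip ht hcx hwx).2 hwc)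

end Saddle

section Split

variable (hy : IsReg R y)
include hy

theorem node_ne {v : V} (hv : ¬ IsReg R v) : v ≠ x ∧ v ≠ y :=
  ⟨by rintro rfl; exact hv (h.reg_of_tip ht hk), by rintro rfl; exact hv hy⟩

theorem verts_of_split : (nodeTree R').verts = (nodeTree R).verts ∪ {x, y} := by
  ext v
  change ¬ _ ↔ (¬ _ ∨ (v = x ∨ v = y))
  by_cases hx : v = x
  · subst hx
    exact iff_of_true (not_reg_of_tip ht) (Or.inr (Or.inl rfl))
  by_cases hvy : v = y
  · subst hvy
    exact iff_of_true (h.saddle_of_tip ht hk).2.2 (Or.inr (Or.inr rfl))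
  rw [h.reg_iff hx hvy]
  simp [hx, hvy]

theorem not_nodeTreeIncluded_of_verts (hσ : NodeTreeIncluded R' R x y) : False := by
  obtain ⟨σ, hσ, hsub⟩ := hσ
  have h1 : ¬ IsReg R (σ x) := hsub.1 ⟨x, not_reg_of_tip ht, rfl⟩
  have h2 := h.node_ne ht hk hy h1
  exact (hσ.mem (Or.inl rfl)).elim h2.1 h2.2

/-- The edge of the first tree in which `x` and `y` are inserted. -/
theorem exists_split_edge [Finite V] :
    ∃ c p, (c, p) ∈ (nodeTree R).edges ∧ R y c ∧ R p x ∧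
      (∀ u, ¬ IsReg R u → R y u → R c u) ∧ ∀ u, ¬ IsReg R u → R u y → R u p := by
  have hxr := h.reg_of_tip ht hk
  obtain ⟨m, hm, hym⟩ := h.tree.exists_tip y
  obtain ⟨c, ⟨c1, c2, c3⟩, -, c4⟩ := h.tree.exists_minimal
    (fun c => ¬ IsReg R c ∧ R y c ∧ R c m) ⟨not_reg_of_tip hm, hym, h.tree.refl m⟩
  obtain ⟨r, hr⟩ := h.tree.root
  obtain ⟨p, ⟨p1, p2⟩, -, p3⟩ := h.tree.exists_maximal (fun p => ¬ IsReg R p ∧ R p x)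
    ⟨not_reg_of_bot hr, hr x⟩
  have hc' : ∀ u, ¬ IsReg R u → R y u → R c u := by
    intro u hu hyu
    by_contra hcu
    by_cases huc : R u c
    · exact hcu (c4 u ⟨hu, hyu, h.tree.trans huc c3⟩ huc ▸ h.tree.refl _)
    · obtain ⟨z, z1, z2, z3, -, z5, -⟩ := h.tree.exists_branching c2 hyu hcu huc
      exact z5 (c4 z ⟨z1, z2, h.tree.trans z3 c3⟩ z3)
  have hp' : ∀ u, ¬ IsReg R u → R u y → R u p := by
    intro u hu huy
    have hune := h.node_ne ht hk hy hu
    have hux := (h.le_iff hune.1 hune.2).2 huy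
    rcases h.tree.linear hux p2 with h1 | h1
    · exact h1
    · exact p3 u ⟨hu, hux⟩ h1 ▸ h.tree.refl _
  refine ⟨c, p, ⟨c1, p1, h.tree.trans (h.tree.trans p2 h.link) c2, ?_, ?_⟩, c2, p2, hc', hp'⟩
  · intro (e : c = p)
    exact h.not_le (h.tree.trans c2 (e ▸ p2))
  · intro w hw hpw hwc
    rcases h.tree.linear hwc c2 with h1 | h1
    · exact Or.inr (h.tree.antisymm (hp' w hw h1) hpw)
    · exact Or.inl (h.tree.antisymm hwc (hc' w hw h1))

variable {c p : V} (hcp : (c, p) ∈ (nodeTree R).edges) (hyc : R y c) (hpx : R p x)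
  (hc : ∀ u, ¬ IsReg R u → R y u → R c u) (hp : ∀ u, ¬ IsReg R u → R u y → R u p)
include hcp hyc hpx hc hp

theorem edges_of_split : (nodeTree R').edges =
    ((nodeTree R).edges \ {(c, p)}) ∪ {(x, y), (c, y), (y, p)} := by
  have hc1 : c ≠ x ∧ c ≠ y := h.node_ne ht hk hy hcp.1
  have hp1 : p ≠ x ∧ p ≠ y := h.node_ne ht hk hy hcp.2.1
  have hc' : ¬ IsReg R' c := h.not_reg_of_not_reg ht hk hcp.1
  have hp' : ¬ IsReg R' p := h.not_reg_of_not_reg ht hk hcp.2.1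
  have hx' := not_reg_of_tip ht
  have hy' := (h.saddle_of_tip ht hk).2.2
  have hyc' : R' y c := (h.le_iff_of_tip ht hc1.1 h.ne.symm).1 hyc
  have hpy' : R' p y := (h.off hp1.1 hp1.2 y).1 (h.tree.trans hpx h.link)
  have hback : ∀ {v}, v ≠ x → v ≠ y → ¬ IsReg R' v → ¬ IsReg R v := fun h1 h2 hv => by
    rwa [h.reg_iff h1 h2]
  have hlowp : ∀ {v}, v ≠ x → v ≠ y → ¬ IsReg R' v → R' v y → R' v p := fun h1 h2 hv hvy =>
    (h.off h1 h2 p).1 (hp _ (hback h1 h2 hv) ((h.off h1 h2 y).2 hvy))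
  have hupc : ∀ {v}, v ≠ x → v ≠ y → ¬ IsReg R' v → R' y v → R' c v := fun h1 h2 hv hvy =>
    (h.off hc1.1 hc1.2 _).1 (hc _ (hback h1 h2 hv) ((h.le_iff_of_tip ht h1 h.ne.symm).2 hvy))
  ext ⟨u, v⟩
  simp only [Set.mem_union, Set.mem_sdiff, Set.mem_singleton_iff, Set.mem_insert_iff,
    Prod.mk.injEq]
  constructor
  · rintro ⟨h1, h2, h3, h4, h5⟩
    dsimp only at h1 h2 h3 h4 h5
    by_cases hvx : v = x
    · subst hvx
      exact absurd (ht u h3) h4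
    by_cases hux : u = x
    · subst hux
      right; left
      refine ⟨rfl, ?_⟩
      by_cases hvy : v = y
      · exact hvy
      have hvy' := (h.symm.le_iff hvy hvx).2 h3
      exact ((h5 y hy' hvy' h.link').resolve_left h.ne.symm).symm
    by_cases huy : u = y
    · subst huy
      right; right; right
      refine ⟨rfl, ?_⟩
      have hvp := hlowp hvx h4.symm h2 h3
      exact ((h5 p hp' hvp hpy').resolve_left hp1.2).symm
    by_cases hvy : v = y
    · subst hvy
      right; right; left
      refine ⟨?_, rfl⟩
      exact ((h5 c hc' hyc' (hupc hux huy h1 h3)).resolve_right hc1.2).symm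
    left
    refine ⟨⟨hback hux huy h1, hback hvx hvy h2, (h.off hvx hvy u).2 h3, h4,
      fun w hw hvw hwu => ?_⟩, ?_⟩
    · have hw1 := h.node_ne ht hk hy hw
      exact h5 w (h.not_reg_of_not_reg ht hk hw) ((h.off hvx hvy w).1 hvw)
        ((h.off hw1.1 hw1.2 u).1 hwu)
    · rintro ⟨rfl, rfl⟩
      rcases h5 y hy' hpy' hyc' with h6 | h6
      · exact huy h6.symm
      · exact hvy h6.symm
  · rintro (⟨⟨h1, h2, h3, h4, h5⟩, hne⟩ | ⟨rfl, rfl⟩ | ⟨rfl, rfl⟩ | ⟨rfl, rfl⟩)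
    · dsimp only at h1 h2 h3 h4 h5
      have hu1 := h.node_ne ht hk hy h1
      have hv1 := h.node_ne ht hk hy h2
      refine ⟨h.not_reg_of_not_reg ht hk h1, h.not_reg_of_not_reg ht hk h2,
        (h.off hv1.1 hv1.2 u).1 h3, h4, fun w hw hvw hwu => ?_⟩
      dsimp only at hvw hwu ⊢
      have hwx : w ≠ x := by rintro rfl; exact hu1.1 (ht u hwu)
      by_cases hwy : w = y
      · exfalso
        subst hwy
        have hcu := hc u h1 ((h.le_iff_of_tip ht hu1.1 h.ne.symm).2 hwu)
        have hvp := hp v h2 ((h.off hv1.1 hv1.2 w).2 hvw)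
        have hpu := h.tree.trans hcp.2.2.1 hcu
        have hvc := h.tree.trans hvp hcp.2.2.1
        rcases h5 c hcp.1 hvc hcu with e | e
        · rcases h5 p hcp.2.1 hvp hpu with e' | e'
          · exact hcp.2.2.2.1 (e.trans e'.symm)
          · exact hne ⟨e.symm, e'.symm⟩
        · subst e
          exact hcp.2.2.2.1 (h.tree.antisymm hvp hcp.2.2.1)
      · exact h5 w (hback hwx hwy hw) ((h.off hv1.1 hv1.2 w).2 hvw) ((h.off hwx hwy u).2 hwu)
    · exact h.edge' hx' hy'
    · refine ⟨hc', hy', hyc', hc1.2, fun w hw hyw hwc => ?_⟩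
      dsimp only at hyw hwc ⊢
      by_cases hwy : w = v
      · exact Or.inr hwy
      have hwx : w ≠ x := by rintro rfl; exact hc1.1 (ht u hwc)
      exact Or.inl (h.tree'.antisymm hwc (hupc hwx hwy hw hyw))
    · refine ⟨hy', hp', hpy', hp1.2.symm, fun w hw hpw hwy => ?_⟩
      dsimp only at hpw hwy ⊢
      by_cases hwy' : w = u
      · exact Or.inl hwy'
      have hwx : w ≠ x := by rintro rfl; exact h.not_le' hwy
      exact Or.inr (h.tree'.antisymm (hlowp hwx hwy' hw hwy) hpw)

theorem downPath_subdivide {s m : V} {b : List V} (hb : (nodeTree R).DownPath s m b) :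
    (nodeTree R').DownPath s m (subdivide p c y b) := by
  have hE := h.edges_of_split ht hk hy hcp hyc hpx hc hp
  induction hb with
  | nil a => rw [subdivide]; exact .nil a
  | @cons a c' m l he hl ih =>
    obtain ⟨t, rfl⟩ := hl.eq_cons
    rw [subdivide]
    split_ifs with hif
    · obtain ⟨rfl, rfl⟩ := hif
      refine .cons (c := y) ?_ (.cons ?_ ih)
      · rw [hE]; simp
      · rw [hE]; simp
    · refine .cons ?_ ih
      rw [hE]
      refine Or.inl ⟨he, fun e => hif ?_⟩
      simp only [Set.mem_singleton_iff, Prod.mk.injEq] at e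
      exact ⟨e.2, e.1⟩

theorem branches_of_split [Finite V] : (branchDecompositionTree (nodeTree R') g).verts =
    subdivide p c y '' (branchDecompositionTree (nodeTree R) f).verts ∪ {[y, x]} := by
  have hE := h.edges_of_split ht hk hy hcp hyc hpx hc hp
  have hys := h.saddle_of_tip ht hk
  have hc1 : c ≠ x ∧ c ≠ y := h.node_ne ht hk hy hcp.1
  have hstart : IsStart R' g y x := by
    refine ⟨ht, hys.2.2, h.link', h.ne.symm, Or.inr ?_, fun v hv hyv hne hvx => ?_⟩
    · intro hh
      obtain ⟨t, htip, hct⟩ := h.tree.exists_tip c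
      have htne := h.ne_of_tip ht hk htip
      have hyt := (h.le_iff_of_tip ht htne.1 h.ne.symm).1 (h.tree.trans hyc hct)
      rcases h.passes.symm.between t (h.le_of' hyt)
        (hh.2.2 t ((h.tip_iff htne.1 htne.2).1 htip) hyt) with h5 | h5
      · exact htne.2 h5
      · exact htne.1 h5
    · rcases h.symm.eq_or_eq hyv hvx with h1 | h1
      · exact absurd h1.symm hne
      · rw [h1]; exact highest_self ht h.tree'
  have hpath : (nodeTree R').DownPath y x [y, x] :=
    .cons (h.edge' (not_reg_of_tip ht) hys.2.2) (.nil x)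
  ext b
  constructor
  · intro hb
    obtain ⟨s, m, hs, hb⟩ := h.tree'.mem_branchDecomposition.1 hb
    by_cases hmx : m = x
    · subst hmx
      obtain rfl := h.tree'.start_unique hs hstart
      exact Or.inr (h.tree'.downPath_unique hb hpath)
    · have hm := (h.tip_iff_of_tip ht hk hmx).2 hs.1
      obtain ⟨s', hs'⟩ := h.tree.exists_start f hm (fun hl => hs.2.2.2.1
        (h.tree'.eq_of_le_bot ((h.lowest_iff_of_tip ht hk hmx).1 hl) hs.2.2.1))
      obtain rfl := h.tree'.start_unique hs (h.start_of_start ht hk hs')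
      obtain ⟨b', hb', hb''⟩ := h.tree.exists_branch hs'
      exact Or.inl ⟨b', hb'', h.tree'.downPath_unique
        (h.downPath_subdivide ht hk hy hcp hyc hpx hc hp hb') hb⟩
  · rintro (⟨b, hb, rfl⟩ | hb)
    · obtain ⟨s, m, hs, hb⟩ := h.tree.mem_branchDecomposition.1 hb
      exact h.tree'.mem_branchDecomposition.2 ⟨s, m, h.start_of_start ht hk hs,
        h.downPath_subdivide ht hk hy hcp hyc hpx hc hp hb⟩
    · rw [Set.mem_singleton_iff] at hb
      subst hb
      exact h.tree'.mem_branchDecomposition.2 ⟨y, x, hstart, hpath⟩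

theorem not_nodeTreeIncluded_of_split (hσ : NodeTreeIncluded R R' x y) : False := by
  obtain ⟨σ, hσ, hsub⟩ := hσ
  have hc1 : c ≠ x ∧ c ≠ y := h.node_ne ht hk hy hcp.1
  have hp1 : p ≠ x ∧ p ≠ y := h.node_ne ht hk hy hcp.2.1
  have := edge_of_isSubgraph hsub hcp
  rw [hσ c hc1.1 hc1.2, hσ p hp1.1 hp1.2,
    h.edges_of_split ht hk hy hcp hyc hpx hc hp] at this
  simp [hc1.1, hc1.2, hp1.2] at this

theorem not_bdtSubgraph_of_split [Finite V] {σ : Equiv.Perm V} (hσ : RenamesOnly x y σ)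
    (hb : BDTSubgraph σ (branchDecompositionTree (nodeTree R') g)
      (branchDecompositionTree (nodeTree R) f)) : False := by
  have hmap := branchMap_of_bdtSubgraph h.tree' h.tree hb
  have h1 : [y, x] ∈ (nodeTree R').branchDecomposition g := by
    change _ ∈ (branchDecompositionTree (nodeTree R') g).verts
    rw [h.branches_of_split ht hk hy hcp hyc hpx hc hp]
    exact Or.inr rfl
  obtain ⟨hs, -⟩ := h.tree'.branch_ends h1 (s := y) (m := x) rfl rfl
  have h2 := h.node_ne ht hk hy (hmap.start hs).2.1
  exact (hσ.mem (Or.inr rfl)).elim h2.1 h2.2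

end Split

end Linked

end NewLeaf

/-! ### Two maxima exchanging their positions -/

section Meeting

variable {V : Type*}

open IsTreeOrder

theorem nodeMap_refl (R : V → V → Prop) : NodeMap (Equiv.refl V) R R :=
  ⟨fun _ => .rfl, fun _ _ _ _ => .rfl⟩

variable [DecidableEq V]

theorem nodeIso_refl_of_not_tip [Finite V] {R : V → V → Prop} {f g : V → ℝ} {x y : V}
    (hR : IsTreeOrder R) (h : Passes f g x y) (ht : ¬ (IsTip R x ∧ IsTip R y)) :
    NodeIso (Equiv.refl V) R R f g := by
  refine (nodeMap_refl R).nodeIso hR hR fun m m' hm hm' => h.le_iff_of_ne ?_ ?_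
  · by_contra! hcon
    exact ht ⟨hcon.1 ▸ hm', hcon.2 ▸ hm⟩
  · by_contra! hcon
    exact ht ⟨hcon.2 ▸ hm, hcon.1 ▸ hm'⟩

theorem Passes.highest_transfer {R : V → V → Prop} {f g : V → ℝ} {x y : V}
    (h : Passes f g x y) {v : V} (hx : IsTip R x) (hvx : R v x) (hv : IsHighest R f v y) :
    IsHighest R g v x := by
  refine ⟨hx, hvx, fun m hm hvm => ?_⟩
  by_cases hmx : m = x
  · rw [hmx]
  by_cases hmy : m = y
  · rw [hmy]; exact h.lt'.le
  · rw [← h.le_iff_left hmx hmy]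
    by_contra hlt
    rcases h.between m (not_le.1 hlt).le (hv.2.2 m hm hvm) with h1 | h1
    · exact hmx h1
    · exact hmy h1

theorem nodeIso_refl_of_not_highest {R : V → V → Prop} {f g : V → ℝ} {x y : V}
    (h : Passes f g x y) (ht : IsTip R y)
    (hno : ∀ v, R v x → R v y → ¬ IsHighest R f v y) :
    NodeIso (Equiv.refl V) R R f g := by
  refine ⟨nodeMap_refl R, fun v m _ => ?_⟩
  simp only [Equiv.refl_apply]
  constructor
  · rintro ⟨h1, h2, h3⟩
    refine ⟨h1, h2, fun m' hm' hvm' => (h.le_iff_of_ne ?_ ?_).1 (h3 m' hm' hvm')⟩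
    · by_contra! hcon
      obtain ⟨rfl, rfl⟩ := hcon
      exact hno v hvm' h2 ⟨h1, h2, h3⟩
    · by_contra! hcon
      obtain ⟨rfl, rfl⟩ := hcon
      exact (not_le.2 h.lt) (h3 m' hm' hvm')
  · rintro ⟨h1, h2, h3⟩
    refine ⟨h1, h2, fun m' hm' hvm' => (h.le_iff_of_ne ?_ ?_).2 (h3 m' hm' hvm')⟩
    · by_contra! hcon
      obtain ⟨rfl, rfl⟩ := hcon
      exact (not_le.2 h.lt') (h3 m' hm' hvm')
    · by_contra! hcon
      obtain ⟨rfl, rfl⟩ := hcon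
      exact hno v h2 hvm' (h.symm.highest_transfer ht hvm' ⟨h1, h2, h3⟩)

/-- The branches of the maxima `x` and `y` meet at `s`, and `y` continues there for `f`, whereas
`x` continues for `g`. -/
structure Meeting (R : V → V → Prop) (f g : V → ℝ) (x y s : V) : Prop where
  passes : Passes f g x y
  tree : IsTreeOrder R
  tip : IsTip R x
  tip' : IsTip R y
  node : ¬ IsReg R s
  not_lowest : ¬ IsLowest R s
  le : R s x
  le' : R s y
  ne : s ≠ x
  ne' : s ≠ y
  meet : ∀ u, R u x → R u y → R u s
  highest : IsHighest R f s y
  highest' : IsHighest R g s x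

theorem exists_meeting [Finite V] {R : V → V → Prop} {f g : V → ℝ} {x y : V}
    (h : Passes f g x y) (hR : IsTreeOrder R)
    (hs : ∀ r, IsLowest R r → ∃ w, w ≠ r ∧ ∀ u, u ≠ r → R w u)
    (hx : IsTip R x) (hy : IsTip R y) {v : V} (hvx : R v x) (hv : IsHighest R f v y) :
    ∃ s, Meeting R f g x y s := by
  obtain ⟨s, h1, h2, h3, h4, h5, h6, h7⟩ := hR.exists_branching hvx hv.2.1
    (fun h' => h.ne (hx y h').symm) (fun h' => h.ne (hy x h'))
  have hh := hR.highest_mono hv h2 h4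
  refine ⟨s, h, hR, hx, hy, h1, fun hl => ?_, h3, h4, h5, h6, h7, hh,
    h.highest_transfer hx h3 hh⟩
  obtain ⟨w, hw, hw'⟩ := hs s hl
  exact hw (hR.eq_of_le_bot hl (h7 w (hw' x h5.symm) (hw' y h6.symm)))

namespace Meeting

variable {R : V → V → Prop} {f g : V → ℝ} {x y s : V}

theorem symm (h : Meeting R f g x y s) : Meeting R g f y x s :=
  ⟨h.passes.symm, h.tree, h.tip', h.tip, h.node, h.not_lowest, h.le', h.le, h.ne', h.ne,
    fun u h1 h2 => h.meet u h2 h1, h.highest', h.highest⟩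

variable (h : Meeting R f g x y s)
include h

theorem start : IsStart R f s x := by
  refine ⟨h.tip, h.node, h.le, h.ne,
    Or.inr fun hh => h.passes.ne (highest_unique h.passes.inj hh h.highest),
    fun v _ hsv hne hvx => ⟨h.tip, hvx, fun m hm hvm => ?_⟩⟩
  have hmy : m ≠ y := by
    rintro rfl
    exact hne (h.tree.antisymm hsv (h.meet v hvx hvm))
  by_contra hlt
  rcases h.passes.between m (not_le.1 hlt).le
    (h.highest.2.2 m hm (h.tree.trans hsv hvm)) with h1 | h1
  · exact hlt (h1 ▸ le_refl _)
  · exact hmy h1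

theorem exists_branches [Finite V] :
    ∃ bx b_y, (nodeTree R).IsBranchAt f x bx ∧ (nodeTree R).IsBranchAt f y b_y ∧
      IsParentBranch b_y bx := by
  obtain ⟨bx, hbx, hbx'⟩ := h.tree.exists_branch h.start
  obtain ⟨s', b_y, hs', hby, hedge, -⟩ :=
    h.tree.exists_parentBranch h.start hbx h.not_lowest h.highest
  refine ⟨bx, b_y, ⟨hbx', ?_⟩, ⟨hedge.2.1, ?_⟩, hedge.2.2⟩
  · rw [h.tree.mem_tail_downPath hbx (not_reg_of_tip h.tip)]
    exact ⟨not_reg_of_tip h.tip, h.le, h.tree.refl x, h.ne⟩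
  · rw [h.tree.mem_tail_downPath hby (not_reg_of_tip h.tip')]
    exact ⟨not_reg_of_tip h.tip', hs'.2.2.1, h.tree.refl y, hs'.2.2.2.1⟩

/-- If the branch decomposition trees are nested up to renaming, there is no node between `s` and
the two maxima. -/
theorem nodeIso_of_branchMap [Finite V] {σ : Equiv.Perm V} (hσ : RenamesOnly x y σ)
    (hb : BranchMap σ R R f g) : NodeIso (Equiv.swap x y) R R f g := by
  have hinj := h.passes.inj
  rcases hσ.eq_refl_or_swap with rfl | rfl
  · exact absurd h.highest' (not_highest_of_start (hb.start h.start) h.not_lowest)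
  have key : ∀ t, t = x ∨ t = y → IsTip R t →
      (∀ v, ¬ IsReg R v → R s v → s ≠ v → R v t → IsHighest R f v t) →
      ∀ v, ¬ IsReg R v → R s v → s ≠ v → R v t → v = t := by
    intro t ht htip hhigh v hv hsv hne hvt
    by_contra hvne
    have hhv := hhigh v hv hsv hne hvt
    have hvl : ¬ IsLowest R v := fun hl => hne (h.tree.eq_of_le_bot hl hsv)
    have hvtip : ¬ IsTip R v := fun hl => hvne (hl t hvt).symm
    obtain ⟨-, c, -, hc, -, hct⟩ := h.tree.two_children ⟨hvl, hvtip, hv⟩ htip hvt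
    obtain ⟨m, hm⟩ := h.tree.exists_highest f c
    have hst := h.tree.start_of_child hc hhv hct hm hinj
    have hpar := (hb.parent hst hvl hhv).2
    have hvx : v ≠ x := by rintro rfl; exact hvtip h.tip
    have hvy : v ≠ y := by rintro rfl; exact hvtip h.tip'
    rw [Equiv.swap_apply_of_ne_of_ne hvx hvy] at hpar
    have : R v x ∧ R v y := by
      rcases ht with rfl | rfl
      · rw [Equiv.swap_apply_left] at hpar
        exact ⟨hvt, hpar.2.1⟩
      · rw [Equiv.swap_apply_right] at hpar
        exact ⟨hpar.2.1, hvt⟩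
    exact hne (h.tree.antisymm hsv (h.meet v this.1 this.2))
  have keyx := key x (Or.inl rfl) h.tip h.start.2.2.2.2.2
  have keyy := key y (Or.inr rfl) h.tip' (fun v _ hsv _ hvt => h.tree.highest_mono h.highest hsv hvt)
  have hle : ∀ u, ¬ IsReg R u → u ≠ x → u ≠ y → (R u x ↔ R u y) := by
    intro u hu hux huy
    constructor
    · intro h1
      rcases h.tree.linear h1 h.le with h2 | h2
      · exact h.tree.trans h2 h.le'
      · by_cases hsu : s = u
        · exact hsu ▸ h.le'
        · exact absurd (keyx u hu h2 hsu h1) hux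
    · intro h1
      rcases h.tree.linear h1 h.le' with h2 | h2
      · exact h.tree.trans h2 h.le
      · by_cases hsu : s = u
        · exact hsu ▸ h.le
        · exact absurd (keyy u hu h2 hsu h1) huy
  have htip : ∀ {t}, IsTip R t → ∀ v, R t v ↔ v = t := fun ht v =>
    ⟨ht v, fun e => e ▸ h.tree.refl _⟩
  refine NodeMap.nodeIso h.tree h.tree ⟨fun v => ?_, fun u v hu hv => ?_⟩
    fun m m' _ _ => h.passes.le_iff m' m
  · by_cases hvx : v = x
    · subst hvx
      rw [Equiv.swap_apply_left]
      exact iff_of_false (not_reg_of_tip h.tip) (not_reg_of_tip h.tip')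
    by_cases hvy : v = y
    · subst hvy
      rw [Equiv.swap_apply_right]
      exact iff_of_false (not_reg_of_tip h.tip') (not_reg_of_tip h.tip)
    rw [Equiv.swap_apply_of_ne_of_ne hvx hvy]
  · by_cases hux : u = x
    · subst hux
      rw [Equiv.swap_apply_left, htip h.tip, htip h.tip', Equiv.swap_apply_eq_iff,
        Equiv.swap_apply_right]
    by_cases huy : u = y
    · subst huy
      rw [Equiv.swap_apply_right, htip h.tip, htip h.tip', Equiv.swap_apply_eq_iff,
        Equiv.swap_apply_left]
    rw [Equiv.swap_apply_of_ne_of_ne hux huy]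
    by_cases hvx : v = x
    · subst hvx
      rw [Equiv.swap_apply_left]
      exact hle u hu hux huy
    by_cases hvy : v = y
    · subst hvy
      rw [Equiv.swap_apply_right]
      exact (hle u hu hux huy).symm
    rw [Equiv.swap_apply_of_ne_of_ne hvx hvy]

end Meeting

end Meeting

/-! ### The vertex graph of a triangulated manifold -/

section Topology

theorem isPreconnected_ball_diff_center {E : Type*} [NormedAddCommGroup E] [InnerProductSpace ℝ E]
    (hE : 1 < Module.rank ℝ E) (c : E) {r : ℝ} (hr : 0 < r) :
    IsPreconnected (Metric.ball c r \ {c}) := by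
  have key : ∀ e : OpenPartialHomeomorph E E, e.source = Set.univ →
      e '' {(0 : E)}ᶜ = e.target \ {e 0} := by
    intro e hs
    ext p
    constructor
    · rintro ⟨q, hq, rfl⟩
      exact ⟨e.map_source (hs ▸ Set.mem_univ q),
        fun hp => hq (e.injOn (hs ▸ Set.mem_univ q) (hs ▸ Set.mem_univ 0) hp)⟩
    · rintro ⟨hp, hpc⟩
      refine ⟨e.symm p, fun h => hpc ?_, e.right_inv hp⟩
      rw [Set.mem_singleton_iff] at h
      rw [Set.mem_singleton_iff, ← h, e.right_inv hp]
  have h := key _ (OpenPartialHomeomorph.univBall_source c r)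
  rw [OpenPartialHomeomorph.univBall_target c hr, OpenPartialHomeomorph.univBall_apply_zero] at h
  rw [← h]
  exact (isConnected_compl_singleton_of_one_lt_rank hE 0).isPreconnected.image _
    (OpenPartialHomeomorph.continuous_univBall c r).continuousOn

/-- A connected manifold of dimension at least two stays connected when a point is removed. -/
theorem isPreconnected_compl_singleton_of_chartedSpace {H M : Type*} [NormedAddCommGroup H]
    [InnerProductSpace ℝ H] (hH : 1 < Module.rank ℝ H) [TopologicalSpace M] [T1Space M]
    [PreconnectedSpace M] [ChartedSpace H M] (p : M) : IsPreconnected ({p}ᶜ : Set M) := by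
  let φ := chartAt H p
  have hp : p ∈ φ.source := mem_chart_source H p
  obtain ⟨r, hr, hball⟩ := Metric.isOpen_iff.1 φ.open_target (φ p) (φ.map_source hp)
  have hP : IsPreconnected (φ.symm '' (Metric.ball (φ p) r \ {φ p})) :=
    (isPreconnected_ball_diff_center hH (φ p) hr).image _
      (φ.continuousOn_symm.mono (Set.sdiff_subset.trans hball))
  have hW : IsOpen (φ.symm '' Metric.ball (φ p) r) :=
    φ.symm.isOpen_image_of_subset_source Metric.isOpen_ball hball
  have hpW : p ∈ φ.symm '' Metric.ball (φ p) r :=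
    ⟨φ p, Metric.mem_ball_self hr, φ.left_inv hp⟩
  have hPsub : φ.symm '' (Metric.ball (φ p) r \ {φ p}) ⊆ {p}ᶜ := by
    rintro _ ⟨q, ⟨hq, hqp⟩, rfl⟩ h
    rw [Set.mem_singleton_iff] at h
    apply hqp
    rw [Set.mem_singleton_iff, ← h, φ.right_inv (hball hq)]
  have hWsub : φ.symm '' Metric.ball (φ p) r ⊆
      φ.symm '' (Metric.ball (φ p) r \ {φ p}) ∪ {p} := by
    rintro _ ⟨q, hq, rfl⟩
    by_cases hqp : q = φ p
    · right; rw [hqp]; exact φ.left_inv hp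
    · left; exact ⟨q, ⟨hq, hqp⟩, rfl⟩
  have key : ∀ A B : Set M, IsOpen A → IsOpen B → A ⊆ {p}ᶜ → B ⊆ {p}ᶜ → Disjoint A B →
      {p}ᶜ ⊆ A ∪ B → B.Nonempty → φ.symm '' (Metric.ball (φ p) r \ {φ p}) ⊆ A → False := by
    intro A B hA hB hAp hBp hAB hcov hBne hPA
    have hcompl : Bᶜ = A ∪ φ.symm '' Metric.ball (φ p) r := by
      ext q
      constructor
      · intro hq
        by_cases hqp : q = p
        · exact Or.inr (hqp ▸ hpW)
        · exact Or.inl ((hcov hqp).resolve_right hq)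
      · rintro (hq | hq) hqB
        · exact Set.disjoint_left.1 hAB hq hqB
        · rcases hWsub hq with h | h
          · exact Set.disjoint_left.1 hAB (hPA h) hqB
          · exact hBp hqB h
    have hclopen : IsClopen B := ⟨isOpen_compl_iff.1 (hcompl ▸ hA.union hW), hB⟩
    rcases isClopen_iff.1 hclopen with h | h
    · exact hBne.ne_empty h
    · exact hBp (h ▸ Set.mem_univ p) rfl
  intro O₁ O₂ h₁ h₂ hcov hn₁ hn₂
  by_contra hcon
  rw [Set.not_nonempty_iff_eq_empty] at hcon
  have hpo : IsOpen ({p}ᶜ : Set M) := isOpen_compl_singleton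
  have hdisj : Disjoint ({p}ᶜ ∩ O₁) ({p}ᶜ ∩ O₂) := by
    rw [Set.disjoint_left]
    intro q hq hq'
    have : q ∈ ({p}ᶜ ∩ (O₁ ∩ O₂) : Set M) := ⟨hq.1, hq.2, hq'.2⟩
    rw [hcon] at this
    exact this
  have hcov' : ({p}ᶜ : Set M) ⊆ ({p}ᶜ ∩ O₁) ∪ ({p}ᶜ ∩ O₂) := fun q hq =>
    (hcov hq).imp (fun h => ⟨hq, h⟩) (fun h => ⟨hq, h⟩)
  rcases hP.subset_or_subset (hpo.inter h₁) (hpo.inter h₂) hdisj (hPsub.trans hcov') with h | h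
  · exact key _ _ (hpo.inter h₁) (hpo.inter h₂) Set.inter_subset_left Set.inter_subset_left hdisj
      hcov' hn₂ h
  · exact key _ _ (hpo.inter h₂) (hpo.inter h₁) Set.inter_subset_left Set.inter_subset_left
      hdisj.symm (Set.union_comm _ _ ▸ hcov') hn₁ h

namespace Geometry.SimplicialComplex

variable {E : Type*} [NormedAddCommGroup E] [NormedSpace ℝ E] (K : SimplicialComplex ℝ E)

theorem vertex_mem_of_mem_convexHull {v : E} (hv : v ∈ K.vertices) {t : Finset E}
    (ht : t ∈ K.faces) (h : v ∈ convexHull ℝ (t : Set E)) : v ∈ t := by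
  have h1 := K.inter_subset_convexHull (s := {v}) hv ht ⟨by simp, h⟩
  by_contra hvt
  have : ((({v} : Finset E) : Set E) ∩ (t : Set E)) = ∅ := by
    ext q
    simp only [Finset.coe_singleton, Set.mem_inter_iff, Set.mem_singleton_iff, Finset.mem_coe,
      Set.mem_empty_iff_false, iff_false, not_and]
    rintro rfl
    exact hvt
  rw [this, convexHull_empty] at h1
  exact h1

theorem mem_vertices_of_mem {t : Finset E} (ht : t ∈ K.faces) {v : E} (hv : v ∈ t) :
    v ∈ K.vertices :=
  K.down_closed ht (by simpa using hv) (by simp)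

/-- The open star of a vertex, together with the complement of the underlying space. -/
def star (u : E) : Set E := (⋃ t ∈ {t ∈ K.faces | u ∉ t}, convexHull ℝ (t : Set E))ᶜ

theorem isOpen_star (hfin : K.faces.Finite) (u : E) : IsOpen (K.star u) := by
  refine isOpen_compl_iff.2 ((hfin.subset (Set.sep_subset _ _)).isClosed_biUnion fun t _ => ?_)
  exact (Set.Finite.isCompact_convexHull ℝ t.finite_toSet).isClosed

theorem mem_of_mem_star {u p : E} (hp : p ∈ K.star u) {t : Finset E} (ht : t ∈ K.faces)
    (hpt : p ∈ convexHull ℝ (t : Set E)) : u ∈ t := by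
  by_contra hut
  exact hp (Set.mem_biUnion (x := t) ⟨ht, hut⟩ hpt)

/-- Every point of the space has a face all of whose vertices have the point in their star. -/
theorem exists_carrier {p : E} (hp : p ∈ K.space) :
    ∃ s ∈ K.faces, p ∈ convexHull ℝ (s : Set E) ∧ ∀ u ∈ s, p ∈ K.star u := by
  classical
  obtain ⟨t, ht, hpt⟩ := mem_space_iff.1 hp
  have hex : ∃ n, ∃ s ∈ K.faces, p ∈ convexHull ℝ (s : Set E) ∧ s.card = n := ⟨_, t, ht, hpt, rfl⟩
  obtain ⟨s, hs, hps, hcard⟩ := Nat.find_spec hex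
  refine ⟨s, hs, hps, fun u hu hmem => ?_⟩
  simp only [Set.mem_iUnion] at hmem
  obtain ⟨t, ⟨ht, hut⟩, hpt⟩ := hmem
  have h1 := K.inter_subset_convexHull hs ht ⟨hps, hpt⟩
  rw [← Finset.coe_inter] at h1
  have hne : (s ∩ t).Nonempty := by
    rw [← Finset.coe_nonempty, ← convexHull_nonempty_iff (𝕜 := ℝ)]
    exact ⟨p, h1⟩
  have hlt : (s ∩ t).card < s.card :=
    Finset.card_lt_card ⟨Finset.inter_subset_left, fun hsub =>
      hut (Finset.mem_of_mem_inter_right (hsub hu))⟩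
  exact Nat.find_min hex (hcard ▸ hlt)
    ⟨s ∩ t, K.down_closed hs Finset.inter_subset_left hne, h1, rfl⟩

theorem finite_vertices (hfin : K.faces.Finite) : Finite K.vertices := by
  refine Set.Finite.to_subtype (Set.Finite.of_finite_image (f := fun v : E => ({v} : Finset E))
    (hfin.subset ?_) (fun a _ b _ h => by simpa using h))
  rintro _ ⟨v, hv, rfl⟩
  exact hv

theorem reachIn_of_isPreconnected (hfin : K.faces.Finite) {A : Set E} (hA : IsPreconnected A)
    (hAK : A ⊆ K.space) (S : Set K.vertices) (hSA : ∀ u ∈ S, (u : E) ∈ A)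
    (hcov : ∀ p ∈ A, ∃ u ∈ S, p ∈ K.star u) {a b : K.vertices} (ha : a ∈ S) (hb : b ∈ S) :
    ReachIn (vertexGraph K) S a b := by
  by_contra hab
  have hself : ∀ u : K.vertices, (u : E) ∈ K.star u := by
    intro u hmem
    simp only [Set.mem_iUnion] at hmem
    obtain ⟨t, ⟨ht, hut⟩, hpt⟩ := hmem
    exact hut (K.vertex_mem_of_mem_convexHull u.2 ht hpt)
  obtain ⟨p, hpA, hp₁, hp₂⟩ := hA
    (⋃ u ∈ {u : K.vertices | u ∈ S ∧ ReachIn (vertexGraph K) S a u}, K.star u)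
    (⋃ u ∈ {u : K.vertices | u ∈ S ∧ ¬ ReachIn (vertexGraph K) S a u}, K.star u)
    (isOpen_biUnion fun u _ => K.isOpen_star hfin u)
    (isOpen_biUnion fun u _ => K.isOpen_star hfin u)
    (fun p hp => by
      obtain ⟨u, hu, hpu⟩ := hcov p hp
      by_cases hr : ReachIn (vertexGraph K) S a u
      · exact Or.inl (Set.mem_biUnion (x := u) ⟨hu, hr⟩ hpu)
      · exact Or.inr (Set.mem_biUnion (x := u) ⟨hu, hr⟩ hpu))
    ⟨a, hSA a ha, Set.mem_biUnion (x := a) ⟨ha, Relation.ReflTransGen.refl⟩ (hself a)⟩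
    ⟨b, hSA b hb, Set.mem_biUnion (x := b) ⟨hb, hab⟩ (hself b)⟩
  simp only [Set.mem_iUnion] at hp₁ hp₂
  obtain ⟨u, ⟨hu, hru⟩, hpu⟩ := hp₁
  obtain ⟨w, ⟨hw, hrw⟩, hpw⟩ := hp₂
  obtain ⟨t, ht, hpt⟩ := mem_space_iff.1 (hAK hpA)
  have hut := K.mem_of_mem_star hpu ht hpt
  have hwt := K.mem_of_mem_star hpw ht hpt
  classical
  refine hrw (Relation.ReflTransGen.tail hru ⟨⟨?_, {(u : E), (w : E)}, ?_, by simp⟩, hw⟩)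
  · rintro rfl
    exact hrw hru
  · refine K.down_closed ht ?_ (by simp)
    intro q hq
    simp only [Finset.mem_insert, Finset.mem_singleton] at hq
    rcases hq with rfl | rfl
    · exact hut
    · exact hwt

theorem reachIn_univ (hfin : K.faces.Finite) (hconn : IsConnected K.space) (a b : K.vertices) :
    ReachIn (vertexGraph K) Set.univ a b := by
  refine K.reachIn_of_isPreconnected hfin hconn.isPreconnected le_rfl Set.univ
    (fun u _ => K.subset_space (s := {(u : E)}) u.2 (by simp)) (fun p hp => ?_) trivial trivial
  obtain ⟨s, hs, -, hstar⟩ := K.exists_carrier hp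
  obtain ⟨u, hu⟩ := K.nonempty_of_mem_faces hs
  exact ⟨⟨u, K.mem_vertices_of_mem hs hu⟩, trivial, hstar u hu⟩

/-- The vertex graph of a triangulated manifold of dimension at least two stays connected when a
vertex is removed. -/
theorem reachIn_compl_singleton (hfin : K.faces.Finite) (hconn : IsConnected K.space)
    {H : Type*} [NormedAddCommGroup H] [InnerProductSpace ℝ H] (hH : 1 < Module.rank ℝ H)
    [ChartedSpace H K.space] (v a b : K.vertices) (ha : a ≠ v) (hb : b ≠ v) :
    ReachIn (vertexGraph K) {v}ᶜ a b := by
  have hmem : ∀ u : K.vertices, (u : E) ∈ K.space := fun u =>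
    K.subset_space (s := {(u : E)}) u.2 (by simp)
  have : PreconnectedSpace K.space := isPreconnected_iff_preconnectedSpace.1 hconn.isPreconnected
  have hA : IsPreconnected (K.space \ {(v : E)}) := by
    have h := isPreconnected_compl_singleton_of_chartedSpace hH (⟨v, hmem v⟩ : K.space)
    have himg : (Subtype.val '' ({⟨v, hmem v⟩}ᶜ : Set K.space)) = K.space \ {(v : E)} := by
      ext q
      constructor
      · rintro ⟨q, hq, rfl⟩
        exact ⟨q.2, fun h => hq (Subtype.ext h)⟩
      · rintro ⟨hq, hqv⟩
        exact ⟨⟨q, hq⟩, fun h => hqv (congrArg Subtype.val h), rfl⟩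
    rw [← himg]
    exact h.image _ continuous_subtype_val.continuousOn
  refine K.reachIn_of_isPreconnected hfin hA Set.sdiff_subset {v}ᶜ
    (fun u hu => ⟨hmem u, fun h => hu (Subtype.ext h)⟩) (fun p hp => ?_) ha hb
  obtain ⟨s, hs, hps, hstar⟩ := K.exists_carrier hp.1
  have : ∃ u ∈ s, u ≠ (v : E) := by
    by_contra! hcon
    have hsub : (s : Set E) ⊆ {(v : E)} := fun u hu => hcon u hu
    have := convexHull_mono (𝕜 := ℝ) hsub hps
    rw [convexHull_singleton] at this
    exact hp.2 this
  obtain ⟨u, hu, huv⟩ := this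
  exact ⟨⟨u, K.mem_vertices_of_mem hs hu⟩, fun h => huv (congrArg Subtype.val h), hstar u hu⟩

end Geometry.SimplicialComplex

end Topology

/-! ### Classification of the changes -/

section Classification

variable {V : Type*}

open IsTreeOrder

theorem vertexRank_le_iff [Finite V] (f : V → ℝ) {u v : V} :
    vertexRank f u ≤ vertexRank f v ↔ f u ≤ f v := by
  constructor
  · intro h
    by_contra hlt
    refine absurd (Set.ncard_lt_ncard (s := {w | f w ≤ f v}) (t := {w | f w ≤ f u}) ?_
      (Set.toFinite _)) (not_lt.2 h)
    exact ⟨fun w (hw : f w ≤ f v) => hw.trans (not_le.1 hlt).le,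
      fun hsub => hlt (hsub (le_refl (f u)))⟩
  · intro h
    exact Set.ncard_le_ncard (fun w (hw : f w ≤ f u) => hw.trans h) (Set.toFinite _)

theorem SwapsPosition.passes [Finite V] [DecidableEq V] {f g : V → ℝ} {x y : V}
    (hf : Function.Injective f) (hg : Function.Injective g) (hoff : ∀ u, u ≠ x → f u = g u)
    (h : SwapsPosition f g x y) (hrise : f x < g x) : Passes f g x y := by
  obtain ⟨h1, h2, h3, h4, h5⟩ := h
  have hrank : ∀ u, vertexRank g (Equiv.swap x y u) = vertexRank f u := by
    intro u
    by_cases hx : u = x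
    · subst hx; rw [Equiv.swap_apply_left, h3]
    by_cases hy : u = y
    · subst hy; rw [Equiv.swap_apply_right, h4]
    · rw [Equiv.swap_apply_of_ne_of_ne hx hy, h5 u hy hx]
  have hle : ∀ u v, f u ≤ f v ↔ g (Equiv.swap x y u) ≤ g (Equiv.swap x y v) := by
    intro u v
    rw [← vertexRank_le_iff, ← vertexRank_le_iff, hrank, hrank]
  have hlt : f x < f y := by
    by_contra hlt
    have h6 := (hle y x).1 (not_lt.1 hlt)
    rw [Equiv.swap_apply_left, Equiv.swap_apply_right, ← hoff y h1] at h6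
    linarith [not_lt.1 hlt]
  refine ⟨hf, hg, h1.symm, hle, hlt, fun w hxw hwy => ?_⟩
  have hr1 := (vertexRank_le_iff f).2 hxw
  have hr2 := (vertexRank_le_iff f).2 hwy
  have hr3 := (vertexRank_le_iff f).2 hlt.le
  have hr4 : vertexRank f y ≤ vertexRank f x + 1 := by
    rw [abs_eq one_pos.le] at h2
    omega
  rcases eq_or_lt_of_le hr1 with h6 | h6
  · exact Or.inl (hf (le_antisymm ((vertexRank_le_iff f).1 h6.ge) hxw))
  · exact Or.inr (hf (le_antisymm hwy ((vertexRank_le_iff f).1 (by omega))))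

section Graph

variable [DecidableEq V] {G : SimpleGraph V} {f g : V → ℝ} {x y : V}

theorem Passes.superlevel_eq (h : Passes f g x y) : {w | f x ≤ f w} = {w | g y ≤ g w} := by
  ext w
  change f x ≤ f w ↔ g y ≤ g w
  by_cases hx : w = x
  · subst hx; exact iff_of_true le_rfl h.lt'.le
  by_cases hy : w = y
  · subst hy; exact iff_of_true h.lt.le le_rfl
  rw [h.le_iff, Equiv.swap_apply_left, Equiv.swap_apply_of_ne_of_ne hx hy]

theorem Passes.mergeLE_iff (h : Passes f g x y) {v : V} (hx : v ≠ x) (hy : v ≠ y) (u : V) :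
    MergeLE G f v u ↔ MergeLE G g v u := by
  have : {w | f v ≤ f w} = {w | g v ≤ g w} := Set.ext fun w => h.le_iff_left hx hy w
  unfold MergeLE
  rw [this]

theorem Passes.mergeLE_link (h : Passes f g x y) (hl : MergeLE G f x y) (u : V) :
    MergeLE G f x u ↔ MergeLE G g y u := by
  unfold MergeLE at *
  rw [← h.superlevel_eq]
  exact ⟨fun h' => ReachIn.trans (hl.symm (le_refl (f x))) h', fun h' => ReachIn.trans hl h'⟩

theorem Passes.mergeLE_cover (h : Passes f g x y) (u : V) (hu : MergeLE G f x u) :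
    u = x ∨ u = y ∨ MergeLE G f y u ∨ MergeLE G g x u := by
  induction hu with
  | refl => exact Or.inl rfl
  | @tail v w hv hw ih =>
    by_cases hwx : w = x
    · exact Or.inl hwx
    by_cases hwy : w = y
    · exact Or.inr (Or.inl hwy)
    have hw2 : f x ≤ f w := hw.2
    have hfw : f y ≤ f w := by
      by_contra hlt
      rcases h.between w hw2 (not_le.1 hlt).le with e | e
      · exact hwx e
      · exact hwy e
    have hgw : g x ≤ g w := by
      rw [h.le_iff, Equiv.swap_apply_right, Equiv.swap_apply_of_ne_of_ne hwx hwy] at hfw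
      exact hfw
    right; right
    rcases ih with rfl | rfl | ih | ih
    · exact Or.inr (Relation.ReflTransGen.single ⟨hw.1, hgw⟩)
    · exact Or.inl (Relation.ReflTransGen.single ⟨hw.1, hfw⟩)
    · exact Or.inl (Relation.ReflTransGen.tail ih ⟨hw.1, hfw⟩)
    · exact Or.inr (Relation.ReflTransGen.tail ih ⟨hw.1, hgw⟩)

theorem Passes.mergeLE_iff_of_not_link (h : Passes f g x y) (hl : ¬ MergeLE G f x y) (u : V) :
    MergeLE G f x u ↔ MergeLE G g x u := by
  have hw : ∀ w, w ≠ y → (f x ≤ f w ↔ g x ≤ g w) := fun w hw =>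
    h.le_iff_of_ne (Or.inr hw) (Or.inl h.ne)
  constructor
  · intro hu
    induction hu with
    | refl => exact Relation.ReflTransGen.refl
    | @tail v w hv hvw ih =>
      have hwy : w ≠ y := by
        rintro rfl
        exact hl (Relation.ReflTransGen.tail hv hvw)
      exact Relation.ReflTransGen.tail ih ⟨hvw.1, (hw w hwy).1 hvw.2⟩
  · refine ReachIn.mono fun w (hgw : g x ≤ g w) => (hw w ?_).2 hgw
    rintro rfl
    exact not_lt.2 hgw h.lt'

theorem Passes.mergeLE_eq_of_not_link (h : Passes f g x y) (hl : ¬ MergeLE G f x y) :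
    MergeLE G f = MergeLE G g := by
  funext v u
  apply propext
  by_cases hx : v = x
  · subst hx; exact h.mergeLE_iff_of_not_link hl u
  by_cases hy : v = y
  · subst hy
    refine (h.symm.mergeLE_iff_of_not_link (fun hl' => hl ?_) u).symm
    unfold MergeLE at *
    rw [← h.superlevel_eq] at hl'
    exact hl'.symm h.lt.le
  · exact h.mergeLE_iff hx hy u

omit [DecidableEq V] in
theorem exists_single_child [Finite V] (hcut : ∀ v a b, a ≠ v → b ≠ v → ReachIn G {v}ᶜ a b)
    (hxy : x ≠ y) (r : V) :
    ∃ w, w ≠ r ∧ ∀ u, u ≠ r → MergeLE G f w u := by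
  have hne : ∃ z, z ≠ r := by
    by_cases hx : x = r
    · exact ⟨y, fun hy => hxy (hx.trans hy.symm)⟩
    · exact ⟨x, hx⟩
  obtain ⟨w, hw, hmin⟩ := Set.exists_min_image {z | z ≠ r} f (Set.toFinite _) hne
  exact ⟨w, hw, fun u hu => ReachIn.mono (fun z (hz : z ≠ r) => hmin z hz) (hcut r w u hw hu)⟩

theorem Passes.linked [Finite V] (h : Passes f g x y) (hG : ∀ a b, ReachIn G Set.univ a b)
    (hcut : ∀ v a b, a ≠ v → b ≠ v → ReachIn G {v}ᶜ a b) (hl : MergeLE G f x y) :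
    Linked (MergeLE G f) (MergeLE G g) f g x y :=
  have : Nonempty V := ⟨x⟩
  { passes := h
    tree := isTreeOrder_mergeLE hG h.inj
    tree' := isTreeOrder_mergeLE hG h.inj'
    le_of := MergeLE.le
    le_of' := MergeLE.le
    off := h.mergeLE_iff
    low := h.mergeLE_link hl
    link := hl
    cover := h.mergeLE_cover
    single := fun r _ => exists_single_child hcut h.ne r
    single' := fun r _ => exists_single_child hcut h.ne r }

end Graph

namespace Linked

variable [DecidableEq V] {R R' : V → V → Prop} {f g : V → ℝ} {x y : V}

theorem cases [Finite V] (h : Linked R R' f g x y) :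
    (∃ σ, RenamesOnly x y σ ∧ NodeIso σ R R' f g) ∨
    ((¬ ∀ u, R x u → u ≠ x → u ≠ y → R y u) ∧ IsSaddle R y) ∨
    ((¬ ∀ u, R' y u → u ≠ y → u ≠ x → R' x u) ∧ IsSaddle R' x) ∨
    (IsTip R' x ∧ ∃ k, R x k ∧ k ≠ x ∧ k ≠ y) ∨
    (IsTip R y ∧ ∃ k, R' y k ∧ k ≠ y ∧ k ≠ x) := by
  have hQ' : (∀ u, R' y u → u ≠ y → u ≠ x → R' x u) ↔ ∀ u, R x u → u ≠ x → u ≠ y → R' x u :=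
    forall_congr' fun u => by
      rw [h.low u]
      exact ⟨fun a b c d => a b d c, fun a b c d => a b d c⟩
  by_cases hP : ∀ u, R x u → u ≠ x → u ≠ y → R y u
  · by_cases hQ : ∀ u, R x u → u ≠ x → u ≠ y → R' x u
    · exact Or.inl ⟨_, renamesOnly_swap x y, h.nodeIso_of_all hP hQ⟩
    by_cases hx : IsTip R' x
    · push Not at hQ
      obtain ⟨k, h1, h2, h3, -⟩ := hQ
      exact Or.inr (Or.inr (Or.inr (Or.inl ⟨hx, k, h1, h2, h3⟩)))
    by_cases hxr : IsReg R' x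
    · refine Or.inl ⟨_, (renamesOnly_refl x y).inv, (h.symm.nodeIso_refl hxr (hQ'.not.2 hQ) ?_).symm⟩
      exact fun u h1 h2 h3 => hP u ((h.low u).2 h1) h3 h2
    · exact Or.inr (Or.inr (Or.inl ⟨hQ'.not.2 hQ, h.not_lowest', hx, hxr⟩))
  · by_cases hy : IsTip R y
    · push Not at hP
      obtain ⟨k, h1, h2, h3, -⟩ := hP
      exact Or.inr (Or.inr (Or.inr (Or.inr ⟨hy, k, (h.low k).1 h1, h3, h2⟩)))
    by_cases hyr : IsReg R y
    · by_cases hQ : ∀ u, R x u → u ≠ x → u ≠ y → R' x u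
      · exact Or.inl ⟨_, renamesOnly_refl x y, h.nodeIso_refl hyr hP hQ⟩
      by_cases hx : IsTip R' x
      · push Not at hQ
        obtain ⟨k, h1, h2, h3, -⟩ := hQ
        exact Or.inr (Or.inr (Or.inr (Or.inl ⟨hx, k, h1, h2, h3⟩)))
      by_cases hxr : IsReg R' x
      · exact Or.inl ⟨_, renamesOnly_swap x y, h.nodeIso_swap hyr hxr hP hQ⟩
      · exact Or.inr (Or.inr (Or.inl ⟨hQ'.not.2 hQ, h.not_lowest', hx, hxr⟩))
    · exact Or.inr (Or.inl ⟨hP, h.not_lowest, hy, hyr⟩)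

end Linked

/-! ### From tree orders to merge trees -/

section Translation

variable {G : SimpleGraph V} {f g : V → ℝ} {x y : V}

theorem treeIncluded_iff [Finite V] (hR : IsTreeOrder (MergeLE G f))
    (hR' : IsTreeOrder (MergeLE G g)) :
    TreeIncluded G x y f g ↔ NodeTreeIncluded (MergeLE G f) (MergeLE G g) x y := by
  unfold TreeIncluded NodeTreeIncluded
  rw [hR.mergeTree_eq, hR'.mergeTree_eq]

theorem obdtIncluded_iff [Finite V] (hR : IsTreeOrder (MergeLE G f))
    (hR' : IsTreeOrder (MergeLE G g)) :
    OBDTIncluded G x y f g ↔ BranchesIncluded (MergeLE G f) (MergeLE G g) f g x y := by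
  unfold OBDTIncluded BranchesIncluded bdt
  rw [hR.mergeTree_eq, hR'.mergeTree_eq]

theorem saddleSplits_iff [Finite V] (hR : IsTreeOrder (MergeLE G f))
    (hR' : IsTreeOrder (MergeLE G g)) :
    SaddleSplits G x y f g ↔ SaddleSplitting (MergeLE G f) (MergeLE G g) x y := by
  unfold SaddleSplits SaddleSplitting
  rw [hR.mergeTree_eq, hR'.mergeTree_eq, hR.isSaddleVertex_iff, hR.isSaddleVertex_iff,
    hR'.isSaddleVertex_iff, hR'.isSaddleVertex_iff]
  change ((¬ ¬ _ ∧ _) ∨ (¬ ¬ _ ∧ _)) ∧ _ ↔ _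
  rw [not_not, not_not]
  rfl

theorem bdtSubgraph_of_obdtSubgraph {σ : Equiv.Perm V} {D D' : ParentGraph (List V)}
    (h : OBDTSubgraph σ D D') : BDTSubgraph σ D D' :=
  h.imp fun _ h => h.1

theorem equalUpToRenaming_of_nodeIso [Finite V] (hR : IsTreeOrder (MergeLE G f))
    (hR' : IsTreeOrder (MergeLE G g)) {σ : Equiv.Perm V} (hσ : RenamesOnly x y σ)
    (h : NodeIso σ (MergeLE G f) (MergeLE G g) f g) : EqualUpToRenaming G x y f g := by
  refine ⟨σ, hσ, ?_, ?_, ?_⟩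
  · rw [hR.mergeTree_eq, hR'.mergeTree_eq]; exact h.map_eq
  · unfold bdt
    rw [hR.mergeTree_eq, hR'.mergeTree_eq]
    exact bdtSubgraph_of_obdtSubgraph (h.obdtSubgraph hR hR')
  · unfold bdt
    rw [hR.mergeTree_eq, hR'.mergeTree_eq]
    exact bdtSubgraph_of_obdtSubgraph (h.symm.obdtSubgraph hR' hR)

theorem nodeTreeIncluded_of_nodeIso {R R' : V → V → Prop} {σ : Equiv.Perm V}
    (hσ : RenamesOnly x y σ) (h : NodeIso σ R R' f g) : NodeTreeIncluded R R' x y :=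
  ⟨σ, hσ, h.map_eq ▸ ⟨Set.Subset.rfl, Set.Subset.rfl⟩⟩

theorem nodeTreeIncluded_refl (R : V → V → Prop) (x y : V) : NodeTreeIncluded R R x y :=
  ⟨Equiv.refl V, renamesOnly_refl x y, by simp [ParentGraph.map, ParentGraph.IsSubgraph]⟩

end Translation

variable [DecidableEq V] {G : SimpleGraph V} {f g : V → ℝ} {x y : V}

/-- The only edge whose length changes when a maximum moves is the one below it. -/
theorem existsUnique_edge_length {R : V → V → Prop} [Finite V] (hR : IsTreeOrder R)
    (hle : ∀ {u v}, R u v → f u ≤ f v) (hoff : ∀ u, u ≠ x → f u = g u) (hrise : f x < g x)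
    (hx : IsTip R x) (hl : ¬ IsLowest R x) :
    ∃! e, e ∈ (nodeTree R).edges ∧ |f e.1 - f e.2| ≠ |g e.1 - g e.2| := by
  obtain ⟨r, hr⟩ := hR.root
  obtain ⟨p, hp, -⟩ := hR.exists_parent (not_reg_of_tip hx) (not_reg_of_bot hr) (hr x)
    (by rintro rfl; exact hl hr)
  have hpx : p ≠ x := fun e => hp.2.2.2.1 e.symm
  refine ⟨(x, p), ⟨hp, ?_⟩, ?_⟩
  · have h1 : f p ≤ f x := hle hp.2.2.1
    have h2 := hoff p hpx
    dsimp only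
    rw [abs_of_nonneg (by linarith), abs_of_nonneg (by linarith)]
    intro h3
    linarith
  · rintro ⟨u, v⟩ ⟨huv, hne⟩
    have hvx : v ≠ x := by
      rintro rfl
      exact huv.2.2.2.1 (hx u huv.2.2.1)
    by_cases hux : u = x
    · subst hux
      rw [hR.parent_unique huv hp]
    · dsimp only at hne
      rw [hoff u hux, hoff v hvx] at hne
      exact absurd rfl hne

/-- The classification of merge tree changes for graphs that stay connected when a vertex is
removed. -/
theorem classification [Finite V] (hG : ∀ a b, ReachIn G Set.univ a b)
    (hcut : ∀ v a b, a ≠ v → b ≠ v → ReachIn G {v}ᶜ a b) (h : Passes f g x y)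
    (hoff : ∀ u, u ≠ x → f u = g u) (hrise : f x < g x) :
    (IsVerticalSwap G x y f g →
      mergeTree G f = mergeTree G g ∧
      (∃! v, v ∈ (mergeTree G f).verts ∧ f v ≠ g v) ∧
      (∃! e, e ∈ (mergeTree G f).edges ∧ |f e.1 - f e.2| ≠ |g e.1 - g e.2|) ∧
      IsMaximumVertex G f x ∧ IsMaximumVertex G f y ∧
      IsMaximumVertex G g x ∧ IsMaximumVertex G g y ∧
      (∃ bx b_y, (mergeTree G f).IsBranchAt f x bx ∧ (mergeTree G f).IsBranchAt f y b_y ∧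
        IsParentBranch b_y bx) ∧
      (∃ bx b_y, (mergeTree G g).IsBranchAt g x bx ∧ (mergeTree G g).IsBranchAt g y b_y ∧
        IsParentBranch bx b_y)) ∧
    (IsEdgeSplit G x y f g → BDTIncluded G x y f g →
      Disjoint (mergeTree G f).verts {x, y} ∧
      (mergeTree G g).verts = (mergeTree G f).verts ∪ {x, y} ∧
      ∃ c p, (c, p) ∈ (mergeTree G f).edges ∧
        (mergeTree G g).edges =
          ((mergeTree G f).edges \ {(c, p)}) ∪ {(x, y), (c, y), (y, p)} ∧
        (bdt G g).verts = subdivide p c y '' (bdt G f).verts ∪ {[y, x]}) ∧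
    (IsHorizontalSwap G x y f g →
      ((y, x) ∈ (mergeTree G f).edges ∧ (x, y) ∈ (mergeTree G g).edges ∧
        IsSaddleVertex G f x ∧ IsSaddleVertex G f y ∧
        IsSaddleVertex G g x ∧ IsSaddleVertex G g y) ∨
      SaddleSplits G x y f g ∨
      SaddleSplits G y x g f) ∧
    (IsSimpleChange G x y f g →
      EqualUpToRenaming G x y f g ∨
      (|((mergeTree G f).verts.ncard : ℤ) - ((mergeTree G g).verts.ncard : ℤ)| = 1 ∧
        |((mergeTree G f).edges.ncard : ℤ) - ((mergeTree G g).edges.ncard : ℤ)| = 1 ∧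
        |((bdt G f).verts.ncard : ℤ) - ((bdt G g).verts.ncard : ℤ)| = 1 ∧
        |((bdt G f).edges.ncard : ℤ) - ((bdt G g).edges.ncard : ℤ)| = 1)) := by
  have : Nonempty V := ⟨x⟩
  have hR := isTreeOrder_mergeLE hG h.inj
  have hR' := isTreeOrder_mergeLE hG h.inj'
  have hsingle := fun r (_ : IsLowest (MergeLE G f) r) =>
    exists_single_child (f := f) hcut h.ne r
  have hsingle' := fun r (_ : IsLowest (MergeLE G g) r) =>
    exists_single_child (f := g) hcut h.ne r
  have hEq : ∀ {σ : Equiv.Perm V}, RenamesOnly x y σ →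
      NodeIso σ (MergeLE G f) (MergeLE G g) f g → EqualUpToRenaming G x y f g :=
    equalUpToRenaming_of_nodeIso hR hR'
  unfold IsVerticalSwap IsEdgeSplit IsHorizontalSwap IsSimpleChange BDTIncluded
  rw [treeIncluded_iff hR hR', treeIncluded_iff hR' hR, obdtIncluded_iff hR hR',
    obdtIncluded_iff hR' hR, saddleSplits_iff hR hR', saddleSplits_iff hR' hR,
    hR.isMaximumVertex_iff, hR.isMaximumVertex_iff, hR'.isMaximumVertex_iff,
    hR'.isMaximumVertex_iff, hR.isSaddleVertex_iff, hR.isSaddleVertex_iff,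
    hR'.isSaddleVertex_iff, hR'.isSaddleVertex_iff]
  unfold bdt
  rw [hR.mergeTree_eq, hR'.mergeTree_eq]
  have edges := hR.ncard_edges
  have edges' := hR'.ncard_edges
  have hbdt : (branchDecompositionTree (nodeTree (MergeLE G f)) f).edges.ncard + 1 =
      (branchDecompositionTree (nodeTree (MergeLE G f)) f).verts.ncard := by
    obtain ⟨r, hr⟩ := hR.root
    obtain ⟨w, hw, hw'⟩ := hsingle r hr
    exact hR.ncard_bdt_edges h.inj hr hw hw'
  have hbdt' : (branchDecompositionTree (nodeTree (MergeLE G g)) g).edges.ncard + 1 =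
      (branchDecompositionTree (nodeTree (MergeLE G g)) g).verts.ncard := by
    obtain ⟨r, hr⟩ := hR'.root
    obtain ⟨w, hw, hw'⟩ := hsingle' r hr
    exact hR'.ncard_bdt_edges h.inj' hr hw hw'
  have iso : ∀ σ : Equiv.Perm V, RenamesOnly x y σ →
      NodeIso σ (MergeLE G f) (MergeLE G g) f g →
      NodeTreeIncluded (MergeLE G f) (MergeLE G g) x y ∧
      BranchesIncluded (MergeLE G f) (MergeLE G g) f g x y := fun σ hσ hi =>
    ⟨nodeTreeIncluded_of_nodeIso hσ hi, σ, hσ, hi.obdtSubgraph hR hR'⟩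
  by_cases hl : MergeLE G f x y
  · have L := h.linked hG hcut hl
    rcases L.cases with ⟨σ, hσ, hi⟩ | ⟨ha, hs⟩ | ⟨ha, hs⟩ | ⟨ht, hk⟩ | ⟨ht, hk⟩
    · obtain ⟨h1, h2⟩ := iso σ hσ hi
      exact ⟨fun H => absurd h2 H.2.1, fun H => absurd h1 H.1, fun H => absurd h1 H.1,
        fun _ => Or.inl (hEq hσ hi)⟩
    · have t1 := L.not_nodeTreeIncluded ha hs
      have t2 := L.not_nodeTreeIncluded' ha hs
      exact ⟨fun H => (H.1.elim t1 t2).elim,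
        fun H => (H.2.2.elim (L.not_branchesIncluded ha hs) (L.not_branchesIncluded' ha hs)).elim,
        fun _ => L.saddlesChange ha hs, fun H => (H.1.elim t1 t2).elim⟩
    · have t1 := fun H => L.symm.not_nodeTreeIncluded ha hs (NodeTreeIncluded.symm_names H)
      have t2 := fun H => L.symm.not_nodeTreeIncluded' ha hs (NodeTreeIncluded.symm_names H)
      have b1 := fun H => L.symm.not_branchesIncluded ha hs (BranchesIncluded.symm_names H)
      have b2 := fun H => L.symm.not_branchesIncluded' ha hs (BranchesIncluded.symm_names H)
      exact ⟨fun H => (H.1.elim t2 t1).elim, fun H => (H.2.2.elim b2 b1).elim,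
        fun _ => (L.symm.saddlesChange ha hs).symm, fun H => (H.1.elim t2 t1).elim⟩
    · have b := L.branchesIncluded_of_tip ht hk
      by_cases hy : IsReg (MergeLE G f) y
      · obtain ⟨c, p, e1, e2, e3, e4, e5⟩ := L.exists_split_edge ht hk hy
        have t1 := L.not_nodeTreeIncluded_of_split ht hk hy e1 e2 e3 e4 e5
        have t2 := L.not_nodeTreeIncluded_of_verts ht hk hy
        refine ⟨fun H => (H.1.elim t1 t2).elim, fun _ _ => ⟨?_, L.verts_of_split ht hk hy,
          c, p, e1, L.edges_of_split ht hk hy e1 e2 e3 e4 e5,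
          L.branches_of_split ht hk hy e1 e2 e3 e4 e5⟩, fun H => absurd b H.2.2.1,
          fun H => (H.1.elim t1 t2).elim⟩
        rw [Set.disjoint_left]
        rintro v hv (rfl | rfl)
        · exact hv (L.reg_of_tip ht hk)
        · exact hv hy
      · have t := L.nodeTreeIncluded_of_tip ht hk hy
        have c1 := L.ncard_verts_of_tip ht hk hy
        have c2 := L.ncard_branches_of_tip ht hk
        refine ⟨fun H => absurd b H.2.1, fun H => absurd t H.1, fun H => absurd t H.1,
          fun _ => Or.inr ⟨?_, ?_, ?_, ?_⟩⟩ <;> rw [abs_eq one_pos.le] <;> omega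
    · have b := (L.symm.branchesIncluded_of_tip ht hk).symm_names
      by_cases hx : IsReg (MergeLE G g) x
      · obtain ⟨c, p, e1, e2, e3, e4, e5⟩ := L.symm.exists_split_edge ht hk hx
        have t1 := fun H => L.symm.not_nodeTreeIncluded_of_split ht hk hx e1 e2 e3 e4 e5
          (NodeTreeIncluded.symm_names H)
        have t2 := fun H => L.symm.not_nodeTreeIncluded_of_verts ht hk hx
          (NodeTreeIncluded.symm_names H)
        exact ⟨fun H => (H.1.elim t2 t1).elim, fun _ ⟨σ, hσ, H⟩ =>
          (L.symm.not_bdtSubgraph_of_split ht hk hx e1 e2 e3 e4 e5 hσ.symm H).elim,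
          fun H => absurd b H.2.2.2, fun H => (H.1.elim t2 t1).elim⟩
      · have t := (L.symm.nodeTreeIncluded_of_tip ht hk hx).symm_names
        have c1 := L.symm.ncard_verts_of_tip ht hk hx
        have c2 := L.symm.ncard_branches_of_tip ht hk
        refine ⟨fun H => absurd b H.2.2, fun H => absurd t H.2.1, fun H => absurd t H.2.1,
          fun _ => Or.inr ⟨?_, ?_, ?_, ?_⟩⟩ <;> rw [abs_eq one_pos.le] <;> omega
  · have hRR := h.mergeLE_eq_of_not_link hl
    by_cases ht : IsTip (MergeLE G f) x ∧ IsTip (MergeLE G f) y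
    · by_cases hv : ∃ v, MergeLE G f v x ∧ IsHighest (MergeLE G f) f v y
      · obtain ⟨v, hvx, hv⟩ := hv
        obtain ⟨s, M⟩ := exists_meeting h hR hsingle ht.1 ht.2 hvx hv
        have hlx : ¬ IsLowest (MergeLE G f) x := fun hl => M.ne (hR.eq_of_le_bot hl M.le)
        have hly : ¬ IsLowest (MergeLE G f) y := fun hl => M.ne' (hR.eq_of_le_bot hl M.le')
        have t : NodeTreeIncluded (MergeLE G f) (MergeLE G g) x y := by
          rw [← hRR]
          exact nodeTreeIncluded_refl _ x y
        refine ⟨fun _ => ⟨by rw [hRR], ⟨x, ⟨not_reg_of_tip ht.1, hrise.ne⟩, fun u hu => ?_⟩,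
          existsUnique_edge_length hR MergeLE.le hoff hrise ht.1 hlx, ⟨hlx, ht.1⟩, ⟨hly, ht.2⟩,
          hRR ▸ ⟨hlx, ht.1⟩, hRR ▸ ⟨hly, ht.2⟩, M.exists_branches, ?_⟩,
          fun H => absurd t H.1, fun H => absurd t H.1, fun H => Or.inl ?_⟩
        · by_contra hux
          exact hu.2 (hoff u hux)
        · rw [← hRR]
          obtain ⟨b_y, bx, h1, h2, h3⟩ := M.symm.exists_branches
          exact ⟨bx, b_y, h2, h1, h3⟩
        · rcases H.2 with ⟨σ, hσ, H⟩ | ⟨σ, hσ, H⟩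
          · rw [← hRR] at H
            have hi := M.nodeIso_of_branchMap hσ
              (branchMap_of_bdtSubgraph hR hR (bdtSubgraph_of_obdtSubgraph H))
            exact hEq (renamesOnly_swap x y) (hRR ▸ hi)
          · rw [← hRR] at H
            have hi := M.symm.nodeIso_of_branchMap hσ.symm
              (branchMap_of_bdtSubgraph hR hR (bdtSubgraph_of_obdtSubgraph H))
            exact hEq (renamesOnly_swap y x).symm.inv (hRR ▸ hi.symm)
      · push Not at hv
        have hi : NodeIso (Equiv.refl V) (MergeLE G f) (MergeLE G g) f g :=
          hRR ▸ nodeIso_refl_of_not_highest h ht.2 (fun v hvx _ => hv v hvx)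
        obtain ⟨h1, h2⟩ := iso _ (renamesOnly_refl x y) hi
        exact ⟨fun H => absurd h2 H.2.1, fun H => absurd h1 H.1, fun H => absurd h1 H.1,
          fun _ => Or.inl (hEq (renamesOnly_refl x y) hi)⟩
    · have hi : NodeIso (Equiv.refl V) (MergeLE G f) (MergeLE G g) f g :=
        hRR ▸ nodeIso_refl_of_not_tip hR h ht
      obtain ⟨h1, h2⟩ := iso _ (renamesOnly_refl x y) hi
      exact ⟨fun H => absurd h2 H.2.1, fun H => absurd h1 H.1, fun H => absurd h1 H.1,
        fun _ => Or.inl (hEq (renamesOnly_refl x y) hi)⟩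

end Classification

theorem lemma1 {N d : ℕ} (hd : 2 ≤ d)
    (K : Geometry.SimplicialComplex ℝ (EuclideanSpace ℝ (Fin N)))
    (hfin : K.faces.Finite) (hconn : IsConnected K.space)
    [ChartedSpace (EuclideanSpace ℝ (Fin d)) K.space]
    (f g : K.vertices → ℝ) (hf : Function.Injective f) (hg : Function.Injective g)
    (x y : K.vertices) (hpert : IsMinimalVertexPerturbation f g x)
    (hpass : SwapsPosition f g x y) (hrise : f x < g x) :
    (IsVerticalSwap (vertexGraph K) x y f g →
      mergeTree (vertexGraph K) f = mergeTree (vertexGraph K) g ∧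
      (∃! v, v ∈ (mergeTree (vertexGraph K) f).verts ∧ f v ≠ g v) ∧
      (∃! e, e ∈ (mergeTree (vertexGraph K) f).edges ∧ |f e.1 - f e.2| ≠ |g e.1 - g e.2|) ∧
      IsMaximumVertex (vertexGraph K) f x ∧ IsMaximumVertex (vertexGraph K) f y ∧
      IsMaximumVertex (vertexGraph K) g x ∧ IsMaximumVertex (vertexGraph K) g y ∧
      (∃ bx b_y, (mergeTree (vertexGraph K) f).IsBranchAt f x bx ∧ (mergeTree (vertexGraph K) f).IsBranchAt f y b_y ∧ IsParentBranch b_y bx) ∧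
      (∃ bx b_y, (mergeTree (vertexGraph K) g).IsBranchAt g x bx ∧ (mergeTree (vertexGraph K) g).IsBranchAt g y b_y ∧ IsParentBranch bx b_y)) ∧
    (IsEdgeSplit (vertexGraph K) x y f g → BDTIncluded (vertexGraph K) x y f g →
      Disjoint (mergeTree (vertexGraph K) f).verts {x, y} ∧
      (mergeTree (vertexGraph K) g).verts = (mergeTree (vertexGraph K) f).verts ∪ {x, y} ∧
      ∃ c p, (c, p) ∈ (mergeTree (vertexGraph K) f).edges ∧
        (mergeTree (vertexGraph K) g).edges = ((mergeTree (vertexGraph K) f).edges \ {(c, p)}) ∪ {(x, y), (c, y), (y, p)} ∧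
        (bdt (vertexGraph K) g).verts = subdivide p c y '' (bdt (vertexGraph K) f).verts ∪ {[y, x]}) ∧
    (IsHorizontalSwap (vertexGraph K) x y f g →
      ((y, x) ∈ (mergeTree (vertexGraph K) f).edges ∧ (x, y) ∈ (mergeTree (vertexGraph K) g).edges ∧
        IsSaddleVertex (vertexGraph K) f x ∧ IsSaddleVertex (vertexGraph K) f y ∧
        IsSaddleVertex (vertexGraph K) g x ∧ IsSaddleVertex (vertexGraph K) g y) ∨
      SaddleSplits (vertexGraph K) x y f g ∨
      SaddleSplits (vertexGraph K) y x g f) ∧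
    (IsSimpleChange (vertexGraph K) x y f g →
      EqualUpToRenaming (vertexGraph K) x y f g ∨
      (|((mergeTree (vertexGraph K) f).verts.ncard : ℤ) - ((mergeTree (vertexGraph K) g).verts.ncard : ℤ)| = 1 ∧
        |((mergeTree (vertexGraph K) f).edges.ncard : ℤ) - ((mergeTree (vertexGraph K) g).edges.ncard : ℤ)| = 1 ∧
        |((bdt (vertexGraph K) f).verts.ncard : ℤ) - ((bdt (vertexGraph K) g).verts.ncard : ℤ)| = 1 ∧
        |((bdt (vertexGraph K) f).edges.ncard : ℤ) - ((bdt (vertexGraph K) g).edges.ncard : ℤ)| = 1)) := by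
  classical
  have := K.finite_vertices hfin
  have hrank : 1 < Module.rank ℝ (EuclideanSpace ℝ (Fin d)) := by
    rw [← Module.finrank_eq_rank, finrank_euclideanSpace_fin]
    exact_mod_cast hd
  exact classification (K.reachIn_univ hfin hconn) (K.reachIn_compl_singleton hfin hconn hrank)
    (hpass.passes hf hg hpert.2.1 hrise) hpert.2.1 hrise
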